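/- Let $A$ and $B$ be separable $C^*$-algebras (not necessarily unital; $B$ is not assumed stable) and let $J\subseteq A$ be a $C^*$-subalgebra. Let $M(B)$ be the multiplier algebra of $B$, regard $B\subseteq M(B)$, and put $IB=C([0,1],B)$. For $s\in[0,1]$ let $\widetilde{\pi_s}:M(IB)\to M(B)$ be the $*$-homomorphism induced by the point evaluation $\pi_s:IB\to B$, $f\mapsto f(s)$. An asymptotic homomorphism $\varphi=(\varphi_t)_{t\in[1,\infty)}:A\to E$ into a $C^*$-algebra $E$ is a family of maps $\varphi_t:A\to E$ such that $t\mapsto\varphi_t(a)$ is norm-continuous for every $a\in A$, and such that, as $t\to\infty$, the elements $\varphi_t(a+b)-\varphi_t(a)-\varphi_t(b)$, $\varphi_t(\lambda a)-\lambda\varphi_t(a)$, $\varphi_t(ab)-\varphi_t(a)\varphi_t(b)$ and $\varphi_t(a^*)-\varphi_t(a)^*$ tend to $0$ in norm for all $a,b\in A$, $\lambda\in\mathbb C$. For a $C^*$-algebra $D$, an asymptotic homomorphism $\varphi:A\to M(D)$ is *extended* (from $J$) if $\varphi_t(J)\subseteq D$ for all $t$; it is *constantly extended* if, in addition, $\varphi_t(x)-\varphi_1(x)\in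 D$ for all $x\in A$ and all $t\in[1,\infty)$. Two extended (respectively constantly extended) asymptotic homomorphisms $\varphi,\psi:A\to M(B)$ are *homotopic* if there is an extended (respectively constantly extended) asymptotic homomorphism $\Phi:A\to M(IB)$ with $\widetilde{\pi_0}\circ\Phi_t=\varphi_t$ and $\widetilde{\pi_1}\circ\Phi_t=\psi_t$ for all $t\in[1,\infty)$. Homotopy is an equivalence relation in both cases; let $[[A,J;B]]$ denote the set of homotopy classes of extended asymptotic homomorphisms $A\to M(B)$, and $[\{A,J;B\}]$ the set of homotopy classes of constantly extended ones. **Theorem.** The canonical (forgetful) map $[\{A,J;B\}]\to[[A,J;B]]$, sending the class of a constantly extended asymptotic homomorphism to its class as an extended asymptotic homomorphism, is a bijection. -/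

import Mathlib

namespace AsympExt

open Filter Topology
open scoped unitInterval MultiplierAlgebra

section Multipliers

variable {B : Type*} [NonUnitalCStarAlgebra B]

/-- `B` regarded as a subset (an ideal) of its multiplier algebra `M(B)`. -/
noncomputable def inM (B : Type*) [NonUnitalCStarAlgebra B] : AddSubgroup 𝓜(ℂ, B) :=
  AddMonoidHom.range (DoubleCentralizer.coeHom (𝕜 := ℂ) (A := B) : B →+ 𝓜(ℂ, B))

theorem mem_inM {m : 𝓜(ℂ, B)} : m ∈ inM B ↔ ∃ b : B, (b : 𝓜(ℂ, B)) = m := Iff.rfl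

/-- An element of a C⋆-algebra is determined by the products with it from the left. -/
theorem eq_of_mul_left {a b : B} (h : ∀ x : B, x * a = x * b) : a = b := by
  have h1 : star (a - b) * (a - b) = 0 := by rw [mul_sub, h, sub_self]
  exact sub_eq_zero.1 ((CStarRing.star_mul_self_eq_zero_iff _).1 h1)

theorem eq_of_mul_right {a b : B} (h : ∀ x : B, a * x = b * x) : a = b := by
  have h1 : (a - b) * star (a - b) = 0 := by rw [sub_mul, h, sub_self]
  exact sub_eq_zero.1 ((CStarRing.mul_star_self_eq_zero_iff _).1 h1)

/-- A multiplier is determined by its action from the left. -/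
theorem ext_fst {m n : 𝓜(ℂ, B)} (h : ∀ b, m.fst b = n.fst b) : m = n := by
  refine DoubleCentralizer.ext _ _ _ _ (Prod.ext (ContinuousLinearMap.ext h) ?_)
  refine ContinuousLinearMap.ext fun x => eq_of_mul_right fun y => ?_
  rw [m.central, n.central, h]

theorem coe_inj {a b : B} (h : (a : 𝓜(ℂ, B)) = b) : a = b :=
  eq_of_mul_right fun x => congrArg (fun m : 𝓜(ℂ, B) => m.fst x) h

/-- `f ↦ f(s)`, precomposed with the constant functions and postcomposed with a multiplier: the
value at `s` of the action of an operator on `IB = C([0,1], B)` on a constant function. -/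
noncomputable def evOp (s : I) (T : C(I, B) →L[ℂ] C(I, B)) : B →L[ℂ] B :=
  LinearMap.mkContinuous
    { toFun := fun b => T (ContinuousMap.const I b) s
      map_add' := fun x y => by
        rw [← ContinuousMap.add_apply, ← map_add]; rfl
      map_smul' := fun c x => by
        rw [RingHom.id_apply, ← ContinuousMap.smul_apply, ← map_smul]; rfl }
    ‖T‖ fun b => by
      refine ((T (ContinuousMap.const I b)).norm_coe_le_norm s).trans ?_
      refine (T.le_opNorm _).trans ?_
      gcongr
      exact (ContinuousMap.norm_le _ (norm_nonneg b)).2 fun _ => le_rfl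

theorem evOp_apply (s : I) (T : C(I, B) →L[ℂ] C(I, B)) (b : B) :
    evOp s T b = T (ContinuousMap.const I b) s := rfl

/-- For `m ∈ M(IB)` the value `(m f)(s)` depends only on `f(s)`. -/
theorem fst_apply (m : 𝓜(ℂ, C(I, B))) (f : C(I, B)) (s : I) :
    m.fst f s = m.fst (ContinuousMap.const I (f s)) s := by
  refine eq_of_mul_left fun x => ?_
  have h1 := congrArg (fun g : C(I, B) => g s) (m.central (ContinuousMap.const I x) f)
  have h2 := congrArg (fun g : C(I, B) => g s)
    (m.central (ContinuousMap.const I x) (ContinuousMap.const I (f s)))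
  exact h1.symm.trans h2

theorem snd_apply (m : 𝓜(ℂ, C(I, B))) (f : C(I, B)) (s : I) :
    m.snd f s = m.snd (ContinuousMap.const I (f s)) s := by
  refine eq_of_mul_right fun x => ?_
  have h1 := congrArg (fun g : C(I, B) => g s) (m.central f (ContinuousMap.const I x))
  have h2 := congrArg (fun g : C(I, B) => g s)
    (m.central (ContinuousMap.const I (f s)) (ContinuousMap.const I x))
  exact h1.trans h2.symm

/-- The ⋆-homomorphism `M(IB) → M(B)` induced by the point evaluation `IB → B`, `f ↦ f(s)`, where
`IB = C([0,1], B)`. It is characterized by `(evM s m) f(s) = (m f)(s)` and `f(s) (evM s m) = (f m)(s)`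
for all `f ∈ IB`, see `evM_fst` and `evM_snd`. -/
noncomputable def evM (s : I) : 𝓜(ℂ, C(I, B)) →⋆ₐ[ℂ] 𝓜(ℂ, B) where
  toFun m :=
    { fst := evOp s m.fst
      snd := evOp s m.snd
      central := fun x y => congrArg (fun g : C(I, B) => g s)
        (m.central (ContinuousMap.const I x) (ContinuousMap.const I y)) }
  map_one' := rfl
  map_mul' m n := ext_fst fun b => fst_apply m (n.fst (ContinuousMap.const I b)) s
  map_zero' := rfl
  map_add' _ _ := rfl
  commutes' _ := rfl
  map_star' _ := ext_fst fun _ => rfl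

theorem evM_fst (s : I) (m : 𝓜(ℂ, C(I, B))) (f : C(I, B)) :
    (evM s m).fst (f s) = m.fst f s := (fst_apply m f s).symm

theorem evM_snd (s : I) (m : 𝓜(ℂ, C(I, B))) (f : C(I, B)) :
    (evM s m).snd (f s) = m.snd f s := (snd_apply m f s).symm

theorem evM_coe (s : I) (f : C(I, B)) :
    evM s (f : 𝓜(ℂ, C(I, B))) = (f s : 𝓜(ℂ, B)) := rfl

theorem evM_ext {m n : 𝓜(ℂ, C(I, B))} (h : ∀ s, evM s m = evM s n) : m = n :=
  ext_fst fun f => ContinuousMap.ext fun s => by rw [← evM_fst, ← evM_fst, h]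

theorem norm_le_of_evM {m : 𝓜(ℂ, C(I, B))} {C : ℝ} (hC : 0 ≤ C) (h : ∀ s, ‖evM s m‖ ≤ C) :
    ‖m‖ ≤ C := by
  rw [← DoubleCentralizer.norm_fst]
  refine ContinuousLinearMap.opNorm_le_bound _ hC fun f => ?_
  refine (ContinuousMap.norm_le _ (by positivity)).2 fun s => ?_
  rw [← evM_fst]
  refine ((evM s m).fst.le_opNorm _).trans ?_
  rw [DoubleCentralizer.norm_fst]
  exact mul_le_mul (h s) (f.norm_coe_le_norm s) (norm_nonneg _) hC

/-- The operator on `C([0,1], B)` defined pointwise by a bounded, pointwise continuous family of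
operators on `B`. -/
noncomputable def famOp (T : I → B →L[ℂ] B) (C : ℝ) (hC : ∀ s, ‖T s‖ ≤ C)
    (hT : ∀ b, Continuous fun s => T s b) : C(I, B) →L[ℂ] C(I, B) :=
  LinearMap.mkContinuous
    { toFun := fun f =>
        { toFun := fun s => T s (f s)
          continuous_toFun := by
            have h : Continuous fun p : B × I => T p.2 p.1 := by
              refine continuous_prod_of_continuous_lipschitzWith _ (Real.toNNReal C) hT fun s => ?_
              exact (T s).lipschitz.weaken (by
                rw [← NNReal.coe_le_coe]; exact (hC s).trans (Real.le_coe_toNNReal C))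
            exact h.comp (f.continuous.prodMk continuous_id) }
      map_add' := fun f g => ContinuousMap.ext fun s => map_add (T s) _ _
      map_smul' := fun c f => ContinuousMap.ext fun s => map_smul (T s) _ _ }
    C fun f => by
      have hC0 : 0 ≤ C := (norm_nonneg _).trans (hC 0)
      refine (ContinuousMap.norm_le _ (by positivity)).2 fun s => ?_
      refine ((T s).le_opNorm _).trans ?_
      exact mul_le_mul (hC s) (f.norm_coe_le_norm s) (norm_nonneg _) hC0

/-- A norm-bounded strictly continuous family `s ↦ m(s) ∈ M(B)`, `s ∈ [0,1]`, is a multiplier of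
`IB`. -/
noncomputable def ofFamily (m : I → 𝓜(ℂ, B)) (C : ℝ) (hC : ∀ s, ‖m s‖ ≤ C)
    (h1 : ∀ b, Continuous fun s => (m s).fst b) (h2 : ∀ b, Continuous fun s => (m s).snd b) :
    𝓜(ℂ, C(I, B)) where
  fst := famOp (fun s => (m s).fst) C (fun s => by rw [DoubleCentralizer.norm_fst]; exact hC s) h1
  snd := famOp (fun s => (m s).snd) C (fun s => by rw [DoubleCentralizer.norm_snd]; exact hC s) h2
  central := fun f g => ContinuousMap.ext fun s => (m s).central (f s) (g s)

theorem evM_ofFamily (m : I → 𝓜(ℂ, B)) (C : ℝ) (hC : ∀ s, ‖m s‖ ≤ C)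
    (h1 : ∀ b, Continuous fun s => (m s).fst b) (h2 : ∀ b, Continuous fun s => (m s).snd b)
    (s : I) : evM s (ofFamily m C hC h1 h2) = m s := rfl

theorem continuous_evM_fst (m : 𝓜(ℂ, C(I, B))) (b : B) :
    Continuous fun s => (evM s m).fst b := (m.fst (ContinuousMap.const I b)).continuous

theorem continuous_evM_snd (m : 𝓜(ℂ, C(I, B))) (b : B) :
    Continuous fun s => (evM s m).snd b := (m.snd (ContinuousMap.const I b)).continuous

theorem norm_evM_le (s : I) (m : 𝓜(ℂ, C(I, B))) : ‖evM s m‖ ≤ ‖m‖ :=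
  NonUnitalStarAlgHom.norm_apply_le (evM s) m

end Multipliers

section AsymptoticHomomorphisms

variable {A : Type*} [NonUnitalCStarAlgebra A]

/-- Asymptotic homomorphisms `φ = (φ_t)`, `t ∈ [1,∞)`, between C⋆-algebras. -/
structure IsAsymptoticHom {E : Type*} [NonUnitalCStarAlgebra E]
    (φ : Set.Ici (1 : ℝ) → A → E) : Prop where
  continuous : ∀ a, Continuous fun t => φ t a
  add : ∀ a b, Tendsto (fun t => φ t (a + b) - (φ t a + φ t b)) atTop (𝓝 0)
  smul : ∀ (c : ℂ) a, Tendsto (fun t => φ t (c • a) - c • φ t a) atTop (𝓝 0)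
  mul : ∀ a b, Tendsto (fun t => φ t (a * b) - φ t a * φ t b) atTop (𝓝 0)
  star : ∀ a, Tendsto (fun t => φ t (star a) - star (φ t a)) atTop (𝓝 0)

/-- The first parameter value, `1 ∈ [1,∞)`. -/
def start : Set.Ici (1 : ℝ) := ⟨1, Set.mem_Ici.2 le_rfl⟩

/-- Asymptotic homomorphisms `A → M(B)` extended from `J`: `φ_t(J) ⊆ B` for all `t`. -/
@[ext]
structure ExtHom (J : NonUnitalStarSubalgebra ℂ A) (B : Type*) [NonUnitalCStarAlgebra B] where
  toFun : Set.Ici (1 : ℝ) → A → 𝓜(ℂ, B)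
  isAsymptoticHom : IsAsymptoticHom toFun
  extended : ∀ t, ∀ x ∈ J, toFun t x ∈ inM B

/-- Asymptotic homomorphisms `A → M(B)` constantly extended from `J`: in addition `φ_t` is
independent of `t` modulo `B`. -/
@[ext]
structure ConstExtHom (J : NonUnitalStarSubalgebra ℂ A) (B : Type*) [NonUnitalCStarAlgebra B]
    extends ExtHom J B where
  constant : ∀ t, ∀ x : A, toFun t x - toFun start x ∈ inM B

variable (J : NonUnitalStarSubalgebra ℂ A) (B : Type*) [NonUnitalCStarAlgebra B]

/-- Homotopy of extended asymptotic homomorphisms, through an extended asymptotic homomorphism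
`A → M(IB)`, where `IB = C([0,1], B)`. -/
def ExtHom.Homotopic (φ ψ : ExtHom J B) : Prop :=
  ∃ Φ : ExtHom J C(I, B), (∀ t a, evM 0 (Φ.toFun t a) = φ.toFun t a) ∧
    ∀ t a, evM 1 (Φ.toFun t a) = ψ.toFun t a

/-- Homotopy of constantly extended asymptotic homomorphisms, through a constantly extended
asymptotic homomorphism `A → M(IB)`, where `IB = C([0,1], B)`. -/
def ConstExtHom.Homotopic (φ ψ : ConstExtHom J B) : Prop :=
  ∃ Φ : ConstExtHom J C(I, B), (∀ t a, evM 0 (Φ.toFun t a) = φ.toFun t a) ∧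
    ∀ t a, evM 1 (Φ.toFun t a) = ψ.toFun t a

section Equivalence

/-! Homotopy is an equivalence relation. -/

variable {J B}

/-- A family of maps into `M(IB)` is an asymptotic homomorphism as soon as at each `s` it is
obtained, by a ⋆-homomorphism, from one of two asymptotic homomorphisms. -/
theorem isAsymptoticHom_of_evM {D₁ D₂ : Type*} [NonUnitalCStarAlgebra D₁]
    [NonUnitalCStarAlgebra D₂] {φ₁ : Set.Ici (1 : ℝ) → A → D₁} {φ₂ : Set.Ici (1 : ℝ) → A → D₂}
    (h₁ : IsAsymptoticHom φ₁) (h₂ : IsAsymptoticHom φ₂)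
    (Φ : Set.Ici (1 : ℝ) → A → 𝓜(ℂ, C(I, B)))
    (h : ∀ s, (∃ χ : D₁ →⋆ₙₐ[ℂ] 𝓜(ℂ, B), ∀ t a, evM s (Φ t a) = χ (φ₁ t a)) ∨
      ∃ χ : D₂ →⋆ₙₐ[ℂ] 𝓜(ℂ, B), ∀ t a, evM s (Φ t a) = χ (φ₂ t a)) :
    IsAsymptoticHom Φ := by
  have key : ∀ (m : 𝓜(ℂ, C(I, B))) (d₁ : D₁) (d₂ : D₂),
      (∀ s, (∃ χ : D₁ →⋆ₙₐ[ℂ] 𝓜(ℂ, B), evM s m = χ d₁) ∨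
        ∃ χ : D₂ →⋆ₙₐ[ℂ] 𝓜(ℂ, B), evM s m = χ d₂) → ‖m‖ ≤ ‖d₁‖ + ‖d₂‖ := by
    intro m d₁ d₂ hm
    refine norm_le_of_evM (by positivity) fun s => ?_
    rcases hm s with ⟨χ, hχ⟩ | ⟨χ, hχ⟩
    · rw [hχ]
      exact (NonUnitalStarAlgHom.norm_apply_le χ d₁).trans (by linarith [norm_nonneg d₂])
    · rw [hχ]
      exact (NonUnitalStarAlgHom.norm_apply_le χ d₂).trans (by linarith [norm_nonneg d₁])
  have lim : ∀ (l : Filter (Set.Ici (1 : ℝ))) (m : Set.Ici (1 : ℝ) → 𝓜(ℂ, C(I, B)))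
      (d₁ : Set.Ici (1 : ℝ) → D₁) (d₂ : Set.Ici (1 : ℝ) → D₂),
      Tendsto d₁ l (𝓝 0) → Tendsto d₂ l (𝓝 0) → (∀ t, ‖m t‖ ≤ ‖d₁ t‖ + ‖d₂ t‖) →
      Tendsto m l (𝓝 0) := by
    intro l m d₁ d₂ hd₁ hd₂ hm
    refine squeeze_zero_norm hm ?_
    simpa using hd₁.norm.add hd₂.norm
  refine ⟨fun a => ?_, fun a b => ?_, fun c a => ?_, fun a b => ?_, fun a => ?_⟩
  · rw [continuous_iff_continuousAt]
    intro t₀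
    refine tendsto_sub_nhds_zero_iff.1 ?_
    refine lim _ _ (fun t => φ₁ t a - φ₁ t₀ a) (fun t => φ₂ t a - φ₂ t₀ a)
      (tendsto_sub_nhds_zero_iff.2 ((h₁.continuous a).tendsto t₀))
      (tendsto_sub_nhds_zero_iff.2 ((h₂.continuous a).tendsto t₀)) fun t => key _ _ _ fun s => ?_
    exact (h s).imp (fun ⟨χ, hχ⟩ => ⟨χ, by simp only [map_sub, hχ]⟩)
      (fun ⟨χ, hχ⟩ => ⟨χ, by simp only [map_sub, hχ]⟩)
  · refine lim _ _ _ _ (h₁.add a b) (h₂.add a b) fun t => key _ _ _ fun s => ?_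
    exact (h s).imp (fun ⟨χ, hχ⟩ => ⟨χ, by simp only [map_sub, map_add, hχ]⟩)
      (fun ⟨χ, hχ⟩ => ⟨χ, by simp only [map_sub, map_add, hχ]⟩)
  · refine lim _ _ _ _ (h₁.smul c a) (h₂.smul c a) fun t => key _ _ _ fun s => ?_
    exact (h s).imp (fun ⟨χ, hχ⟩ => ⟨χ, by simp only [map_sub, map_smul, hχ]⟩)
      (fun ⟨χ, hχ⟩ => ⟨χ, by simp only [map_sub, map_smul, hχ]⟩)
  · refine lim _ _ _ _ (h₁.mul a b) (h₂.mul a b) fun t => key _ _ _ fun s => ?_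
    exact (h s).imp (fun ⟨χ, hχ⟩ => ⟨χ, by simp only [map_sub, map_mul, hχ]⟩)
      (fun ⟨χ, hχ⟩ => ⟨χ, by simp only [map_sub, map_mul, hχ]⟩)
  · refine lim _ _ _ _ (h₁.star a) (h₂.star a) fun t => key _ _ _ fun s => ?_
    exact (h s).imp (fun ⟨χ, hχ⟩ => ⟨χ, by simp only [map_sub, map_star, hχ]⟩)
      (fun ⟨χ, hχ⟩ => ⟨χ, by simp only [map_sub, map_star, hχ]⟩)

/-- The constant multiplier of `IB` given by `m ∈ M(B)`. -/
noncomputable def constM (m : 𝓜(ℂ, B)) : 𝓜(ℂ, C(I, B)) :=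
  ofFamily (fun _ => m) ‖m‖ (fun _ => le_rfl) (fun _ => continuous_const) fun _ => continuous_const

theorem constM_sub (m n : 𝓜(ℂ, B)) : constM (m - n) = constM m - constM n := rfl

theorem constM_mem {m : 𝓜(ℂ, B)} (h : m ∈ inM B) : constM m ∈ inM C(I, B) := by
  obtain ⟨b, rfl⟩ := mem_inM.1 h
  exact mem_inM.2 ⟨ContinuousMap.const I b, evM_ext fun _ => rfl⟩

/-- The reversal of a multiplier of `IB`. -/
noncomputable def symmM (m : 𝓜(ℂ, C(I, B))) : 𝓜(ℂ, C(I, B)) :=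
  ofFamily (fun s => evM (σ s) m) ‖m‖ (fun _ => norm_evM_le _ m)
    (fun b => (continuous_evM_fst m b).comp unitInterval.continuous_symm)
    fun b => (continuous_evM_snd m b).comp unitInterval.continuous_symm

theorem symmM_sub (m n : 𝓜(ℂ, C(I, B))) : symmM (m - n) = symmM m - symmM n := rfl

theorem symmM_mem {m : 𝓜(ℂ, C(I, B))} (h : m ∈ inM C(I, B)) : symmM m ∈ inM C(I, B) := by
  obtain ⟨f, rfl⟩ := mem_inM.1 h
  exact mem_inM.2 ⟨f.comp ⟨σ, unitInterval.continuous_symm⟩, evM_ext fun _ => rfl⟩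

/-- Concatenation of functions on `[0,1]`. -/
noncomputable def glue {X : Type*} (f g : I → X) (s : I) : X :=
  if (s : ℝ) ≤ 1 / 2 then f (Set.projIcc 0 1 zero_le_one (2 * (s : ℝ)))
  else g (Set.projIcc 0 1 zero_le_one (2 * (s : ℝ) - 1))

theorem glue_zero {X : Type*} (f g : I → X) : glue f g 0 = f 0 := by
  simp [glue]

theorem glue_one {X : Type*} (f g : I → X) : glue f g 1 = g 1 := by
  rw [glue, if_neg (by norm_num)]
  norm_num

theorem glue_cases {X : Type*} (s : I) : ∃ s' : I,
    (∀ f g : I → X, glue f g s = f s') ∨ (∀ f g : I → X, glue f g s = g s') := by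
  by_cases hs : (s : ℝ) ≤ 1 / 2
  · exact ⟨_, Or.inl fun f g => if_pos hs⟩
  · exact ⟨_, Or.inr fun f g => if_neg hs⟩

theorem glue_comp {X Y : Type*} (k : X → Y) (f g : I → X) (s : I) :
    k (glue f g s) = glue (fun r => k (f r)) (fun r => k (g r)) s := by
  unfold glue; split <;> rfl

theorem continuous_glue {X : Type*} [TopologicalSpace X] {f g : I → X} (hf : Continuous f)
    (hg : Continuous g) (h : f 1 = g 0) : Continuous (glue f g) := by
  unfold glue
  refine Continuous.if_le ?_ ?_ continuous_subtype_val continuous_const fun _ hs => ?_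
  · exact hf.comp (continuous_projIcc.comp (by fun_prop))
  · exact hg.comp (continuous_projIcc.comp (by fun_prop))
  · rw [hs]; norm_num [h]

/-- Concatenation of multipliers of `IB`. -/
noncomputable def transM (m n : 𝓜(ℂ, C(I, B))) (h : evM 1 m = evM 0 n) : 𝓜(ℂ, C(I, B)) :=
  ofFamily (glue (fun s => evM s m) (fun s => evM s n)) (‖m‖ + ‖n‖)
    (fun s => by
      obtain ⟨s', hs | hs⟩ := glue_cases (X := 𝓜(ℂ, B)) s
      · rw [hs]; exact (norm_evM_le _ m).trans (by linarith [norm_nonneg n])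
      · rw [hs]; exact (norm_evM_le _ n).trans (by linarith [norm_nonneg m]))
    (fun b => by
      simp only [glue_comp (fun m : 𝓜(ℂ, B) => m.fst b)]
      exact continuous_glue (continuous_evM_fst m b) (continuous_evM_fst n b) (by rw [h]))
    (fun b => by
      simp only [glue_comp (fun m : 𝓜(ℂ, B) => m.snd b)]
      exact continuous_glue (continuous_evM_snd m b) (continuous_evM_snd n b) (by rw [h]))

theorem evM_transM (m n : 𝓜(ℂ, C(I, B))) (h : evM 1 m = evM 0 n) (s : I) :
    evM s (transM m n h) = glue (fun s => evM s m) (fun s => evM s n) s := rfl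

theorem evM_zero_transM (m n : 𝓜(ℂ, C(I, B))) (h : evM 1 m = evM 0 n) :
    evM 0 (transM m n h) = evM 0 m := by
  rw [evM_transM, glue_zero]

theorem evM_one_transM (m n : 𝓜(ℂ, C(I, B))) (h : evM 1 m = evM 0 n) :
    evM 1 (transM m n h) = evM 1 n := by
  rw [evM_transM, glue_one]

theorem transM_sub (m n m' n' : 𝓜(ℂ, C(I, B))) (h : evM 1 m = evM 0 n)
    (h' : evM 1 m' = evM 0 n') :
    transM m n h - transM m' n' h' = transM (m - m') (n - n') (by simp only [map_sub, h, h']) := by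
  refine evM_ext fun s => ?_
  rw [map_sub, evM_transM, evM_transM, evM_transM]
  obtain ⟨s', hs | hs⟩ := glue_cases (X := 𝓜(ℂ, B)) s <;> simp only [hs, map_sub]

theorem transM_mem {m n : 𝓜(ℂ, C(I, B))} (h : evM 1 m = evM 0 n) (hm : m ∈ inM C(I, B))
    (hn : n ∈ inM C(I, B)) : transM m n h ∈ inM C(I, B) := by
  obtain ⟨f, rfl⟩ := mem_inM.1 hm
  obtain ⟨g, rfl⟩ := mem_inM.1 hn
  have hfg : f 1 = g 0 := coe_inj h
  refine mem_inM.2 ⟨⟨glue f g, continuous_glue f.continuous g.continuous hfg⟩,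
    evM_ext fun s => ?_⟩
  rw [evM_transM, evM_coe]
  exact glue_comp (fun b : B => (b : 𝓜(ℂ, B))) f g s

/-- The constant homotopy. -/
noncomputable def ExtHom.const (φ : ExtHom J B) : ExtHom J C(I, B) where
  toFun t a := constM (φ.toFun t a)
  isAsymptoticHom := isAsymptoticHom_of_evM φ.isAsymptoticHom φ.isAsymptoticHom _
    fun _ => Or.inl ⟨NonUnitalStarAlgHom.id ℂ _, fun _ _ => rfl⟩
  extended t x hx := constM_mem (φ.extended t x hx)

/-- The reversed homotopy. -/
noncomputable def ExtHom.symm (Φ : ExtHom J C(I, B)) : ExtHom J C(I, B) where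
  toFun t a := symmM (Φ.toFun t a)
  isAsymptoticHom := isAsymptoticHom_of_evM Φ.isAsymptoticHom Φ.isAsymptoticHom _
    fun s => Or.inl ⟨(evM (σ s) : 𝓜(ℂ, C(I, B)) →⋆ₐ[ℂ] 𝓜(ℂ, B)), fun _ _ => rfl⟩
  extended t x hx := symmM_mem (Φ.extended t x hx)

/-- The concatenation of two homotopies. -/
noncomputable def ExtHom.trans (Φ Ψ : ExtHom J C(I, B))
    (h : ∀ t a, evM 1 (Φ.toFun t a) = evM 0 (Ψ.toFun t a)) : ExtHom J C(I, B) where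
  toFun t a := transM (Φ.toFun t a) (Ψ.toFun t a) (h t a)
  isAsymptoticHom := isAsymptoticHom_of_evM Φ.isAsymptoticHom Ψ.isAsymptoticHom _ fun s => by
    obtain ⟨s', hs | hs⟩ := glue_cases (X := 𝓜(ℂ, B)) s
    · exact Or.inl ⟨(evM s' : 𝓜(ℂ, C(I, B)) →⋆ₐ[ℂ] 𝓜(ℂ, B)), fun t a => by rw [evM_transM, hs]; rfl⟩
    · exact Or.inr ⟨(evM s' : 𝓜(ℂ, C(I, B)) →⋆ₐ[ℂ] 𝓜(ℂ, B)), fun t a => by rw [evM_transM, hs]; rfl⟩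
  extended t x hx := transM_mem _ (Φ.extended t x hx) (Ψ.extended t x hx)

end Equivalence

theorem ExtHom.equivalence : Equivalence (ExtHom.Homotopic J B) where
  refl φ := ⟨φ.const, fun _ _ => rfl, fun _ _ => rfl⟩
  symm := fun ⟨Φ, h0, h1⟩ => ⟨Φ.symm,
    fun t a => (congrArg (fun s => evM s (Φ.toFun t a)) unitInterval.symm_zero).trans (h1 t a),
    fun t a => (congrArg (fun s => evM s (Φ.toFun t a)) unitInterval.symm_one).trans (h0 t a)⟩
  trans := fun ⟨Φ, h0, h1⟩ ⟨Ψ, k0, k1⟩ =>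
    ⟨Φ.trans Ψ fun t a => (h1 t a).trans (k0 t a).symm,
      fun t a => (evM_zero_transM _ _ ((h1 t a).trans (k0 t a).symm)).trans (h0 t a),
      fun t a => (evM_one_transM _ _ ((h1 t a).trans (k0 t a).symm)).trans (k1 t a)⟩

theorem ConstExtHom.equivalence : Equivalence (ConstExtHom.Homotopic J B) where
  refl φ := ⟨⟨φ.toExtHom.const, fun t x => constM_mem (φ.constant t x)⟩,
    fun _ _ => rfl, fun _ _ => rfl⟩
  symm := fun ⟨Φ, h0, h1⟩ => ⟨⟨Φ.toExtHom.symm, fun t x => symmM_mem (Φ.constant t x)⟩,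
    fun t a => (congrArg (fun s => evM s (Φ.toFun t a)) unitInterval.symm_zero).trans (h1 t a),
    fun t a => (congrArg (fun s => evM s (Φ.toFun t a)) unitInterval.symm_one).trans (h0 t a)⟩
  trans := fun ⟨Φ, h0, h1⟩ ⟨Ψ, k0, k1⟩ =>
    ⟨⟨Φ.toExtHom.trans Ψ.toExtHom fun t a => (h1 t a).trans (k0 t a).symm, fun t x => by
        simp only [ExtHom.trans, transM_sub]
        exact transM_mem _ (Φ.constant t x) (Ψ.constant t x)⟩,
      fun t a => (evM_zero_transM _ _ ((h1 t a).trans (k0 t a).symm)).trans (h0 t a),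
      fun t a => (evM_one_transM _ _ ((h1 t a).trans (k0 t a).symm)).trans (k1 t a)⟩

instance ExtHom.setoid : Setoid (ExtHom J B) := ⟨ExtHom.Homotopic J B, ExtHom.equivalence J B⟩

instance ConstExtHom.setoid : Setoid (ConstExtHom J B) :=
  ⟨ConstExtHom.Homotopic J B, ConstExtHom.equivalence J B⟩

/-- `[[A,J;B]]`: the homotopy classes of extended asymptotic homomorphisms. -/
def ExtClasses : Type _ := Quotient (ExtHom.setoid J B)

/-- `[{A,J;B}]`: the homotopy classes of constantly extended asymptotic homomorphisms. -/
def ConstExtClasses : Type _ := Quotient (ConstExtHom.setoid J B)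

/-- The canonical (forgetful) map `[{A,J;B}] → [[A,J;B]]`. -/
def forget : ConstExtClasses J B → ExtClasses J B :=
  Quotient.map (fun φ => φ.toExtHom) fun _ _ ⟨Φ, h0, h1⟩ => ⟨Φ.toExtHom, h0, h1⟩

end AsymptoticHomomorphisms

end AsympExt

/-!
An extended asymptotic homomorphism is made constantly extended by compressing it with a
quasi-central approximate unit, and the same compression, applied to a homotopy, serves for
surjectivity and for injectivity.

Let `D` be a separable C⋆-algebra. A quasi-central system (`QCSystem`, `exists_qcSystem`) consists of
`v n ∈ D` that are almost units on the earlier ones, converge strictly to the unit of `M(D)`, and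
almost commute with prescribed multipliers;
put `c n = 1 - v n`, and let `d n ∈ D` be such that `c n ^ 2 + d n ^ 2 = 1`. A bounded sequence `y` of
multipliers has a compression
`T k y = ∑ₙ c_k ⋯ c_{n-1} d_n y_n d_n c_{n-1} ⋯ c_k` (sum over `n ≥ k`, in the strict topology), which
satisfies `T k y = d_k y_k d_k + c_k (T (k+1) y) c_k`. If `y` and `z` vary slowly and almost commute
with the system, the defect `T k (y z) - T k y * T k z` obeys a recursion with errors that are small
by the *exact* factorization `defect_rec`; hence `T k` is almost multiplicative
(`norm_T_mul_sub_mul_le`). Moreover `T k y - T (k+1) y` is always in `D` (`T_sub_T_succ_mem`), because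
both depend on the tail of `y` only, up to terms with a factor `v k` or `d k`. So if `φ` is an
asymptotic homomorphism into `M(D)`, sampled at suitable times `t_0 < t_1 < ⋯`, then
`k ↦ T k (φ_{t_n}(a))_{n ≥ k}`, interpolated in `k`, is constant modulo `D`.

In order to join `φ` to this compression, take `D = C([0,1], B)`, and replace the sampling times `t_n`
by the continuous functions `min t_n (max t_k (1 / γ(s)))` of `s ∈ [0,1]` (`Grid.cutoff`), for a
function `γ : [0,1] → [0,1]`. Where `γ = 1` the sequence is constant in `n ≥ k`, with value
`φ_{t_k}(a)`, and its compression is asymptotic to `φ`; where `γ = 0` the sequence does not depend on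
`k`, and the compression is constant modulo `B` (`IsAdapted.tendsto_evM_compression_sub`,
`IsAdapted.evM_compression_sub_mem`). Asymptotic families are homotopic through the straight line.
With `γ(s) = 1 - s` and the constant homotopy at `φ`, this gives surjectivity. For injectivity, a
homotopy between constantly extended `φ` and `ψ` is first prolonged by constant homotopies at both
ends, and `γ` is taken to be `1` at the end points and `0` on the part where the homotopy need not be
constantly extended; then the compression is constantly extended over all of `C([0,1], B)`
(`IsAdapted.compression_sub_mem`), and its ends are asymptotic to `φ` and `ψ`.
-/

namespace AsympExt

open Filter Topology
open scoped unitInterval MultiplierAlgebra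

/-! ### Multiplier algebras and quasi-central elements -/

section MultiplierBasics

variable {D : Type*} [NonUnitalCStarAlgebra D]

/-- The inclusion `D → M(D)` as a ⋆-homomorphism. -/
noncomputable abbrev toM : D →⋆ₙₐ[ℂ] 𝓜(ℂ, D) := DoubleCentralizer.coeHom

theorem toM_mem (b : D) : toM b ∈ inM D := ⟨b, rfl⟩

theorem toM_injective : Function.Injective (toM : D → 𝓜(ℂ, D)) := fun _ _ h => coe_inj h

theorem norm_toM (b : D) : ‖(toM b : 𝓜(ℂ, D))‖ = ‖b‖ :=
  NonUnitalStarAlgHom.norm_map (toM : D →⋆ₙₐ[ℂ] 𝓜(ℂ, D)) toM_injective b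

theorem isometry_toM : Isometry (toM : D → 𝓜(ℂ, D)) :=
  AddMonoidHomClass.isometry_of_norm _ norm_toM

theorem mul_toM (m : 𝓜(ℂ, D)) (b : D) : m * toM b = toM (m.fst b) := by
  refine ext_fst fun x => eq_of_mul_left fun y => ?_
  change y * m.fst (b * x) = y * (m.fst b * x)
  rw [← mul_assoc, ← m.central, ← m.central, mul_assoc]

theorem toM_mul (m : 𝓜(ℂ, D)) (b : D) : toM b * m = toM (m.snd b) :=
  ext_fst fun x => (m.central b x).symm

theorem inM_mul_left (m : 𝓜(ℂ, D)) {x : 𝓜(ℂ, D)} (h : x ∈ inM D) : m * x ∈ inM D := by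
  obtain ⟨b, rfl⟩ := h
  exact ⟨_, (mul_toM m b).symm⟩

theorem inM_mul_right (m : 𝓜(ℂ, D)) {x : 𝓜(ℂ, D)} (h : x ∈ inM D) : x * m ∈ inM D := by
  obtain ⟨b, rfl⟩ := h
  exact ⟨_, (toM_mul m b).symm⟩

theorem inM_smul (c : ℂ) {x : 𝓜(ℂ, D)} (h : x ∈ inM D) : c • x ∈ inM D := by
  obtain ⟨b, rfl⟩ := h
  exact ⟨c • b, map_smul toM c b⟩

theorem isClosed_inM : IsClosed (inM D : Set 𝓜(ℂ, D)) :=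
  (isometry_toM (D := D)).isClosedEmbedding.isClosed_range

theorem norm_fst_apply (m : 𝓜(ℂ, D)) (b : D) : ‖m.fst b‖ = ‖m * toM b‖ := by
  rw [mul_toM, norm_toM]

theorem norm_fst_le (m : 𝓜(ℂ, D)) (b : D) : ‖m.fst b‖ ≤ ‖m‖ * ‖b‖ := by
  rw [← DoubleCentralizer.norm_fst]; exact m.fst.le_opNorm b

theorem norm_snd_le (m : 𝓜(ℂ, D)) (b : D) : ‖m.snd b‖ ≤ ‖m‖ * ‖b‖ := by
  rw [← DoubleCentralizer.norm_snd]; exact m.snd.le_opNorm b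

theorem norm_le_of_fst {m : 𝓜(ℂ, D)} {C : ℝ} (hC : 0 ≤ C) (h : ∀ b, ‖m.fst b‖ ≤ C * ‖b‖) :
    ‖m‖ ≤ C := by
  rw [← DoubleCentralizer.norm_fst]
  exact ContinuousLinearMap.opNorm_le_bound _ hC h

end MultiplierBasics

section QuasiCentral

/-- Quasi-orthogonality: if the products `star (x j) * x i` are small for `i < j`, the norm of
`∑ x i` grows like the square root of the number of summands. -/
theorem norm_sq_sum_le {E : Type*} [NonUnitalCStarAlgebra E] (x : ℕ → E) {M ε : ℝ}
    (hM : ∀ i, ‖x i‖ ≤ M) (hx : ∀ i j, i < j → ‖star (x j) * x i‖ ≤ ε) (N : ℕ) :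
    ‖∑ i ∈ Finset.range N, x i‖ ^ 2 ≤ N * M ^ 2 + N ^ 2 * ε := by
  have hM0 : 0 ≤ M := (norm_nonneg _).trans (hM 0)
  have hε : 0 ≤ ε := (norm_nonneg _).trans (hx 0 1 zero_lt_one)
  have h1 : ∀ i j, ‖star (x j) * x i‖ ≤ (if i = j then M ^ 2 else 0) + ε := by
    intro i j
    rcases lt_trichotomy i j with h | h | h
    · rw [if_neg h.ne, zero_add]; exact hx i j h
    · subst h
      rw [if_pos rfl, CStarRing.norm_star_mul_self]
      nlinarith [hM i, norm_nonneg (x i)]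
    · rw [if_neg h.ne', zero_add, ← norm_star, star_mul, star_star]; exact hx j i h
  rw [sq, ← CStarRing.norm_star_mul_self, star_sum, Finset.sum_mul_sum]
  calc _ ≤ ∑ j ∈ Finset.range N, ∑ i ∈ Finset.range N, ((if i = j then M ^ 2 else 0) + ε) :=
        norm_sum_le_of_le _ fun j _ => norm_sum_le_of_le _ fun i _ => h1 i j
    _ = N * M ^ 2 + N ^ 2 * ε := by
        simp only [Finset.sum_add_distrib, Finset.sum_ite_eq', Finset.sum_const, Finset.card_range,
          nsmul_eq_mul]
        rw [Finset.sum_congr rfl (fun j hj => if_pos hj)]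
        simp; ring

variable {D : Type*} [NonUnitalCStarAlgebra D] [PartialOrder D] [StarOrderedRing D]

/-- One step of the construction of a quasi-central approximate unit: along an approximate unit
`w`, the commutator `[w, y]` becomes orthogonal to any fixed commutator `[u, y]`. -/
theorem tendsto_star_commutator_mul (y : 𝓜(ℂ, D)) (u : D) :
    Tendsto (fun w : D => star (toM w * y - y * toM w) * (toM u * y - y * toM u))
      (CStarAlgebra.approximateUnit D) (𝓝 0) := by
  have hl := CStarAlgebra.increasingApproximateUnit D
  set b : D := y.snd u - y.fst u
  have hb : toM u * y - y * toM u = toM b := by rw [mul_toM, toM_mul, map_sub]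
  have h1 : Tendsto (fun w : D => toM ((star y).fst (w * b) - w * (star y).fst b))
      (CStarAlgebra.approximateUnit D) (𝓝 (toM ((star y).fst b - (star y).fst b))) :=
    (isometry_toM.continuous.tendsto _).comp
      ((((star y).fst.continuous.tendsto _).comp (hl.tendsto_mul_right b)).sub
        (hl.tendsto_mul_right _))
  rw [sub_self, map_zero] at h1
  refine h1.congr' ?_
  filter_upwards [hl.eventually_star_eq] with w hw
  rw [hb, star_sub, star_mul, star_mul, ← map_star, hw, sub_mul, mul_assoc, mul_assoc, ← map_mul,
    mul_toM, mul_toM, ← map_mul, ← map_sub]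

/-- Quasi-central approximate units exist: a convex combination of sufficiently many elements of
an approximate unit, each an approximate unit for the commutators produced by the earlier ones,
almost commutes with finitely many given multipliers. -/
theorem exists_quasicentral (F : Finset 𝓜(ℂ, D)) (K : Finset D) {ε : ℝ} (hε : 0 < ε) :
    ∃ v : D, 0 ≤ v ∧ ‖v‖ ≤ 1 ∧ (∀ b ∈ K, ‖b - v * b‖ ≤ ε) ∧
      ∀ y ∈ F, ‖toM v * y - y * toM v‖ ≤ ε := by
  have hl := CStarAlgebra.increasingApproximateUnit D
  have := hl.neBot
  obtain ⟨M, hM⟩ : ∃ M : ℝ, ∀ y ∈ F, ‖y‖ ≤ M := by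
    obtain ⟨M, hM⟩ := (F.image fun y => ‖y‖).bddAbove
    exact ⟨M, fun y hy => hM (by simpa using ⟨y, hy, rfl⟩)⟩
  obtain ⟨u, hu, hu'⟩ := exists_seq_of_forall_finset_exists
    (fun u : D => 0 ≤ u ∧ ‖u‖ ≤ 1 ∧ ∀ b ∈ K, ‖b - u * b‖ ≤ ε)
    (fun u w => ∀ y ∈ F,
      ‖star (toM w * y - y * toM w) * (toM u * y - y * toM u)‖ ≤ ε ^ 2 / 2) (by
    intro s _
    have h1 : ∀ᶠ w in CStarAlgebra.approximateUnit D, ∀ b ∈ K, ‖b - w * b‖ ≤ ε := by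
      rw [Filter.eventually_all_finset]
      intro b _
      have := (tendsto_const_nhds (x := b)).sub (hl.tendsto_mul_right b)
      rw [sub_self] at this
      exact (this.norm.eventually (Iic_mem_nhds (by simpa using hε)))
    have h2 : ∀ᶠ w in CStarAlgebra.approximateUnit D, ∀ x ∈ s, ∀ y ∈ F,
        ‖star (toM w * y - y * toM w) * (toM x * y - y * toM x)‖ ≤ ε ^ 2 / 2 := by
      rw [Filter.eventually_all_finset]
      intro x _
      rw [Filter.eventually_all_finset]
      intro y _
      exact ((tendsto_star_commutator_mul y x).norm.eventually
        (Iic_mem_nhds (by rw [norm_zero]; positivity)))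
    obtain ⟨w, hw⟩ := (hl.eventually_nonneg.and (hl.eventually_norm.and (h1.and h2))).exists
    exact ⟨w, ⟨hw.1, hw.2.1, hw.2.2.1⟩, hw.2.2.2⟩)
  -- `N` is so large that `(2 * M) ^ 2 / N ≤ ε ^ 2 / 2`
  obtain ⟨N, hN⟩ := exists_nat_gt ((2 * M) ^ 2 / (ε ^ 2 / 2))
  have hN0 : (0 : ℝ) < N := lt_of_le_of_lt (by positivity) hN
  have hNc : ‖((N : ℝ)⁻¹ : ℂ)‖ = (N : ℝ)⁻¹ := by simp
  have hNne : (N : ℂ) ≠ 0 := by exact_mod_cast hN0.ne'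
  have key : ∀ {E : Type _} [NormedAddCommGroup E] [NormedSpace ℂ E] (x : ℕ → E) (C : ℝ),
      (∀ i, ‖x i‖ ≤ C) → ‖((N : ℝ)⁻¹ : ℂ) • ∑ i ∈ Finset.range N, x i‖ ≤ C := by
    intro E _ _ x C hx
    rw [norm_smul, hNc, inv_mul_le_iff₀ hN0]
    refine (norm_sum_le_of_le _ fun i _ => hx i).trans ?_
    simp
  refine ⟨((N : ℝ)⁻¹ : ℂ) • ∑ i ∈ Finset.range N, u i, ?_, ?_, ?_, ?_⟩
  · have : ((N : ℝ)⁻¹ : ℂ) • ∑ i ∈ Finset.range N, u i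
        = (N : ℝ)⁻¹ • ∑ i ∈ Finset.range N, u i := by
      rw [← Complex.coe_smul (N : ℝ)⁻¹]; simp
    rw [this]
    exact smul_nonneg (by positivity) (Finset.sum_nonneg fun i _ => (hu i).1)
  · exact key u 1 fun i => (hu i).2.1
  · intro b hb
    have : b - (((N : ℝ)⁻¹ : ℂ) • ∑ i ∈ Finset.range N, u i) * b
        = ((N : ℝ)⁻¹ : ℂ) • ∑ i ∈ Finset.range N, (b - u i * b) := by
      rw [Finset.sum_sub_distrib, smul_sub, Finset.sum_const, Finset.card_range,
        smul_mul_assoc, Finset.sum_mul, ← Nat.cast_smul_eq_nsmul ℂ, smul_smul]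
      simp [hNne]
    rw [this]
    exact key _ ε fun i => (hu i).2.2 b hb
  · intro y hy
    have hsum : toM (((N : ℝ)⁻¹ : ℂ) • ∑ i ∈ Finset.range N, u i) * y
        - y * toM (((N : ℝ)⁻¹ : ℂ) • ∑ i ∈ Finset.range N, u i)
        = ((N : ℝ)⁻¹ : ℂ) • ∑ i ∈ Finset.range N, (toM (u i) * y - y * toM (u i)) := by
      rw [map_smul, map_sum, smul_mul_assoc, mul_smul_comm, ← smul_sub, Finset.sum_mul,
        Finset.mul_sum, Finset.sum_sub_distrib]
    have hD : ∀ i, ‖toM (u i) * y - y * toM (u i)‖ ≤ 2 * M := by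
      intro i
      have h1 : ‖toM (u i)‖ ≤ 1 := (norm_toM (u i)).trans_le (hu i).2.1
      have h2 := hM y hy
      have h3 := norm_mul_le (toM (u i)) y
      have h4 := norm_mul_le y (toM (u i))
      have h5 := norm_sub_le (toM (u i) * y) (y * toM (u i))
      nlinarith [norm_nonneg y, norm_nonneg (toM (u i))]
    have h := norm_sq_sum_le (fun i => toM (u i) * y - y * toM (u i)) hD
      (fun i j hij => hu' i j hij y hy) N
    rw [hsum, norm_smul, hNc, inv_mul_le_iff₀ hN0]
    refine abs_le_of_sq_le_sq' ?_ (by positivity) |>.2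
    refine h.trans ?_
    rw [div_lt_iff₀ (by positivity)] at hN
    nlinarith

end QuasiCentral

/-! ### Quasi-central systems -/

section FunctionalCalculus

/-- The commutator with a polynomial in `x` is controlled by the commutator with `x`, uniformly
for `x` in the unit ball. -/
theorem exists_norm_aeval_commutator_le {E : Type*} [CStarAlgebra E] (y : E) (p : Polynomial ℝ) :
    ∃ C : ℝ, 0 ≤ C ∧ ∀ x : E, ‖x‖ ≤ 1 →
      ‖Polynomial.aeval x p * y - y * Polynomial.aeval x p‖ ≤ C * ‖x * y - y * x‖ := by
  induction p using Polynomial.induction_on' with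
  | add p q hp hq =>
    obtain ⟨C, hC, h⟩ := hp
    obtain ⟨C', hC', h'⟩ := hq
    refine ⟨C + C', by positivity, fun x hx => ?_⟩
    have : Polynomial.aeval x (p + q) * y - y * Polynomial.aeval x (p + q)
        = (Polynomial.aeval x p * y - y * Polynomial.aeval x p)
          + (Polynomial.aeval x q * y - y * Polynomial.aeval x q) := by
      rw [map_add]; noncomm_ring
    rw [this, add_mul]
    exact (norm_add_le _ _).trans (add_le_add (h x hx) (h' x hx))
  | monomial n a =>
    refine ⟨|a| * n, by positivity, fun x hx => ?_⟩
    have hpow : ∀ n : ℕ, ‖x ^ n * y - y * x ^ n‖ ≤ n * ‖x * y - y * x‖ := by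
      intro n
      induction n with
      | zero => simp
      | succ n ih =>
        have h1 : x ^ (n + 1) * y - y * x ^ (n + 1)
            = x * (x ^ n * y - y * x ^ n) + (x * y - y * x) * x ^ n := by
          rw [pow_succ']; noncomm_ring
        have h2 : ‖(x * y - y * x) * x ^ n‖ ≤ ‖x * y - y * x‖ := by
          rcases n.eq_zero_or_pos with rfl | hn
          · simp
          · exact (norm_mul_le _ _).trans (mul_le_of_le_one_right (norm_nonneg _)
              ((norm_pow_le' x hn).trans (pow_le_one₀ (norm_nonneg _) hx)))
        rw [h1]
        push_cast
        refine (norm_add_le _ _).trans ?_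
        have h3 := norm_mul_le x (x ^ n * y - y * x ^ n)
        nlinarith [norm_nonneg x, norm_nonneg (x ^ n * y - y * x ^ n)]
    rw [Polynomial.aeval_monomial]
    have : algebraMap ℝ E a * x ^ n * y - y * (algebraMap ℝ E a * x ^ n)
        = a • (x ^ n * y - y * x ^ n) := by
      rw [← Algebra.smul_def, smul_mul_assoc, mul_smul_comm, smul_sub]
    rw [this, norm_smul, Real.norm_eq_abs, mul_assoc]
    gcongr
    exact hpow n

/-- If a self-adjoint `x` with spectrum in `[0, 1]` almost commutes with `y`, so does `f(x)`, for a
fixed continuous function `f`. -/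
theorem exists_norm_cfc_commutator_le {E : Type*} [CStarAlgebra E] (y : E) {f : ℝ → ℝ}
    (hf : ContinuousOn f (Set.Icc 0 1)) {ε : ℝ} (hε : 0 < ε) :
    ∃ δ > 0, ∀ x : E, IsSelfAdjoint x → spectrum ℝ x ⊆ Set.Icc 0 1 → ‖x‖ ≤ 1 →
      ‖x * y - y * x‖ ≤ δ → ‖cfc f x * y - y * cfc f x‖ ≤ ε := by
  obtain ⟨p, hp⟩ := exists_polynomial_near_of_continuousOn 0 1 f hf (ε / (4 * (‖y‖ + 1)))
    (by positivity)
  obtain ⟨C, hC, h⟩ := exists_norm_aeval_commutator_le y p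
  refine ⟨ε / (2 * (C + 1)), by positivity, fun x hx hs hx1 hxy => ?_⟩
  have h1 : ‖cfc f x - Polynomial.aeval x p‖ ≤ ε / (4 * (‖y‖ + 1)) := by
    rw [← cfc_polynomial (R := ℝ) p x hx, ← cfc_sub f _ x (hf.mono hs)]
    refine norm_cfc_le (by positivity) fun t ht => ?_
    rw [Real.norm_eq_abs, abs_sub_comm]
    exact (hp t (hs ht)).le
  have h2 : cfc f x * y - y * cfc f x
      = (Polynomial.aeval x p * y - y * Polynomial.aeval x p)
        + ((cfc f x - Polynomial.aeval x p) * y - y * (cfc f x - Polynomial.aeval x p)) := by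
    noncomm_ring
  have h3 : ‖(cfc f x - Polynomial.aeval x p) * y - y * (cfc f x - Polynomial.aeval x p)‖
      ≤ ε / 2 := by
    refine (norm_sub_le_of_le (norm_mul_le _ _) (norm_mul_le _ _)).trans ?_
    calc _ ≤ ε / (4 * (‖y‖ + 1)) * (‖y‖ + 1) + (‖y‖ + 1) * (ε / (4 * (‖y‖ + 1))) := by
          gcongr <;> linarith
      _ = ε / 2 := by field_simp; ring
  have h4 : C * ‖x * y - y * x‖ ≤ ε / 2 := by
    calc _ ≤ (C + 1) * (ε / (2 * (C + 1))) := by gcongr; linarith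
      _ = ε / 2 := by field_simp
  rw [h2]
  refine (norm_add_le _ _).trans ?_
  linarith [h x hx1]

variable {D : Type*} [NonUnitalCStarAlgebra D]

/-- The element `√(1 - (1 - v)²) = √(2v - v²)` of `D`. -/
noncomputable def dOf (v : D) : D := cfcₙ (fun x : ℝ => √(2 * x - x ^ 2)) v

theorem star_dOf (v : D) : star (dOf v) = dOf v :=
  (cfcₙ_predicate (R := ℝ) _ v : IsSelfAdjoint _)

theorem commute_dOf {v : D} (hv : IsSelfAdjoint v) : v * dOf v = dOf v * v := by
  have h := cfcₙ_commute_cfcₙ (fun x : ℝ => x) (fun x : ℝ => √(2 * x - x ^ 2)) v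
  rw [cfcₙ_id' ℝ v] at h
  exact h

section Order

variable [PartialOrder D] [StarOrderedRing D]

theorem spectrum_toM_subset {v : D} (hv : 0 ≤ v) (hv1 : ‖v‖ ≤ 1) :
    spectrum ℝ (toM v) ⊆ Set.Icc 0 1 := by
  intro x hx
  let _ := CStarAlgebra.spectralOrder 𝓜(ℂ, D)
  have := CStarAlgebra.spectralOrderedRing 𝓜(ℂ, D)
  have h0 : 0 ≤ toM v := map_nonneg toM hv
  have : Nontrivial 𝓜(ℂ, D) := by
    by_contra h
    rw [not_nontrivial_iff_subsingleton] at h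
    rw [spectrum.of_subsingleton] at hx
    exact hx
  have h1 : ‖x‖ ≤ ‖toM v‖ := by
    have := spectrum.norm_le_norm_of_mem hx
    simpa using this
  exact ⟨spectrum_nonneg_of_nonneg h0 hx, (le_abs_self x).trans (h1.trans ((norm_toM v).trans_le hv1))⟩

theorem toM_dOf {v : D} (hv : 0 ≤ v) :
    toM (dOf v) = cfc (fun x : ℝ => √(2 * x - x ^ 2)) (toM v) := by
  have hsa : IsSelfAdjoint v := IsSelfAdjoint.of_nonneg hv
  have hsa' : IsSelfAdjoint (toM v) := hsa.map toM
  rw [dOf, NonUnitalStarAlgHom.map_cfcₙ (toM : D →⋆ₙₐ[ℂ] 𝓜(ℂ, D)) _ v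
    (by fun_prop) (by simp) isometry_toM.continuous hsa hsa', cfcₙ_eq_cfc (by fun_prop) (by simp)]

theorem toM_dOf_mul_self {v : D} (hv : 0 ≤ v) (hv1 : ‖v‖ ≤ 1) :
    (1 - toM v) * (1 - toM v) + toM (dOf v) * toM (dOf v) = 1 := by
  have hsa : IsSelfAdjoint (toM v) := (IsSelfAdjoint.of_nonneg hv).map toM
  have h : toM (dOf v) * toM (dOf v) = 2 * toM v - toM v ^ 2 := by
    rw [toM_dOf hv, ← cfc_mul _ _ _ (by fun_prop) (by fun_prop)]
    have h2 : Set.EqOn (fun x : ℝ => √(2 * x - x ^ 2) * √(2 * x - x ^ 2))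
        (fun x => (2 * Polynomial.X - Polynomial.X ^ 2 : Polynomial ℝ).eval x)
        (spectrum ℝ (toM v)) := by
      intro x hx
      have hx' := spectrum_toM_subset hv hv1 hx
      simp only [Polynomial.eval_sub, Polynomial.eval_mul, Polynomial.eval_pow, Polynomial.eval_X,
        Polynomial.eval_ofNat]
      exact Real.mul_self_sqrt (by nlinarith [hx'.1, hx'.2])
    rw [cfc_congr h2, cfc_polynomial _ _ hsa]
    simp [map_ofNat]
  rw [h]; noncomm_ring

theorem exists_norm_dOf_commutator_le (y : 𝓜(ℂ, D)) {ε : ℝ} (hε : 0 < ε) :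
    ∃ δ > 0, ∀ v : D, 0 ≤ v → ‖v‖ ≤ 1 → ‖toM v * y - y * toM v‖ ≤ δ →
      ‖toM (dOf v) * y - y * toM (dOf v)‖ ≤ ε := by
  obtain ⟨δ, hδ, h⟩ := exists_norm_cfc_commutator_le y
    (f := fun x : ℝ => √(2 * x - x ^ 2)) (by fun_prop) hε
  refine ⟨δ, hδ, fun v hv hv1 hvy => ?_⟩
  rw [toM_dOf hv]
  exact h _ ((IsSelfAdjoint.of_nonneg hv).map toM) (spectrum_toM_subset hv hv1)
    ((norm_toM v).trans_le hv1) hvy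

end Order

/-- In a C⋆-algebra, `star c * c + star d * d = 1` forces `‖c‖ ≤ 1`. -/
theorem norm_le_one_of_add_eq_one {E : Type*} [CStarAlgebra E] {c d : E}
    (h : star c * c + star d * d = 1) : ‖c‖ ≤ 1 := by
  let _ := CStarAlgebra.spectralOrder E
  have := CStarAlgebra.spectralOrderedRing E
  have h1 : star c * c ≤ 1 := by
    rw [← h]; exact le_add_of_nonneg_right (star_mul_self_nonneg d)
  have h2 := (CStarAlgebra.norm_le_one_iff_of_nonneg _ (star_mul_self_nonneg c)).2 h1
  rw [CStarRing.norm_star_mul_self] at h2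
  nlinarith [norm_nonneg c]

end FunctionalCalculus

section Systems

/-- A quasi-central system: elements `v n ∈ D`, written as multipliers, such that `c n = 1 - v n`
satisfies `c n ^ 2 + d n ^ 2 = 1` for some `d n ∈ D`, and such that `v n` is close to being a unit
on the earlier `v m` and `d m` and, eventually, on every element of `D`. -/
structure QCSystem (D : Type*) [NonUnitalCStarAlgebra D] where
  v : ℕ → 𝓜(ℂ, D)
  d : ℕ → 𝓜(ℂ, D)
  v_mem : ∀ n, v n ∈ inM D
  d_mem : ∀ n, d n ∈ inM D
  star_v : ∀ n, star (v n) = v n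
  star_d : ∀ n, star (d n) = d n
  commute : ∀ n, v n * d n = d n * v n
  add_eq_one : ∀ n, (1 - v n) * (1 - v n) + d n * d n = 1
  norm_mul_v : ∀ m n, m < n → ‖(1 - v n) * v m‖ ≤ (1 / 2) ^ n
  norm_mul_d : ∀ m n, m < n → ‖(1 - v n) * d m‖ ≤ (1 / 2) ^ n
  tendsto : ∀ b : D, Tendsto (fun n => (1 - v n) * toM b) atTop (𝓝 0)

/-- Quasi-central systems exist, almost commuting with prescribed finite sets of multipliers and
acting almost as a unit on prescribed finite sets of elements of `D`. -/
theorem exists_qcSystem {D : Type*} [NonUnitalCStarAlgebra D] [TopologicalSpace.SeparableSpace D]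
    (F : ℕ → Finset 𝓜(ℂ, D)) (K : ℕ → Finset D) :
    ∃ S : QCSystem D,
      (∀ n, ∀ y ∈ F n, ‖S.v n * y - y * S.v n‖ ≤ (1 / 2) ^ n ∧
        ‖S.d n * y - y * S.d n‖ ≤ (1 / 2) ^ n) ∧
      ∀ n, ∀ b ∈ K n, ‖(1 - S.v n) * toM b‖ ≤ (1 / 2) ^ n := by
  classical
  let _ := CStarAlgebra.spectralOrder D
  have := CStarAlgebra.spectralOrderedRing D
  have hnorm : ∀ v b : D, ‖(1 - toM v) * toM b‖ = ‖b - v * b‖ := fun v b => by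
    rw [sub_mul, one_mul, ← map_mul, ← map_sub, norm_toM]
  let K' : ℕ → Finset D := fun n =>
    K n ∪ (Finset.range (n + 1)).image (TopologicalSpace.denseSeq D)
  -- The sequence is built together with an increasing sequence of stages, the first components;
  -- passing to later stages only improves the conditions.
  obtain ⟨f, hf, hf'⟩ := exists_seq_of_forall_finset_exists
    (fun x : ℕ × D => 0 ≤ x.2 ∧ ‖x.2‖ ≤ 1 ∧
      (∀ n ≤ x.1, ∀ y ∈ F n, ‖toM x.2 * y - y * toM x.2‖ ≤ (1 / 2) ^ x.1 ∧
        ‖toM (dOf x.2) * y - y * toM (dOf x.2)‖ ≤ (1 / 2) ^ x.1) ∧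
      ∀ n ≤ x.1, ∀ b ∈ K' n, ‖(1 - toM x.2) * toM b‖ ≤ (1 / 2) ^ x.1)
    (fun x z => x.1 < z.1 ∧ ‖(1 - toM z.2) * toM x.2‖ ≤ (1 / 2) ^ z.1 ∧
      ‖(1 - toM z.2) * toM (dOf x.2)‖ ≤ (1 / 2) ^ z.1) (by
    intro s _
    obtain ⟨N, hN⟩ : ∃ N : ℕ, ∀ x ∈ s, x.1 < N := by
      obtain ⟨N, hN⟩ := (s.image Prod.fst).bddAbove
      exact ⟨N + 1, fun x hx => Nat.lt_succ_of_le (hN (by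
        simp only [Finset.coe_image]; exact ⟨x, hx, rfl⟩))⟩
    set ε : ℝ := (1 / 2) ^ N with hεdef
    have hε : 0 < ε := by positivity
    let F' : Finset 𝓜(ℂ, D) := (Finset.range (N + 1)).biUnion F
    obtain ⟨δ, hδ, hδ'⟩ : ∃ δ > 0, ∀ y ∈ F', ∀ v : D, 0 ≤ v → ‖v‖ ≤ 1 →
        ‖toM v * y - y * toM v‖ ≤ δ → ‖toM (dOf v) * y - y * toM (dOf v)‖ ≤ ε := by
      induction F' using Finset.induction_on with
      | empty => exact ⟨1, one_pos, by simp⟩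
      | insert a G _ ih =>
        obtain ⟨δ, hδ, h⟩ := ih
        obtain ⟨δ', hδ', h'⟩ := exists_norm_dOf_commutator_le a hε
        refine ⟨min δ δ', lt_min hδ hδ', fun y hy v hv hv1 hvy => ?_⟩
        rcases Finset.mem_insert.1 hy with rfl | hy
        · exact h' v hv hv1 (hvy.trans (min_le_right _ _))
        · exact h y hy v hv hv1 (hvy.trans (min_le_left _ _))
    obtain ⟨v, hv, hv1, hvK, hvF⟩ := exists_quasicentral F'
      ((Finset.range (N + 1)).biUnion K' ∪ (s.image Prod.snd ∪ s.image fun x => dOf x.2))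
      (lt_min hε hδ)
    have hvK' : ∀ b ∈ (Finset.range (N + 1)).biUnion K' ∪
        (s.image Prod.snd ∪ s.image fun x => dOf x.2), ‖(1 - toM v) * toM b‖ ≤ ε := fun b hb => by
      rw [hnorm]; exact (hvK b hb).trans (min_le_left _ _)
    refine ⟨(N, v), ⟨hv, hv1, fun n hn y hy => ?_, fun n hn b hb => ?_⟩, fun x hx => ⟨hN x hx, ?_, ?_⟩⟩
    · have hy' : y ∈ F' := Finset.mem_biUnion.2 ⟨n, by simpa [Nat.lt_succ_iff] using hn, hy⟩
      exact ⟨(hvF y hy').trans (min_le_left _ _),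
        hδ' y hy' v hv hv1 ((hvF y hy').trans (min_le_right _ _))⟩
    · refine hvK' b (Finset.mem_union_left _ (Finset.mem_biUnion.2 ⟨n, ?_, hb⟩))
      simpa [Nat.lt_succ_iff] using hn
    · exact hvK' _ (Finset.mem_union_right _ (Finset.mem_union_left _
        (Finset.mem_image_of_mem _ hx)))
    · exact hvK' _ (Finset.mem_union_right _ (Finset.mem_union_right _
        (Finset.mem_image_of_mem (fun x : ℕ × D => dOf x.2) hx))))
  have hmono : StrictMono fun n => (f n).1 := fun m n h => (hf' m n h).1
  have hid : ∀ n, n ≤ (f n).1 := fun n => hmono.le_apply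
  have hpow : ∀ n, (1 / 2 : ℝ) ^ (f n).1 ≤ (1 / 2) ^ n := fun n =>
    pow_le_pow_of_le_one (by norm_num) (by norm_num) (hid n)
  have hc1 : ∀ n, ‖1 - toM (f n).2‖ ≤ 1 := fun n => by
    refine norm_le_one_of_add_eq_one (d := toM (dOf (f n).2)) ?_
    rw [star_sub, star_one, ← map_star, ← map_star, star_dOf,
      (IsSelfAdjoint.of_nonneg (hf n).1).star_eq]
    exact toM_dOf_mul_self (hf n).1 (hf n).2.1
  refine ⟨⟨fun n => toM (f n).2, fun n => toM (dOf (f n).2), fun n => toM_mem _, fun n => toM_mem _,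
    fun n => ?_, fun n => ?_, fun n => ?_, fun n => ?_, fun m n h => ?_, fun m n h => ?_,
    fun b => ?_⟩, fun n y hy => ?_, fun n b hb => ?_⟩
  · rw [← map_star, (IsSelfAdjoint.of_nonneg (hf n).1).star_eq]
  · rw [← map_star, star_dOf]
  · rw [← map_mul, commute_dOf (IsSelfAdjoint.of_nonneg (hf n).1), map_mul]
  · exact toM_dOf_mul_self (hf n).1 (hf n).2.1
  · exact (hf' m n h).2.1.trans (hpow n)
  · exact (hf' m n h).2.2.trans (hpow n)
  · rw [Metric.tendsto_atTop]
    intro ε hε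
    obtain ⟨_, hj, ⟨j, rfl⟩⟩ := Metric.dense_iff.1 (TopologicalSpace.denseRange_denseSeq D) b
      (ε / 2) (by positivity)
    obtain ⟨N, hN⟩ := exists_pow_lt_of_lt_one (half_pos hε) (show (1 / 2 : ℝ) < 1 by norm_num)
    refine ⟨max j N, fun n hn => ?_⟩
    have h1 : ‖(1 - toM (f n).2) * toM (TopologicalSpace.denseSeq D j)‖ < ε / 2 := by
      refine ((hf n).2.2.2 n (hid n) _ ?_).trans_lt ?_
      · exact Finset.mem_union_right _ (Finset.mem_image_of_mem _ (by
          simpa [Nat.lt_succ_iff] using (le_max_left _ _).trans hn))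
      · refine (hpow n).trans_lt (lt_of_le_of_lt ?_ hN)
        exact pow_le_pow_of_le_one (by norm_num) (by norm_num) ((le_max_right _ _).trans hn)
    have h2 : ‖(1 - toM (f n).2) * toM (b - TopologicalSpace.denseSeq D j)‖ < ε / 2 := by
      refine (norm_mul_le _ _).trans_lt ?_
      rw [norm_toM]
      rw [mem_ball_iff_norm, norm_sub_rev] at hj
      nlinarith [hc1 n, norm_nonneg (b - TopologicalSpace.denseSeq D j)]
    rw [dist_zero_right]
    calc _ = ‖(1 - toM (f n).2) * toM (TopologicalSpace.denseSeq D j)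
          + (1 - toM (f n).2) * toM (b - TopologicalSpace.denseSeq D j)‖ := by
          rw [← mul_add, ← map_add, add_sub_cancel]
      _ < ε := (norm_add_le _ _).trans_lt (by linarith)
  · exact ⟨((hf n).2.2.1 n (hid n) y hy).1.trans (hpow n),
      ((hf n).2.2.1 n (hid n) y hy).2.trans (hpow n)⟩
  · exact ((hf n).2.2.2 n (hid n) b (Finset.mem_union_left _ hb)).trans (hpow n)

end Systems

/-! ### Compressions along a quasi-central system -/

section Compression

/-- If `c`, `d` are commuting self-adjoint elements with `c² + d² = 1`, then `d y d + c z c` is the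
compression of `diag (y, z)` by an isometry, so that its norm is at most `max ‖y‖ ‖z‖`. -/
theorem norm_compression_le {E : Type*} [CStarAlgebra E] {c d y z : E} {M : ℝ}
    (hc : star c = c) (hd : star d = d) (hcd : c * d = d * c) (h1 : c * c + d * d = 1)
    (hy : ‖y‖ ≤ M) (hz : ‖z‖ ≤ M) : ‖d * y * d + c * z * c‖ ≤ M := by
  let _ := CStarAlgebra.spectralOrder E
  have := CStarAlgebra.spectralOrderedRing E
  have hM : 0 ≤ M := (norm_nonneg y).trans hy
  have hle : ∀ x : E, ‖x‖ ≤ M → star x * x ≤ algebraMap ℝ E (M ^ 2) := fun x hx =>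
    CStarAlgebra.star_mul_le_algebraMap_norm_sq.trans
      (algebraMap_mono E (pow_le_pow_left₀ (norm_nonneg x) hx 2))
  have hconj : ∀ x e : E, ‖x‖ ≤ M → star e = e →
      e * (star x * x) * e ≤ (M ^ 2) • (e * e) := fun x e hx he => by
    have := IsSelfAdjoint.conjugate_le_conjugate (hle x hx) (show IsSelfAdjoint e from he)
    rwa [Algebra.algebraMap_eq_smul_one, mul_smul_comm, mul_one, smul_mul_assoc] at this
  set w := d * y * d + c * z * c with hw
  set u := c * y * d - d * z * c with hu
  -- the defect in the Cauchy-Schwarz inequality for the row `(d, c)` is `star u * u`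
  have hid : star w * w + star u * u = d * (star y * y) * d + c * (star z * z) * c := by
    have hdd : d * d = 1 - c * c := by rw [← h1]; abel
    have e1 : star w = d * star y * d + c * star z * c := by
      simp only [hw, star_add, star_mul, hc, hd, mul_assoc]
    have e2 : star u = d * star y * c - c * star z * d := by
      simp only [hu, star_sub, star_mul, hc, hd, mul_assoc]
    have : star w * w + star u * u
        = d * star y * (d * d + c * c) * (y * d) + c * star z * (c * c + d * d) * (z * c)
          + d * star y * (d * c - c * d) * z * c + c * star z * (c * d - d * c) * y * d := by
      rw [e1, e2, hw, hu]; noncomm_ring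
    rw [this, h1, add_comm (d * d), h1, hcd]
    noncomm_ring
  have hww : star w * w ≤ algebraMap ℝ E (M ^ 2) := by
    calc star w * w ≤ star w * w + star u * u := le_add_of_nonneg_right (star_mul_self_nonneg u)
      _ ≤ (M ^ 2) • (d * d) + (M ^ 2) • (c * c) := by
          rw [hid]; exact add_le_add (hconj y d hy hd) (hconj z c hz hc)
      _ = algebraMap ℝ E (M ^ 2) := by
          rw [← smul_add, add_comm, h1, Algebra.algebraMap_eq_smul_one]
  have := (CStarAlgebra.norm_le_iff_le_algebraMap (star w * w) (sq_nonneg M)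
    (star_mul_self_nonneg w)).2 hww
  rw [CStarRing.norm_star_mul_self] at this
  nlinarith [norm_nonneg w]

end Compression

namespace QCSystem

variable {D : Type*} [NonUnitalCStarAlgebra D] (S : QCSystem D)

/-- The complement `c n = 1 - v n`. -/
noncomputable def c (n : ℕ) : 𝓜(ℂ, D) := 1 - S.v n

theorem star_c (n : ℕ) : star (S.c n) = S.c n := by
  rw [c, star_sub, star_one, S.star_v]

theorem c_mul_d (n : ℕ) : S.c n * S.d n = S.d n * S.c n := by
  rw [c, sub_mul, mul_sub, one_mul, mul_one, S.commute]

theorem c_add_d (n : ℕ) : S.c n * S.c n + S.d n * S.d n = 1 := S.add_eq_one n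

theorem norm_c_le (n : ℕ) : ‖S.c n‖ ≤ 1 :=
  norm_le_one_of_add_eq_one (d := S.d n) (by rw [S.star_c, S.star_d, S.c_add_d])

theorem norm_d_le (n : ℕ) : ‖S.d n‖ ≤ 1 :=
  norm_le_one_of_add_eq_one (d := S.c n) (by rw [S.star_c, S.star_d, add_comm, S.c_add_d])

theorem norm_c_mul_le (n : ℕ) (x : 𝓜(ℂ, D)) : ‖S.c n * x‖ ≤ ‖x‖ :=
  (norm_mul_le _ _).trans (mul_le_of_le_one_left (norm_nonneg _) (S.norm_c_le n))

theorem norm_mul_c_le (n : ℕ) (x : 𝓜(ℂ, D)) : ‖x * S.c n‖ ≤ ‖x‖ :=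
  (norm_mul_le _ _).trans (mul_le_of_le_one_right (norm_nonneg _) (S.norm_c_le n))

theorem norm_d_mul_le (n : ℕ) (x : 𝓜(ℂ, D)) : ‖S.d n * x‖ ≤ ‖x‖ :=
  (norm_mul_le _ _).trans (mul_le_of_le_one_left (norm_nonneg _) (S.norm_d_le n))

theorem norm_mul_d_le (n : ℕ) (x : 𝓜(ℂ, D)) : ‖x * S.d n‖ ≤ ‖x‖ :=
  (norm_mul_le _ _).trans (mul_le_of_le_one_right (norm_nonneg _) (S.norm_d_le n))

theorem norm_c_mul_c_le (n : ℕ) (x : 𝓜(ℂ, D)) : ‖S.c n * x * S.c n‖ ≤ ‖x‖ :=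
  (S.norm_mul_c_le n _).trans (S.norm_c_mul_le n x)

theorem norm_compress_le (n : ℕ) {y z : 𝓜(ℂ, D)} {M : ℝ} (hy : ‖y‖ ≤ M) (hz : ‖z‖ ≤ M) :
    ‖S.d n * y * S.d n + S.c n * z * S.c n‖ ≤ M :=
  norm_compression_le (S.star_c n) (S.star_d n) (S.c_mul_d n) (S.c_add_d n) hy hz

/-- The product `c (k + N - 1) * ⋯ * c k`. -/
noncomputable def cprod : ℕ → ℕ → 𝓜(ℂ, D)
  | _, 0 => 1
  | k, N + 1 => cprod (k + 1) N * S.c k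

theorem cprod_zero (k : ℕ) : S.cprod k 0 = 1 := rfl

theorem cprod_succ (k N : ℕ) : S.cprod k (N + 1) = S.cprod (k + 1) N * S.c k := rfl

theorem cprod_succ' (k N : ℕ) : S.cprod k (N + 1) = S.c (k + N) * S.cprod k N := by
  induction N generalizing k with
  | zero => simp [cprod]
  | succ N ih =>
    rw [cprod_succ, ih, mul_assoc, ← cprod_succ]
    congr 2; omega

theorem norm_star_cprod_mul_le (k N : ℕ) (x : 𝓜(ℂ, D)) : ‖star (S.cprod k N) * x‖ ≤ ‖x‖ := by
  induction N generalizing k x with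
  | zero => rw [cprod_zero, star_one, one_mul]
  | succ N ih =>
    rw [cprod_succ, star_mul, S.star_c, mul_assoc]
    exact (S.norm_c_mul_le _ _).trans (ih _ _)

theorem norm_c_mul_c_sub_le {m n : ℕ} (h : m < n) : ‖S.c n * S.c m - S.c n‖ ≤ (1 / 2) ^ n := by
  have : S.c n * S.c m - S.c n = -((1 - S.v n) * S.v m) := by simp only [c]; noncomm_ring
  rw [this, norm_neg]
  exact S.norm_mul_v m n h

/-- Since `c n * c m` is close to `c n` for `m < n`, long products of the `c n` are close to their
first factor. -/
theorem norm_c_mul_cprod_sub_le (k N n : ℕ) (h : k + N ≤ n) :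
    ‖S.c n * S.cprod k N - S.c n‖ ≤ N * (1 / 2) ^ n := by
  induction N generalizing k with
  | zero => simp [cprod]
  | succ N ih =>
    have h1 : S.c n * S.cprod k (N + 1) - S.c n
        = (S.c n * S.cprod (k + 1) N - S.c n) * S.c k + (S.c n * S.c k - S.c n) := by
      rw [cprod_succ]; noncomm_ring
    rw [h1]
    refine (norm_add_le_of_le ((S.norm_mul_c_le _ _).trans (ih (k + 1) (by omega)))
      (S.norm_c_mul_c_sub_le (by omega))).trans ?_
    push_cast
    linarith

/-- The products `c (k + N - 1) * ⋯ * c k` tend to `0` strictly. -/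
theorem tendsto_cprod (k : ℕ) (b : D) :
    Tendsto (fun N => ‖S.cprod k N * toM b‖) atTop (𝓝 0) := by
  rw [← tendsto_add_atTop_iff_nat 1]
  have h1 : Tendsto (fun N : ℕ => ‖S.c (k + N) * toM b‖ + N * (1 / 2 : ℝ) ^ N * ‖b‖) atTop
      (𝓝 (0 + 0 * ‖b‖)) := by
    refine Tendsto.add ?_ (Tendsto.mul_const _ ?_)
    · have := (S.tendsto b).norm.comp (tendsto_add_atTop_nat k)
      simpa [Function.comp_def, add_comm, c] using this
    · exact tendsto_self_mul_const_pow_of_lt_one (by norm_num) (by norm_num)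
  rw [zero_mul, zero_add] at h1
  refine squeeze_zero (fun _ => norm_nonneg _) (fun N => ?_) h1
  have h2 : S.cprod k (N + 1) * toM b
      = S.c (k + N) * toM b + (S.c (k + N) * S.cprod k N - S.c (k + N)) * toM b := by
    rw [cprod_succ']; noncomm_ring
  rw [h2]
  refine norm_add_le_of_le le_rfl ((norm_mul_le _ _).trans ?_)
  rw [norm_toM]
  refine mul_le_mul_of_nonneg_right ((S.norm_c_mul_cprod_sub_le k N _ le_rfl).trans ?_)
    (norm_nonneg b)
  exact mul_le_mul_of_nonneg_left (pow_le_pow_of_le_one (by norm_num) (by norm_num) (by omega))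
    (Nat.cast_nonneg N)

/-- The partial sums `d k * y k * d k + c k * (d (k + 1) * y (k + 1) * d (k + 1) + ⋯) * c k`, with
`N` summands. -/
noncomputable def partialT (y : ℕ → 𝓜(ℂ, D)) : ℕ → ℕ → 𝓜(ℂ, D)
  | _, 0 => 0
  | k, N + 1 => S.d k * y k * S.d k + S.c k * partialT y (k + 1) N * S.c k

theorem partialT_zero (y : ℕ → 𝓜(ℂ, D)) (k : ℕ) : S.partialT y k 0 = 0 := rfl

theorem partialT_succ (y : ℕ → 𝓜(ℂ, D)) (k N : ℕ) : S.partialT y k (N + 1)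
    = S.d k * y k * S.d k + S.c k * S.partialT y (k + 1) N * S.c k := rfl

theorem partialT_add_right (y : ℕ → 𝓜(ℂ, D)) (k N M : ℕ) : S.partialT y k (N + M)
    = S.partialT y k N + star (S.cprod k N) * S.partialT y (k + N) M * S.cprod k N := by
  induction N generalizing k with
  | zero => simp [partialT, cprod]
  | succ N ih =>
    rw [show N + 1 + M = (N + M) + 1 by omega, partialT_succ, ih, partialT_succ, cprod_succ,
      star_mul, S.star_c, show k + 1 + N = k + (N + 1) by omega]
    noncomm_ring

theorem norm_partialT_le {y : ℕ → 𝓜(ℂ, D)} {k : ℕ} {M : ℝ} (hM : 0 ≤ M)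
    (hy : ∀ n ≥ k, ‖y n‖ ≤ M) (N : ℕ) : ‖S.partialT y k N‖ ≤ M := by
  induction N generalizing k with
  | zero => rwa [partialT_zero, norm_zero]
  | succ N ih => exact S.norm_compress_le k (hy k le_rfl) (ih fun n hn => hy n (by omega))

theorem partialT_mem (y : ℕ → 𝓜(ℂ, D)) (k N : ℕ) : S.partialT y k N ∈ inM D := by
  induction N generalizing k with
  | zero => exact zero_mem _
  | succ N ih =>
    exact add_mem (inM_mul_left _ (S.d_mem k)) (inM_mul_right _ (inM_mul_left _ (ih _)))

theorem partialT_add (y z : ℕ → 𝓜(ℂ, D)) (k N : ℕ) :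
    S.partialT (fun n => y n + z n) k N = S.partialT y k N + S.partialT z k N := by
  induction N generalizing k with
  | zero => simp [partialT_zero]
  | succ N ih => simp only [partialT_succ, ih]; noncomm_ring

theorem partialT_smul (a : ℂ) (y : ℕ → 𝓜(ℂ, D)) (k N : ℕ) :
    S.partialT (fun n => a • y n) k N = a • S.partialT y k N := by
  induction N generalizing k with
  | zero => simp [partialT_zero]
  | succ N ih => simp only [partialT_succ, ih, mul_smul_comm, smul_mul_assoc, smul_add]

theorem partialT_star (y : ℕ → 𝓜(ℂ, D)) (k N : ℕ) :
    S.partialT (fun n => star (y n)) k N = star (S.partialT y k N) := by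
  induction N generalizing k with
  | zero => simp [partialT_zero]
  | succ N ih => simp only [partialT_succ, ih, star_add, star_mul, S.star_c, S.star_d, mul_assoc]

end QCSystem

section StrictLimits

variable {D : Type*} [NonUnitalCStarAlgebra D]

/-- A bounded strictly Cauchy sequence of multipliers has a strict limit. -/
theorem exists_strict_limit (m : ℕ → 𝓜(ℂ, D)) {M : ℝ} (hM : ∀ n, ‖m n‖ ≤ M)
    (h1 : ∀ b, CauchySeq fun n => (m n).fst b) (h2 : ∀ b, CauchySeq fun n => (m n).snd b) :
    ∃ m' : 𝓜(ℂ, D), (∀ b, Tendsto (fun n => (m n).fst b) atTop (𝓝 (m'.fst b))) ∧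
      ∀ b, Tendsto (fun n => (m n).snd b) atTop (𝓝 (m'.snd b)) := by
  choose f hf using fun b => cauchySeq_tendsto_of_complete (h1 b)
  choose g hg using fun b => cauchySeq_tendsto_of_complete (h2 b)
  let f' : D →L[ℂ] D := LinearMap.mkContinuous
    { toFun := f
      map_add' := fun x y => tendsto_nhds_unique (hf (x + y))
        (((hf x).add (hf y)).congr fun n => (map_add _ _ _).symm)
      map_smul' := fun a x => tendsto_nhds_unique (hf (a • x))
        (((hf x).const_smul a).congr fun n => (map_smul (m n).fst _ _).symm) } M
    fun b => le_of_tendsto (hf b).norm (Eventually.of_forall fun n =>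
      (norm_fst_le _ _).trans (mul_le_mul_of_nonneg_right (hM n) (norm_nonneg b)))
  let g' : D →L[ℂ] D := LinearMap.mkContinuous
    { toFun := g
      map_add' := fun x y => tendsto_nhds_unique (hg (x + y))
        (((hg x).add (hg y)).congr fun n => (map_add _ _ _).symm)
      map_smul' := fun a x => tendsto_nhds_unique (hg (a • x))
        (((hg x).const_smul a).congr fun n => (map_smul (m n).snd _ _).symm) } M
    fun b => le_of_tendsto (hg b).norm (Eventually.of_forall fun n =>
      (norm_snd_le _ _).trans (mul_le_mul_of_nonneg_right (hM n) (norm_nonneg b)))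
  exact ⟨⟨(f', g'), fun x y => tendsto_nhds_unique ((hg x).mul_const y)
    (((hf y).const_mul x).congr fun n => ((m n).central x y).symm)⟩, hf, hg⟩

end StrictLimits

namespace QCSystem

variable {D : Type*} [NonUnitalCStarAlgebra D] (S : QCSystem D)

theorem cauchySeq_partialT_fst {y : ℕ → 𝓜(ℂ, D)} {M : ℝ} (hy : ∀ n, ‖y n‖ ≤ M) (k : ℕ) (b : D) :
    CauchySeq fun N => (S.partialT y k N).fst b := by
  have hM : 0 ≤ M := (norm_nonneg _).trans (hy 0)
  refine cauchySeq_of_le_tendsto_0 (fun N => 2 * (M * ‖S.cprod k N * toM b‖)) ?_ ?_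
  · intro i j N hi hj
    have h : ∀ i, N ≤ i → ‖(S.partialT y k i - S.partialT y k N).fst b‖
        ≤ M * ‖S.cprod k N * toM b‖ := by
      intro i hi
      obtain ⟨l, rfl⟩ := Nat.exists_eq_add_of_le hi
      rw [partialT_add_right, add_sub_cancel_left, norm_fst_apply, mul_assoc, mul_assoc]
      refine (S.norm_star_cprod_mul_le _ _ _).trans ((norm_mul_le _ _).trans ?_)
      gcongr
      exact S.norm_partialT_le hM (fun n _ => hy n) l
    have h3 : (S.partialT y k i).fst b - (S.partialT y k j).fst b
        = (S.partialT y k i - S.partialT y k N).fst b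
          - (S.partialT y k j - S.partialT y k N).fst b := by
      simp
    rw [dist_eq_norm, h3, two_mul]
    exact norm_sub_le_of_le (h i hi) (h j hj)
  · simpa using ((S.tendsto_cprod k b).const_mul M).const_mul 2

theorem cauchySeq_partialT_snd {y : ℕ → 𝓜(ℂ, D)} {M : ℝ} (hy : ∀ n, ‖y n‖ ≤ M) (k : ℕ) (b : D) :
    CauchySeq fun N => (S.partialT y k N).snd b := by
  have h := (S.cauchySeq_partialT_fst (y := fun n => star (y n)) (fun n => by
    rw [norm_star]; exact hy n) k (star b))
  have h2 : ∀ N, (S.partialT y k N).snd b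
      = star ((S.partialT (fun n => star (y n)) k N).fst (star b)) := fun N => by
    rw [partialT_star, DoubleCentralizer.star_fst, star_star, star_star]
  simp only [h2]
  exact (starₗᵢ ℂ : D ≃ₗᵢ⋆[ℂ] D).isometry.uniformContinuous.comp_cauchySeq h

theorem exists_T {y : ℕ → 𝓜(ℂ, D)} {M : ℝ} (hy : ∀ n, ‖y n‖ ≤ M) (k : ℕ) :
    ∃ m : 𝓜(ℂ, D), (∀ b, Tendsto (fun N => (S.partialT y k N).fst b) atTop (𝓝 (m.fst b))) ∧
      ∀ b, Tendsto (fun N => (S.partialT y k N).snd b) atTop (𝓝 (m.snd b)) :=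
  exists_strict_limit _
    (S.norm_partialT_le ((norm_nonneg _).trans (hy 0)) (fun n _ => hy n))
    (S.cauchySeq_partialT_fst hy k) (S.cauchySeq_partialT_snd hy k)

open Classical in
/-- The strictly convergent sum `T k y = ∑ n ≥ k, C n * d n * y n * d n * star (C n)`, where
`C n = c k * ⋯ * c (n - 1)`, of a bounded sequence `y` of multipliers: a compression of the diagonal
operator `diag (y k, y (k + 1), …)` by an isometry. Its value is `0` if the partial sums do not
converge strictly. -/
noncomputable def T (k : ℕ) (y : ℕ → 𝓜(ℂ, D)) : 𝓜(ℂ, D) :=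
  if h : ∃ m : 𝓜(ℂ, D), (∀ b, Tendsto (fun N => (S.partialT y k N).fst b) atTop (𝓝 (m.fst b))) ∧
      ∀ b, Tendsto (fun N => (S.partialT y k N).snd b) atTop (𝓝 (m.snd b)) then h.choose else 0

variable {S} {y z : ℕ → 𝓜(ℂ, D)} {M M' : ℝ}

theorem tendsto_T (hy : ∀ n, ‖y n‖ ≤ M) (k : ℕ) (b : D) :
    Tendsto (fun N => (S.partialT y k N).fst b) atTop (𝓝 ((S.T k y).fst b)) := by
  have h := S.exists_T hy k
  rw [T, dif_pos h]
  exact h.choose_spec.1 b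

theorem T_eq (hy : ∀ n, ‖y n‖ ≤ M) {k : ℕ} {m : 𝓜(ℂ, D)}
    (h : ∀ b, Tendsto (fun N => (S.partialT y k N).fst b) atTop (𝓝 (m.fst b))) : S.T k y = m :=
  ext_fst fun b => tendsto_nhds_unique (tendsto_T hy k b) (h b)

theorem T_add (hy : ∀ n, ‖y n‖ ≤ M) (hz : ∀ n, ‖z n‖ ≤ M') (k : ℕ) :
    S.T k (fun n => y n + z n) = S.T k y + S.T k z :=
  T_eq (fun n => norm_add_le_of_le (hy n) (hz n)) fun b => by
    simpa only [partialT_add] using! (tendsto_T hy k b).add (tendsto_T hz k b)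

theorem T_smul (a : ℂ) (hy : ∀ n, ‖y n‖ ≤ M) (k : ℕ) :
    S.T k (fun n => a • y n) = a • S.T k y :=
  T_eq (M := ‖a‖ * M)
    (fun n => by rw [norm_smul]; exact mul_le_mul_of_nonneg_left (hy n) (norm_nonneg a)) fun b => by
    simpa only [partialT_smul] using! (tendsto_T hy k b).const_smul a

theorem T_sub (hy : ∀ n, ‖y n‖ ≤ M) (hz : ∀ n, ‖z n‖ ≤ M') (k : ℕ) :
    S.T k (fun n => y n - z n) = S.T k y - S.T k z := by
  have h1 := T_smul (S := S) (-1) hz k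
  have h2 := T_add (S := S) hy (z := fun n => (-1 : ℂ) • z n) (M' := M')
    (fun n => by rw [norm_smul]; simpa using hz n) k
  rw [h1] at h2
  simpa [sub_eq_add_neg] using h2

theorem T_star (hy : ∀ n, ‖y n‖ ≤ M) (k : ℕ) : S.T k (fun n => star (y n)) = star (S.T k y) := by
  have h := S.exists_T hy k
  have h0 : S.T k y = h.choose := by rw [T, dif_pos h]
  refine T_eq (M := M) (fun n => by rw [norm_star]; exact hy n) fun b => ?_
  simp only [partialT_star, DoubleCentralizer.star_fst, h0]
  exact (continuous_star.tendsto _).comp (h.choose_spec.2 (star b))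

theorem norm_T_le (hy : ∀ n, ‖y n‖ ≤ M) {k : ℕ} {C : ℝ} (hC : ∀ n ≥ k, ‖y n‖ ≤ C) :
    ‖S.T k y‖ ≤ C := by
  have hC0 : 0 ≤ C := (norm_nonneg _).trans (hC k le_rfl)
  refine norm_le_of_fst hC0 fun b => le_of_tendsto (tendsto_T hy k b).norm
    (Eventually.of_forall fun N => (norm_fst_le _ _).trans ?_)
  exact mul_le_mul_of_nonneg_right (S.norm_partialT_le hC0 hC N) (norm_nonneg b)

theorem T_eq_partialT_add (hy : ∀ n, ‖y n‖ ≤ M) (k N : ℕ) : S.T k y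
    = S.partialT y k N + star (S.cprod k N) * S.T (k + N) y * S.cprod k N := by
  refine T_eq hy fun b => ?_
  rw [← tendsto_add_atTop_iff_nat N]
  have h1 : ∀ L, (S.partialT y k (L + N)).fst b = (S.partialT y k N).fst b
      + (star (S.cprod k N)).fst ((S.partialT y (k + N) L).fst ((S.cprod k N).fst b)) := fun L => by
    rw [add_comm L, partialT_add_right]; rfl
  simp only [h1]
  exact ((((star (S.cprod k N)).fst.continuous.tendsto _).comp (tendsto_T hy _ _)).const_add _)

/-- The recursion satisfied by `T`. -/
theorem T_rec (hy : ∀ n, ‖y n‖ ≤ M) (k : ℕ) : S.T k y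
    = S.d k * y k * S.d k + S.c k * S.T (k + 1) y * S.c k := by
  have := T_eq_partialT_add (S := S) hy k 1
  simpa [partialT, cprod, S.star_c] using this

theorem T_congr {k : ℕ} (h : ∀ n ≥ k, y n = z n) : S.T k y = S.T k z := by
  have : S.partialT y k = S.partialT z k := funext fun N => by
    induction N generalizing k with
    | zero => rfl
    | succ N ih =>
      rw [partialT_succ, partialT_succ, h k le_rfl, ih fun n hn => h n (by omega)]
  unfold T; rw [this]

/-- Recursions telescope: a bounded sequence `ρ` with `ρ n ≈ c n * ρ (n + 1) * c n`, up to summable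
errors, is small, because the products of the `c n` tend to `0` strictly. -/
theorem norm_le_of_recursion (ρ : ℕ → 𝓜(ℂ, D)) {R K : ℝ} {k : ℕ} (hR : ∀ n, ‖ρ n‖ ≤ R)
    (hρ : ∀ n ≥ k, ‖ρ n - S.c n * ρ (n + 1) * S.c n‖ ≤ K * (1 / 2) ^ n) :
    ‖ρ k‖ ≤ 2 * K * (1 / 2) ^ k := by
  have hR0 : 0 ≤ R := (norm_nonneg _).trans (hR 0)
  have hK : 0 ≤ K * (1 / 2 : ℝ) ^ k := (norm_nonneg _).trans (hρ k le_rfl)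
  have h1 : ∀ N l, k ≤ l → ‖ρ l - star (S.cprod l N) * ρ (l + N) * S.cprod l N‖
      ≤ 2 * K * (1 / 2) ^ l - 2 * K * (1 / 2) ^ (l + N) := by
    intro N
    induction N with
    | zero => intro l _; simp [cprod]
    | succ N ih =>
      intro l hl
      have h2 : ρ l - star (S.cprod l (N + 1)) * ρ (l + (N + 1)) * S.cprod l (N + 1)
          = (ρ l - S.c l * ρ (l + 1) * S.c l)
            + S.c l * (ρ (l + 1) - star (S.cprod (l + 1) N) * ρ (l + 1 + N) * S.cprod (l + 1) N)
              * S.c l := by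
        rw [cprod_succ, star_mul, S.star_c, show l + (N + 1) = l + 1 + N by omega]
        noncomm_ring
      rw [h2]
      refine (norm_add_le_of_le (hρ l hl)
        ((S.norm_c_mul_c_le l _).trans (ih (l + 1) (by omega)))).trans (le_of_eq ?_)
      rw [show l + (N + 1) = l + 1 + N by omega, pow_succ (1 / 2 : ℝ) l]
      ring
  refine norm_le_of_fst (by linarith) fun b => ?_
  have h3 : Tendsto (fun N => 2 * K * (1 / 2) ^ k * ‖b‖ + R * ‖S.cprod k N * toM b‖) atTop
      (𝓝 (2 * K * (1 / 2) ^ k * ‖b‖ + R * 0)) :=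
    ((S.tendsto_cprod k b).const_mul R).const_add _
  rw [mul_zero, add_zero] at h3
  refine ge_of_tendsto h3 (Eventually.of_forall fun N => ?_)
  have h4 : ρ k * toM b = (ρ k - star (S.cprod k N) * ρ (k + N) * S.cprod k N) * toM b
      + star (S.cprod k N) * (ρ (k + N) * (S.cprod k N * toM b)) := by
    noncomm_ring
  rw [norm_fst_apply, h4]
  refine norm_add_le_of_le ?_ ?_
  · refine (norm_mul_le _ _).trans ?_
    rw [norm_toM]
    refine mul_le_mul_of_nonneg_right ((h1 N k le_rfl).trans ?_) (norm_nonneg b)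
    have : 0 ≤ K * (1 / 2 : ℝ) ^ k * (1 / 2) ^ N := by positivity
    rw [pow_add]; nlinarith
  · refine (S.norm_star_cprod_mul_le _ _ _).trans ((norm_mul_le _ _).trans ?_)
    exact mul_le_mul_of_nonneg_right (hR _) (norm_nonneg _)

end QCSystem

/-! ### Estimates for compressions -/

namespace QCSystem

variable {D : Type*} [NonUnitalCStarAlgebra D] {S : QCSystem D} {y z : ℕ → 𝓜(ℂ, D)} {M : ℝ} {k : ℕ}

/-- From stage `k` on, the terms of `y` with index `n` and `n + 1` almost commute with `v n` and
`d n`. -/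
def QuasiCommutes (S : QCSystem D) (k : ℕ) (y : ℕ → 𝓜(ℂ, D)) : Prop :=
  ∀ n ≥ k, ∀ m, m = n ∨ m = n + 1 → ‖S.v n * y m - y m * S.v n‖ ≤ (1 / 2) ^ n ∧
    ‖S.d n * y m - y m * S.d n‖ ≤ (1 / 2) ^ n

theorem QuasiCommutes.mono (h : S.QuasiCommutes k y) {l : ℕ} (hl : k ≤ l) : S.QuasiCommutes l y :=
  fun n hn => h n (hl.trans hn)

theorem QuasiCommutes.star (h : S.QuasiCommutes k y) :
    S.QuasiCommutes k fun n => star (y n) := by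
  intro n hn m hm
  have h1 := h n hn m hm
  constructor
  · rw [← norm_star, star_sub, star_mul, star_mul, star_star, S.star_v, norm_sub_rev]
    exact h1.1
  · rw [← norm_star, star_sub, star_mul, star_mul, star_star, S.star_d, norm_sub_rev]
    exact h1.2

theorem norm_v_le (S : QCSystem D) (n : ℕ) : ‖S.v n‖ ≤ 2 := by
  have h1 : S.v n = S.c n * S.c n + S.d n * S.d n - S.c n := by rw [c_add_d, c, sub_sub_cancel]
  rw [h1]
  have h2 := S.norm_compress_le n (y := 1) (z := 1) (M := 1)
    (norm_le_one_of_add_eq_one (d := 0) (by simp)) (norm_le_one_of_add_eq_one (d := 0) (by simp))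
  rw [mul_one, mul_one, add_comm] at h2
  linarith [norm_sub_le (S.c n * S.c n + S.d n * S.d n) (S.c n), S.norm_c_le n]

/-- On elements on which `v (k + 1)` is almost a unit, `T (k + 1) y` acts almost as its first term
`y (k + 1)`. -/
theorem norm_mul_T_sub_le (hy : ∀ n, ‖y n‖ ≤ M) (hq : S.QuasiCommutes k y) {e : 𝓜(ℂ, D)}
    (he : star e = e) (he2 : ‖e‖ ≤ 2) (hce : ‖S.c (k + 1) * e‖ ≤ (1 / 2) ^ (k + 1)) :
    ‖e * S.T (k + 1) y - e * y (k + 1)‖ ≤ (M + 1) * (1 / 2) ^ k := by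
  have hM : 0 ≤ M := (norm_nonneg _).trans (hy 0)
  have hec : ‖e * S.c (k + 1)‖ ≤ (1 / 2) ^ (k + 1) := by
    rw [← norm_star, star_mul, he, S.star_c]; exact hce
  have hd : S.d (k + 1) * S.d (k + 1) = 1 - S.c (k + 1) * S.c (k + 1) := by
    rw [← S.c_add_d (k + 1)]; abel
  have h1 : e * S.T (k + 1) y - e * y (k + 1)
      = e * S.c (k + 1) * (S.T (k + 1 + 1) y * S.c (k + 1) - S.c (k + 1) * y (k + 1))
        + e * (S.d (k + 1) * (y (k + 1) * S.d (k + 1) - S.d (k + 1) * y (k + 1))) := by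
    have : e * (S.d (k + 1) * (y (k + 1) * S.d (k + 1) - S.d (k + 1) * y (k + 1)))
        = e * (S.d (k + 1) * y (k + 1) * S.d (k + 1))
          - e * (S.d (k + 1) * S.d (k + 1)) * y (k + 1) := by noncomm_ring
    rw [T_rec hy (k + 1), this, hd]
    noncomm_ring
  have h2 : ‖S.T (k + 1 + 1) y * S.c (k + 1) - S.c (k + 1) * y (k + 1)‖ ≤ M + M :=
    norm_sub_le_of_le ((S.norm_mul_c_le _ _).trans (norm_T_le hy fun n _ => hy n))
      ((S.norm_c_mul_le _ _).trans (hy _))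
  have h3 : ‖S.d (k + 1) * (y (k + 1) * S.d (k + 1) - S.d (k + 1) * y (k + 1))‖
      ≤ (1 / 2) ^ (k + 1) := by
    refine (S.norm_d_mul_le _ _).trans ?_
    rw [norm_sub_rev]
    exact (hq (k + 1) (by omega) (k + 1) (Or.inl rfl)).2
  rw [h1]
  refine (norm_add_le_of_le (norm_mul_le_of_le hec h2) (norm_mul_le_of_le he2 h3)).trans
    (le_of_eq ?_)
  rw [pow_succ]; ring

theorem norm_T_mul_sub_le (hy : ∀ n, ‖y n‖ ≤ M) (hq : S.QuasiCommutes k y) {e : 𝓜(ℂ, D)}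
    (he : star e = e) (he2 : ‖e‖ ≤ 2) (hce : ‖S.c (k + 1) * e‖ ≤ (1 / 2) ^ (k + 1)) :
    ‖S.T (k + 1) y * e - y (k + 1) * e‖ ≤ (M + 1) * (1 / 2) ^ k := by
  have h := norm_mul_T_sub_le (S := S) (y := fun n => star (y n)) (M := M)
    (fun n => by rw [norm_star]; exact hy n) hq.star he he2 hce
  rwa [T_star hy, ← norm_star, star_sub, star_mul, star_mul, star_star, star_star, he] at h

theorem norm_c_mul_d_le (S : QCSystem D) (k : ℕ) : ‖S.c (k + 1) * S.d k‖ ≤ (1 / 2) ^ (k + 1) :=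
  S.norm_mul_d k (k + 1) (by omega)

theorem norm_c_mul_v_le (S : QCSystem D) (k : ℕ) : ‖S.c (k + 1) * S.v k‖ ≤ (1 / 2) ^ (k + 1) :=
  S.norm_mul_v k (k + 1) (by omega)

theorem norm_d_le_two (S : QCSystem D) (k : ℕ) : ‖S.d k‖ ≤ 2 := (S.norm_d_le k).trans one_le_two

/-- One step of the recursion for the defect `T k (y * z) - T k y * T k z` of multiplicativity. -/
theorem defect_rec (hy : ∀ n, ‖y n‖ ≤ M) (hz : ∀ n, ‖z n‖ ≤ M) (k : ℕ) :
    S.T k (fun n => y n * z n) - S.T k y * S.T k z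
      - S.c k * (S.T (k + 1) (fun n => y n * z n) - S.T (k + 1) y * S.T (k + 1) z) * S.c k
      = (S.d k * y k * S.c k - S.c k * S.T (k + 1) y * S.d k)
        * (S.c k * z k * S.d k - S.d k * S.T (k + 1) z * S.c k) := by
  have hyz : ∀ n, ‖y n * z n‖ ≤ M * M := fun n => norm_mul_le_of_le (hy n) (hz n)
  rw [T_rec hyz k, T_rec hy k, T_rec hz k]
  set Y := S.T (k + 1) y
  set Z := S.T (k + 1) z
  set W := S.T (k + 1) fun n => y n * z n
  have hd : S.d k * S.d k = 1 - S.c k * S.c k := by rw [← S.c_add_d k]; abel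
  have e1 : (S.d k * y k * S.d k + S.c k * Y * S.c k) * (S.d k * z k * S.d k + S.c k * Z * S.c k)
      = S.d k * y k * (S.d k * S.d k) * z k * S.d k + S.d k * y k * (S.d k * S.c k) * Z * S.c k
        + S.c k * Y * (S.c k * S.d k) * z k * S.d k + S.c k * Y * S.c k * S.c k * Z * S.c k := by
    noncomm_ring
  have e2 : (S.d k * y k * S.c k - S.c k * Y * S.d k) * (S.c k * z k * S.d k - S.d k * Z * S.c k)
      = S.d k * y k * S.c k * S.c k * z k * S.d k - S.d k * y k * (S.c k * S.d k) * Z * S.c k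
        - S.c k * Y * (S.d k * S.c k) * z k * S.d k
        + S.c k * Y * (S.d k * S.d k) * Z * S.c k := by
    noncomm_ring
  rw [e1, e2, hd, S.c_mul_d]
  noncomm_ring

/-- `T k` is almost multiplicative on slowly varying sequences almost commuting with the system. -/
theorem norm_T_mul_sub_mul_le (hy : ∀ n, ‖y n‖ ≤ M) (hz : ∀ n, ‖z n‖ ≤ M)
    (hqy : S.QuasiCommutes k y) (hqz : S.QuasiCommutes k z) {η : ℝ}
    (hη : ∀ n ≥ k, ‖y n - y (n + 1)‖ ≤ η) :
    ‖S.T k (fun n => y n * z n) - S.T k y * S.T k z‖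
      ≤ 2 * M * η + (2 * M + 8 * M * (M + 2)) * (1 / 2) ^ k := by
  have hM : 0 ≤ M := (norm_nonneg _).trans (hy 0)
  set w : ℕ → 𝓜(ℂ, D) := fun n => y n * S.c n - S.c n * y (n + 1) with hw
  set w' : ℕ → 𝓜(ℂ, D) := fun n => S.c n * z n - z (n + 1) * S.c n with hw'
  have hwM : ∀ n, ‖w n‖ ≤ 2 * M := fun n => by
    rw [two_mul]
    exact norm_sub_le_of_le ((S.norm_mul_c_le _ _).trans (hy _)) ((S.norm_c_mul_le _ _).trans (hy _))
  have hwM' : ∀ n, ‖w' n‖ ≤ 2 * M := fun n => by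
    rw [two_mul]
    exact norm_sub_le_of_le ((S.norm_c_mul_le _ _).trans (hz _)) ((S.norm_mul_c_le _ _).trans (hz _))
  have hww : ∀ n, ‖w n * w' n‖ ≤ 2 * M * (2 * M) := fun n => norm_mul_le_of_le (hwM n) (hwM' n)
  have hyz : ∀ n, ‖y n * z n‖ ≤ M * M := fun n => norm_mul_le_of_le (hy n) (hz n)
  -- the sequence `w * w'` absorbs the part of the defect that is small but not summable
  have hrec := norm_le_of_recursion (S := S)
    (fun n => S.T n (fun n => y n * z n) - S.T n y * S.T n z - S.T n fun n => w n * w' n)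
    (R := M * M + M * M + 2 * M * (2 * M)) (K := 4 * M * (M + 2)) (k := k)
    (fun n => norm_sub_le_of_le (norm_sub_le_of_le (norm_T_le hyz fun n _ => hyz n)
      (norm_mul_le_of_le (norm_T_le hy fun n _ => hy n) (norm_T_le hz fun n _ => hz n)))
      (norm_T_le hww fun n _ => hww n)) (by
    intro n hn
    set X := S.d n * y n * S.c n - S.c n * S.T (n + 1) y * S.d n with hX
    set X' := S.c n * z n * S.d n - S.d n * S.T (n + 1) z * S.c n with hX'
    have e : S.T n (fun n => y n * z n) - S.T n y * S.T n z - (S.T n fun n => w n * w' n)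
        - S.c n * (S.T (n + 1) (fun n => y n * z n) - S.T (n + 1) y * S.T (n + 1) z
          - S.T (n + 1) fun n => w n * w' n) * S.c n
        = (X - S.d n * w n) * X' + S.d n * w n * (X' - w' n * S.d n) := by
      have h1 := defect_rec (S := S) hy hz n
      rw [← hX, ← hX'] at h1
      have h2 := T_rec (S := S) hww n
      calc _ = (S.T n (fun n => y n * z n) - S.T n y * S.T n z
            - S.c n * (S.T (n + 1) (fun n => y n * z n) - S.T (n + 1) y * S.T (n + 1) z) * S.c n)
            - ((S.T n fun n => w n * w' n)
              - S.c n * (S.T (n + 1) fun n => w n * w' n) * S.c n) := by noncomm_ring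
        _ = X * X' - S.d n * (w n * w' n) * S.d n := by rw [h1, h2]; noncomm_ring
        _ = _ := by noncomm_ring
    have h1 : ‖X - S.d n * w n‖ ≤ (M + 2) * (1 / 2) ^ n := by
      have : X - S.d n * w n = -(S.c n * (S.T (n + 1) y * S.d n - y (n + 1) * S.d n))
          + S.c n * (S.d n * y (n + 1) - y (n + 1) * S.d n) := by
        have : S.c n * (S.d n * y (n + 1) - y (n + 1) * S.d n)
            = (S.c n * S.d n) * y (n + 1) - S.c n * y (n + 1) * S.d n := by noncomm_ring
        rw [hX, hw, this, S.c_mul_d]; noncomm_ring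
      rw [this]
      refine (norm_add_le_of_le ((norm_neg _).trans_le ((S.norm_c_mul_le _ _).trans
        (norm_T_mul_sub_le hy (hqy.mono hn) (S.star_d n) (S.norm_d_le_two n) (S.norm_c_mul_d_le n))))
        ((S.norm_c_mul_le _ _).trans (hqy n hn (n + 1) (Or.inr rfl)).2)).trans (le_of_eq ?_)
      ring
    have h2 : ‖X' - w' n * S.d n‖ ≤ (M + 2) * (1 / 2) ^ n := by
      have : X' - w' n * S.d n = -((S.d n * S.T (n + 1) z - S.d n * z (n + 1)) * S.c n)
          - (S.d n * z (n + 1) - z (n + 1) * S.d n) * S.c n := by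
        have : (S.d n * z (n + 1) - z (n + 1) * S.d n) * S.c n
            = S.d n * z (n + 1) * S.c n - z (n + 1) * (S.d n * S.c n) := by noncomm_ring
        rw [hX', hw', this, ← S.c_mul_d]; noncomm_ring
      rw [this]
      refine (norm_sub_le_of_le ((norm_neg _).trans_le ((S.norm_mul_c_le _ _).trans
        (norm_mul_T_sub_le hz (hqz.mono hn) (S.star_d n) (S.norm_d_le_two n) (S.norm_c_mul_d_le n))))
        ((S.norm_mul_c_le _ _).trans (hqz n hn (n + 1) (Or.inr rfl)).2)).trans (le_of_eq ?_)
      ring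
    have h3 : ‖X'‖ ≤ 2 * M := by
      rw [two_mul]
      exact norm_sub_le_of_le ((S.norm_mul_d_le _ _).trans ((S.norm_c_mul_le _ _).trans (hz _)))
        ((S.norm_mul_c_le _ _).trans ((S.norm_d_mul_le _ _).trans (norm_T_le hz fun n _ => hz n)))
    rw [e]
    refine (norm_add_le_of_le (norm_mul_le_of_le h1 h3)
      (norm_mul_le_of_le ((S.norm_d_mul_le _ _).trans (hwM n)) h2)).trans (le_of_eq ?_)
    ring)
  have hT : ‖S.T k fun n => w n * w' n‖ ≤ (η + (1 / 2) ^ k) * (2 * M) := by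
    refine norm_T_le hww fun n hn => norm_mul_le_of_le ?_ (hwM' n)
    have : w n = (S.v n * y n - y n * S.v n) + S.c n * (y n - y (n + 1)) := by
      simp only [hw, c]; noncomm_ring
    rw [this, add_comm η]
    refine norm_add_le_of_le ((hqy n hn n (Or.inl rfl)).1.trans ?_)
      ((S.norm_c_mul_le _ _).trans (hη n hn))
    exact pow_le_pow_of_le_one (by norm_num) (by norm_num) hn
  calc _ = ‖(S.T k (fun n => y n * z n) - S.T k y * S.T k z - S.T k fun n => w n * w' n)
        + S.T k fun n => w n * w' n‖ := by rw [sub_add_cancel]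
    _ ≤ _ := norm_add_le_of_le hrec hT
    _ = _ := by ring

/-- `T k` and `T (k + 1)` are close on slowly varying sequences almost commuting with the
system. -/
theorem norm_T_sub_T_succ_le (hy : ∀ n, ‖y n‖ ≤ M) (hq : S.QuasiCommutes k y) :
    ‖S.T k y - S.T (k + 1) y‖ ≤ ‖y k - y (k + 1)‖ + (3 * M + 5) * (1 / 2) ^ k := by
  set t := S.T (k + 1) y with ht
  have e : S.T k y - t = S.d k * ((y k * S.d k - S.d k * y k) + S.d k * (y k - y (k + 1))
        - (S.d k * t - S.d k * y (k + 1)))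
      + S.c k * ((S.v k * t - S.v k * y (k + 1)) + (S.v k * y (k + 1) - y (k + 1) * S.v k)
        - (t * S.v k - y (k + 1) * S.v k)) := by
    have h1 : t = (S.c k * S.c k + S.d k * S.d k) * t := by rw [S.c_add_d, one_mul]
    calc S.T k y - t = S.d k * y k * S.d k + S.c k * t * S.c k
          - (S.c k * S.c k + S.d k * S.d k) * t := by rw [← h1, T_rec hy k]
      _ = S.d k * (y k * S.d k - S.d k * t) + S.c k * (t * S.c k - S.c k * t) := by noncomm_ring
      _ = _ := by
        have h2 : t * S.c k - S.c k * t = S.v k * t - t * S.v k := by rw [c]; noncomm_ring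
        rw [h2]; noncomm_ring
  have h1 : ‖y k * S.d k - S.d k * y k‖ ≤ (1 / 2) ^ k := by
    rw [norm_sub_rev]; exact (hq k le_rfl k (Or.inl rfl)).2
  rw [e]
  refine (norm_add_le_of_le
    ((S.norm_d_mul_le _ _).trans (norm_sub_le_of_le
      (norm_add_le_of_le h1 (S.norm_d_mul_le _ _))
      (norm_mul_T_sub_le hy hq (S.star_d k) (S.norm_d_le_two k) (S.norm_c_mul_d_le k))))
    ((S.norm_c_mul_le _ _).trans (norm_sub_le_of_le
      (norm_add_le_of_le (norm_mul_T_sub_le hy hq (S.star_v k) (S.norm_v_le k) (S.norm_c_mul_v_le k))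
        (hq k le_rfl (k + 1) (Or.inr rfl)).1)
      (norm_T_mul_sub_le hy hq (S.star_v k) (S.norm_v_le k) (S.norm_c_mul_v_le k))))).trans
    (le_of_eq ?_)
  ring

theorem T_sub_T_succ_mem (hy : ∀ n, ‖y n‖ ≤ M) (k : ℕ) : S.T k y - S.T (k + 1) y ∈ inM D := by
  have e : S.T k y - S.T (k + 1) y = S.d k * (y k * S.d k) - S.v k * S.T (k + 1) y
      - S.T (k + 1) y * S.v k + S.v k * (S.T (k + 1) y * S.v k) := by
    rw [T_rec hy k, c]; noncomm_ring
  rw [e]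
  have hv := S.v_mem k
  exact add_mem (sub_mem (sub_mem (inM_mul_left _ (inM_mul_left _ (S.d_mem k)))
    (inM_mul_right _ hv)) (inM_mul_left _ hv)) (inM_mul_left _ (inM_mul_left _ hv))

/-- `T k` almost fixes the constant sequences that almost commute with the system. -/
theorem norm_T_const_sub_le {m : 𝓜(ℂ, D)} (hq : S.QuasiCommutes k fun _ => m) :
    ‖S.T k (fun _ => m) - m‖ ≤ 4 * (1 / 2) ^ k := by
  have hm : ∀ n : ℕ, ‖(fun _ => m) n‖ ≤ ‖m‖ := fun _ => le_rfl
  have h := norm_le_of_recursion (S := S) (fun n => S.T n (fun _ => m) - m) (R := ‖m‖ + ‖m‖) (K := 2)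
    (k := k) (fun n => norm_sub_le_of_le (norm_T_le hm fun n _ => hm n) le_rfl) (by
    intro n hn
    have e : S.T n (fun _ => m) - m - S.c n * (S.T (n + 1) (fun _ => m) - m) * S.c n
        = -(S.d n * (S.d n * m - m * S.d n)) + S.c n * (S.v n * m - m * S.v n) := by
      have h1 : m = (S.c n * S.c n + S.d n * S.d n) * m := by rw [S.c_add_d, one_mul]
      have h2 : S.v n * m - m * S.v n = m * S.c n - S.c n * m := by rw [c]; noncomm_ring
      rw [T_rec hm n, h2]
      calc _ = S.d n * m * S.d n + S.c n * m * S.c n - m := by noncomm_ring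
        _ = S.d n * m * S.d n + S.c n * m * S.c n - (S.c n * S.c n + S.d n * S.d n) * m := by
          rw [← h1]
        _ = _ := by noncomm_ring
    rw [e]
    have h3 := hq n hn n (Or.inl rfl)
    refine (norm_add_le_of_le ((norm_neg _).trans_le ((S.norm_d_mul_le _ _).trans h3.2))
      ((S.norm_c_mul_le _ _).trans h3.1)).trans (le_of_eq (by ring)))
  linarith

/-- If `v n` is almost a unit on `y (n + 1)`, the sum defining `T k y` converges in norm, so that
`T k y` is in `D`. -/
theorem T_mem_of_absorbed (hy : ∀ n, ‖y n‖ ≤ M) {N : ℕ} {C : ℝ}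
    (h : ∀ n ≥ N, ‖S.c n * y (n + 1)‖ ≤ C * (1 / 2) ^ n)
    (hd : ∀ n ≥ N, ‖S.d n * y n - y n * S.d n‖ ≤ C * (1 / 2) ^ n) (k : ℕ) :
    S.T k y ∈ inM D := by
  have hC : 0 ≤ C := by
    have := (norm_nonneg _).trans (h N le_rfl)
    exact nonneg_of_mul_nonneg_left this (by positivity)
  have hρ : ∀ n ≥ N, ‖S.c n * S.T (n + 1) y * S.c n‖ ≤ 2 * (2 * C) * (1 / 2) ^ n := by
    intro n hn
    refine norm_le_of_recursion (S := S) (fun n => S.c n * S.T (n + 1) y * S.c n) (R := M)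
      (fun n => (S.norm_c_mul_c_le _ _).trans (norm_T_le hy fun n _ => hy n)) fun l hl => ?_
    have e : S.c l * S.T (l + 1) y * S.c l
        - S.c l * (S.c (l + 1) * S.T (l + 1 + 1) y * S.c (l + 1)) * S.c l
        = (S.c l * y (l + 1) * S.d (l + 1)
          + S.c l * (S.d (l + 1) * y (l + 1) - y (l + 1) * S.d (l + 1))) * S.d (l + 1) * S.c l := by
      rw [T_rec hy (l + 1)]; noncomm_ring
    rw [e]
    refine (S.norm_mul_c_le _ _).trans ((S.norm_mul_d_le _ _).trans ?_)
    refine (norm_add_le_of_le ((S.norm_mul_d_le _ _).trans (h l (hn.trans hl)))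
      ((S.norm_c_mul_le _ _).trans (hd (l + 1) (by omega)))).trans ?_
    have : 0 ≤ C * (1 / 2 : ℝ) ^ l := by positivity
    rw [pow_succ]; linarith
  have hlim : Tendsto (fun n => S.partialT y k (n + 1)) atTop (𝓝 (S.T k y)) := by
    rw [tendsto_iff_norm_sub_tendsto_zero]
    have h0 : Tendsto (fun n : ℕ => 2 * (2 * C) * (1 / 2 : ℝ) ^ n) atTop (𝓝 0) := by
      simpa using (tendsto_pow_atTop_nhds_zero_of_lt_one (by norm_num : (0 : ℝ) ≤ 1 / 2)
        (by norm_num)).const_mul (2 * (2 * C))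
    refine squeeze_zero' (Eventually.of_forall fun _ => norm_nonneg _) ?_ h0
    filter_upwards [eventually_ge_atTop N] with n hn
    have e : S.partialT y k (n + 1) - S.T k y = -(star (S.cprod k n)
        * ((S.c (k + n) * S.T (k + n + 1) y * S.c (k + n)) * S.cprod k n)) := by
      rw [T_eq_partialT_add hy k (n + 1), cprod_succ', star_mul, S.star_c,
        show k + (n + 1) = k + n + 1 by omega]
      noncomm_ring
    rw [e, norm_neg]
    refine (S.norm_star_cprod_mul_le _ _ _).trans ?_
    rw [← norm_star, star_mul]
    refine (S.norm_star_cprod_mul_le _ _ _).trans ?_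
    rw [norm_star]
    refine (hρ (k + n) (by omega)).trans ?_
    exact mul_le_mul_of_nonneg_left (pow_le_pow_of_le_one (by norm_num) (by norm_num) (by omega))
      (by positivity)
  exact isClosed_inM.mem_of_tendsto hlim (Eventually.of_forall fun n => S.partialT_mem y k _)

/-- Membership of `T k y` in `D` may be tested on approximations of the tail of `y`. -/
theorem T_mem_of_approx (hy : ∀ n, ‖y n‖ ≤ M)
    (h : ∀ ε > 0, ∃ (z : ℕ → 𝓜(ℂ, D)) (M' : ℝ) (N : ℕ), (∀ n, ‖z n‖ ≤ M') ∧
      (∀ k, S.T k z ∈ inM D) ∧ ∀ n ≥ N, ‖y n - z n‖ ≤ ε) (k : ℕ) : S.T k y ∈ inM D := by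
  refine isClosed_inM.closure_subset (Metric.mem_closure_iff.2 fun ε hε => ?_)
  obtain ⟨z, M', N, hz, hzm, hN⟩ := h (ε / 2) (half_pos hε)
  have hyz : ∀ n, ‖y n - z n‖ ≤ M + M' := fun n => norm_sub_le_of_le (hy n) (hz n)
  refine ⟨S.T k z + S.partialT (fun n => y n - z n) k N,
    add_mem (hzm k) (S.partialT_mem _ _ _), ?_⟩
  have h1 := T_eq_partialT_add (S := S) hyz k N
  rw [T_sub hy hz] at h1
  have h2 : S.T k y - (S.T k z + S.partialT (fun n => y n - z n) k N)
      = star (S.cprod k N) * (S.T (k + N) (fun n => y n - z n) * S.cprod k N) := by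
    rw [← sub_sub, h1, mul_assoc]; abel
  rw [dist_eq_norm, h2]
  refine lt_of_le_of_lt ((S.norm_star_cprod_mul_le _ _ _).trans ?_) (half_lt_self hε)
  rw [← norm_star, star_mul]
  refine (S.norm_star_cprod_mul_le _ _ _).trans ?_
  rw [norm_star]
  exact norm_T_le hyz fun n hn => hN n (by omega)

end QCSystem

/-! ### Asymptotic homomorphisms and partitions of the half-line -/

section AsymptoticMultiplicativity

/-- Asymptotic homomorphisms along an arbitrary filter, without continuity in the parameter, but
with pointwise bounds. -/
structure IsAsympMul {ι A E : Type*} [NonUnitalCStarAlgebra A] [NonUnitalCStarAlgebra E]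
    (l : Filter ι) (φ : ι → A → E) : Prop where
  bdd : ∀ a, ∃ M : ℝ, ∀ᶠ i in l, ‖φ i a‖ ≤ M
  add : ∀ a b, Tendsto (fun i => φ i (a + b) - (φ i a + φ i b)) l (𝓝 0)
  smul : ∀ (c : ℂ) a, Tendsto (fun i => φ i (c • a) - c • φ i a) l (𝓝 0)
  mul : ∀ a b, Tendsto (fun i => φ i (a * b) - φ i a * φ i b) l (𝓝 0)
  star : ∀ a, Tendsto (fun i => φ i (star a) - star (φ i a)) l (𝓝 0)

variable {ι κ A E : Type*} [NonUnitalCStarAlgebra A] [NonUnitalCStarAlgebra E] {l : Filter ι}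
  {φ φ' : ι → A → E}

theorem IsAsympMul.comp (h : IsAsympMul l φ) {l' : Filter κ} {u : κ → ι} (hu : Tendsto u l' l) :
    IsAsympMul l' fun i => φ (u i) where
  bdd a := (h.bdd a).imp fun _ hM => hu.eventually hM
  add a b := (h.add a b).comp hu
  smul c a := (h.smul c a).comp hu
  mul a b := (h.mul a b).comp hu
  star a := (h.star a).comp hu

/-- Asymptotic multiplicativity is stable under perturbations tending to `0`. -/
theorem IsAsympMul.perturb (h : IsAsympMul l φ) (h' : ∀ a, Tendsto (fun i => φ' i a - φ i a) l (𝓝 0)) :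
    IsAsympMul l φ' := by
  have hb : ∀ a, ∃ M : ℝ, ∀ᶠ i in l, ‖φ' i a‖ ≤ M := fun a => by
    obtain ⟨M, hM⟩ := h.bdd a
    refine ⟨1 + M, ?_⟩
    filter_upwards [hM, (h' a).norm.eventually (Iic_mem_nhds (by simp : ‖(0 : E)‖ < 1))] with i h1 h2
    calc ‖φ' i a‖ = ‖(φ' i a - φ i a) + φ i a‖ := by rw [sub_add_cancel]
      _ ≤ 1 + M := norm_add_le_of_le h2 h1
  have hbu : ∀ {ψ : ι → A → E} (a : A), (∃ M : ℝ, ∀ᶠ i in l, ‖ψ i a‖ ≤ M) →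
      IsBoundedUnder (· ≤ ·) l ((‖·‖) ∘ fun i => ψ i a) := fun a hM =>
    hM.imp fun M hM => eventually_map.2 hM
  refine ⟨hb, fun a b => ?_, fun c a => ?_, fun a b => ?_, fun a => ?_⟩
  · have := ((h' (a + b)).add (h.add a b)).sub ((h' a).add (h' b))
    simp only [add_zero, sub_zero] at this
    exact this.congr fun i => by abel
  · have := ((h' (c • a)).add (h.smul c a)).sub ((h' a).const_smul c)
    simp only [add_zero, smul_zero, sub_zero] at this
    exact this.congr fun i => by rw [smul_sub]; abel
  · have := ((h' (a * b)).add (h.mul a b)).sub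
      (((h' a).zero_mul_isBoundedUnder_le (hbu b (hb b))).add
        (Filter.isBoundedUnder_le_mul_tendsto_zero (hbu a (h.bdd a)) (h' b)))
    simp only [add_zero, sub_zero] at this
    exact this.congr fun i => by noncomm_ring
  · have := ((h' (Star.star a)).add (h.star a)).sub (continuous_star.tendsto _ |>.comp (h' a))
    simp only [add_zero, star_zero, sub_zero] at this
    exact this.congr fun i => by simp only [Function.comp, star_sub]; abel

theorem IsAsympMul.isAsymptoticHom {φ : Set.Ici (1 : ℝ) → A → E} (h : IsAsympMul atTop φ)
    (hc : ∀ a, Continuous fun t => φ t a) : IsAsymptoticHom φ :=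
  ⟨hc, h.add, h.smul, h.mul, h.star⟩

end AsymptoticMultiplicativity

section Contractivity

variable {A : Type*} [NonUnitalCStarAlgebra A]

/-- If `‖a‖ < 1`, then `b = 1 - √(1 - a⋆ a)` satisfies `a⋆ a + (1 - b)² = 1`. -/
theorem exists_quasi_sqrt {a : A} (ha : ‖a‖ < 1) :
    ∃ b : A, star b = b ∧ star a * a + b * b = b + b := by
  let _ := CStarAlgebra.spectralOrder A
  have := CStarAlgebra.spectralOrderedRing A
  set p := star a * a with hp
  have hsa : IsSelfAdjoint p := IsSelfAdjoint.star_mul_self a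
  have hle : ∀ x ∈ quasispectrum ℝ p, x ≤ 1 := by
    intro x hx
    have h1 : ‖x‖ ≤ ‖p‖ := by
      have := NonUnitalIsometricContinuousFunctionalCalculus.norm_quasispectrum_le p hx hsa
      exact this
    rw [hp, CStarRing.norm_star_mul_self] at h1
    nlinarith [norm_nonneg a, le_abs_self x, Real.norm_eq_abs x]
  let f : ℝ → ℝ := fun x => 1 - √(1 - x)
  refine ⟨cfcₙ f p, cfcₙ_predicate (R := ℝ) f p, ?_⟩
  have hf0 : f 0 = 0 := by simp [f]
  have hfc : Continuous f := by fun_prop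
  have e1 : cfcₙ f p * cfcₙ f p = cfcₙ (fun x => f x * f x) p :=
    (cfcₙ_mul f f p hfc.continuousOn hf0 hfc.continuousOn hf0).symm
  have e2 : p + cfcₙ f p * cfcₙ f p = cfcₙ (fun x => x + f x * f x) p := by
    rw [e1]
    conv_lhs => rw [← cfcₙ_id' ℝ p hsa]
    have h3 := cfcₙ_id' ℝ p hsa
    rw [h3]
    nth_rewrite 1 [← h3]
    exact (cfcₙ_add (fun x => x) (fun x => f x * f x) p (by fun_prop) rfl
      (by fun_prop) (by simp [hf0])).symm
  have e3 : cfcₙ f p + cfcₙ f p = cfcₙ (fun x => f x + f x) p :=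
    (cfcₙ_add f f p hfc.continuousOn hf0 hfc.continuousOn hf0).symm
  rw [e2, e3]
  refine cfcₙ_congr fun x hx => ?_
  have h4 := Real.mul_self_sqrt (sub_nonneg.2 (hle x hx))
  simp only [f]
  linarith

variable {E : Type*} [CStarAlgebra E] {φ : Set.Ici (1 : ℝ) → A → E}

theorem norm_le_three_of_approx {x y xs p q s₁ : E}
    (h1 : ‖xs - star x‖ ≤ 1 / 10) (h2 : ‖p - xs * x‖ ≤ 1 / 10)
    (h3 : ‖s₁ - (p + q)‖ ≤ 1 / 10) (h4 : ‖s₁ - (y + y)‖ ≤ 1 / 10)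
    (h5 : ‖y - star y‖ ≤ 1 / 10) (h6 : ‖q - y * y‖ ≤ 1 / 10) : ‖x‖ ≤ 3 := by
  let _ := CStarAlgebra.spectralOrder E
  have := CStarAlgebra.spectralOrderedRing E
  set r : E := star x * x + star (1 - y) * (1 - y) - 1 with hr
  have hone : ‖(1 : E)‖ ≤ 1 := norm_le_one_of_add_eq_one (d := 0) (by simp)
  have e : r = -((xs - star x) * x) - (p - xs * x) - (s₁ - (p + q)) + (s₁ - (y + y))
      + (y - star y) - (y - star y) * y - (q - y * y) := by
    rw [hr, star_sub, star_one]; noncomm_ring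
  have hrn : ‖r‖ ≤ 1 / 10 * ‖x‖ + 1 / 10 + 1 / 10 + 1 / 10 + 1 / 10 + 1 / 10 * ‖y‖ + 1 / 10 := by
    rw [e]
    exact norm_sub_le_of_le (norm_sub_le_of_le (norm_add_le_of_le (norm_add_le_of_le
      (norm_sub_le_of_le (norm_sub_le_of_le ((norm_neg _).trans_le
      (norm_mul_le_of_le h1 le_rfl)) h2) h3) h4) h5) (norm_mul_le_of_le h5 le_rfl)) h6
  have hsum : ‖star x * x + star (1 - y) * (1 - y)‖ ≤ 1 + ‖r‖ := by
    have : star x * x + star (1 - y) * (1 - y) = 1 + r := by rw [hr]; abel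
    rw [this]
    exact norm_add_le_of_le hone le_rfl
  have hx : ‖x‖ * ‖x‖ ≤ 1 + ‖r‖ := by
    rw [← CStarRing.norm_star_mul_self]
    exact (CStarAlgebra.norm_le_norm_of_nonneg_of_le (star_mul_self_nonneg x)
      (le_add_of_nonneg_right (star_mul_self_nonneg _))).trans hsum
  have hy : ‖1 - y‖ * ‖1 - y‖ ≤ 1 + ‖r‖ := by
    rw [← CStarRing.norm_star_mul_self]
    exact (CStarAlgebra.norm_le_norm_of_nonneg_of_le (star_mul_self_nonneg (1 - y))
      (le_add_of_nonneg_left (star_mul_self_nonneg _))).trans hsum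
  have hy1 : ‖y‖ - 1 ≤ ‖1 - y‖ := by
    have : y = 1 - (1 - y) := by abel
    have h := norm_sub_le (1 : E) (1 - y)
    rw [← this] at h
    linarith
  have hx0 := norm_nonneg x
  rcases le_total ‖y‖ 1 with h | h
  · nlinarith
  · have h7 : (‖y‖ - 1) * (‖y‖ - 1) ≤ 1 + ‖r‖ :=
      (mul_le_mul hy1 hy1 (by linarith) (norm_nonneg _)).trans hy
    nlinarith [sq_nonneg (‖y‖ - 11 / 10)]

theorem eventually_norm_le {ι F : Type*} [SeminormedAddCommGroup F] {l : Filter ι} {f : ι → F}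
    (h : Tendsto f l (𝓝 0)) {ε : ℝ} (hε : 0 < ε) : ∀ᶠ i in l, ‖f i‖ ≤ ε :=
  h.norm.eventually (Iic_mem_nhds (by rwa [norm_zero]))

/-- Asymptotic homomorphisms are asymptotically bounded on balls: on the unit ball this follows by
applying `φ` to the relation `a⋆ a + (1 - b)² = 1` of `exists_quasi_sqrt`. -/
theorem IsAsymptoticHom.eventually_norm_le (h : IsAsymptoticHom φ) {a : A} {δ : ℝ} (ha : ‖a‖ < δ) :
    ∀ᶠ t in atTop, ‖φ t a‖ ≤ 4 * δ := by
  have hδ : 0 < δ := (norm_nonneg a).trans_lt ha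
  have key : ∀ a : A, ‖a‖ < 1 → ∀ᶠ t in atTop, ‖φ t a‖ ≤ 3 := by
    intro a ha
    obtain ⟨b, hb, hab⟩ := exists_quasi_sqrt ha
    have h5 := h.star b
    rw [hb] at h5
    have h3 := h.add (Star.star a * a) (b * b)
    rw [hab] at h3
    have h10 : (0 : ℝ) < 1 / 10 := by norm_num
    filter_upwards [AsympExt.eventually_norm_le (h.star a) h10,
      AsympExt.eventually_norm_le (h.mul (Star.star a) a) h10, AsympExt.eventually_norm_le h3 h10,
      AsympExt.eventually_norm_le (h.add b b) h10, AsympExt.eventually_norm_le h5 h10,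
      AsympExt.eventually_norm_le (h.mul b b) h10] with t k1 k2 k3 k4 k5 k6
    exact norm_le_three_of_approx k1 k2 k3 k4 k5 k6
  have ha' : ‖((δ⁻¹ : ℝ) : ℂ) • a‖ < 1 := by
    rw [norm_smul, Complex.norm_real, Real.norm_of_nonneg (by positivity), inv_mul_lt_iff₀ hδ]
    simpa using ha
  have hs := h.smul (δ : ℂ) (((δ⁻¹ : ℝ) : ℂ) • a)
  have e : (δ : ℂ) • ((δ⁻¹ : ℝ) : ℂ) • a = a := by
    rw [smul_smul, ← Complex.ofReal_mul, mul_inv_cancel₀ hδ.ne']; simp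
  rw [e] at hs
  filter_upwards [key _ ha', AsympExt.eventually_norm_le hs hδ] with t h1 h2
  have h3 : ‖(δ : ℂ) • φ t (((δ⁻¹ : ℝ) : ℂ) • a)‖ ≤ δ * 3 := by
    rw [norm_smul, Complex.norm_real, Real.norm_of_nonneg hδ.le]; gcongr
  calc ‖φ t a‖ = ‖(φ t a - (δ : ℂ) • φ t (((δ⁻¹ : ℝ) : ℂ) • a))
        + (δ : ℂ) • φ t (((δ⁻¹ : ℝ) : ℂ) • a)‖ := by rw [sub_add_cancel]
    _ ≤ δ + δ * 3 := norm_add_le_of_le h2 h3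
    _ = 4 * δ := by ring

/-- Asymptotic homomorphisms are asymptotically Lipschitz. -/
theorem IsAsymptoticHom.eventually_norm_sub_le (h : IsAsymptoticHom φ) {a b : A} {δ : ℝ}
    (hab : ‖a - b‖ < δ) : ∀ᶠ t in atTop, ‖φ t a - φ t b‖ ≤ 5 * δ := by
  have hδ : 0 < δ := (norm_nonneg _).trans_lt hab
  have h1 := h.add (a - b) b
  rw [sub_add_cancel] at h1
  filter_upwards [h.eventually_norm_le hab, AsympExt.eventually_norm_le h1 hδ] with t k1 k2
  calc ‖φ t a - φ t b‖ = ‖(φ t a - (φ t (a - b) + φ t b)) + φ t (a - b)‖ := by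
        congr 1; abel
    _ ≤ δ + 4 * δ := norm_add_le_of_le k2 k1
    _ = 5 * δ := by ring

theorem continuous_projIci_one : Continuous fun x : ℝ => Set.projIci 1 x :=
  (continuous_const.max continuous_id).subtype_mk _

/-- A continuous function on `[1,∞)` that is bounded near infinity is bounded. -/
theorem exists_bound_of_eventually {F : Type*} [SeminormedAddCommGroup F]
    {G : Set.Ici (1 : ℝ) → F} (hG : Continuous G) {M : ℝ} (hM : ∀ᶠ t in atTop, ‖G t‖ ≤ M) :
    ∃ M', ∀ t, ‖G t‖ ≤ M' := by
  obtain ⟨t₀, ht₀⟩ := eventually_atTop.1 hM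
  have hc : IsCompact (Set.Icc (1 : ℝ) t₀) := isCompact_Icc
  have hG' : Continuous fun x : ℝ => G (Set.projIci 1 x) := hG.comp continuous_projIci_one
  obtain ⟨C, hC⟩ := hc.exists_bound_of_continuousOn hG'.continuousOn
  refine ⟨max M C, fun t => ?_⟩
  rcases le_total t₀ t with h | h
  · exact (ht₀ t h).trans (le_max_left _ _)
  · have := hC t ⟨t.2, h⟩
    rw [Set.projIci_coe] at this
    exact this.trans (le_max_right _ _)

theorem IsAsymptoticHom.exists_bound (h : IsAsymptoticHom φ) (a : A) : ∃ M, ∀ t, ‖φ t a‖ ≤ M :=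
  exists_bound_of_eventually (h.continuous a) (h.eventually_norm_le (lt_add_one ‖a‖))

theorem IsAsymptoticHom.isAsympMul (h : IsAsymptoticHom φ) : IsAsympMul atTop φ :=
  ⟨fun a => (h.exists_bound a).imp fun _ hM => Eventually.of_forall hM, h.add, h.smul, h.mul, h.star⟩

end Contractivity

section Grids

/-- A partition `1 = pt 0 < pt 1 < ⋯ → ∞` of `[1,∞)`. -/
structure Grid where
  pt : ℕ → Set.Ici (1 : ℝ)
  pt_zero : pt 0 = start
  strictMono : StrictMono pt
  tendsto : Tendsto pt atTop atTop

/-- Countably many continuous functions on `[1,∞)` oscillate less and less on the successive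
intervals of a suitable partition of `[1,∞)`. -/
theorem exists_grid {E : Type*} [SeminormedAddCommGroup E] (G : ℕ → Set.Ici (1 : ℝ) → E)
    (hG : ∀ i, Continuous (G i)) :
    ∃ g : Grid, ∀ i, ∀ ε > 0, ∃ K, ∀ k ≥ K, ∀ t t' : Set.Ici (1 : ℝ),
        g.pt k ≤ t → t ≤ g.pt (k + 1) → g.pt k ≤ t' → t' ≤ g.pt (k + 1) → ‖G i t - G i t'‖ ≤ ε := by
  have hδ : ∀ m : ℕ, ∃ δ > 0, δ ≤ (1 : ℝ) ∧ ∀ i ≤ m, ∀ t t' : Set.Ici (1 : ℝ), (t : ℝ) ≤ m + 1 →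
      (t' : ℝ) ≤ m + 1 → |(t : ℝ) - t'| ≤ δ → ‖G i t - G i t'‖ ≤ 1 / (m + 1) := by
    intro m
    have h1 : ∀ i, ∃ δ > 0, ∀ t t' : Set.Ici (1 : ℝ), (t : ℝ) ≤ m + 1 →
      (t' : ℝ) ≤ m + 1 → |(t : ℝ) - t'| ≤ δ → ‖G i t - G i t'‖ ≤ 1 / (m + 1) := by
      intro i
      have hG' : Continuous fun x : ℝ => G i (Set.projIci 1 x) := (hG i).comp continuous_projIci_one
      have hu := (isCompact_Icc (a := (1 : ℝ)) (b := m + 1)).uniformContinuousOn_of_continuous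
        hG'.continuousOn
      obtain ⟨δ, hδ, h⟩ := Metric.uniformContinuousOn_iff.1 hu (1 / (m + 1)) (by positivity)
      refine ⟨δ / 2, by positivity, fun t t' ht ht' htt => ?_⟩
      have := h t ⟨t.2, ht⟩ t' ⟨t'.2, ht'⟩ (by rw [Real.dist_eq]; linarith)
      rw [Set.projIci_coe, Set.projIci_coe, dist_eq_norm] at this
      exact this.le
    choose δ hδ h using h1
    refine ⟨min 1 ((Finset.range (m + 1)).inf' ⟨0, by simp⟩ δ), ?_, min_le_left _ _, ?_⟩
    · refine lt_min one_pos ((Finset.lt_inf'_iff _).2 fun i _ => hδ i)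
    · intro i hi t t' ht ht' htt
      exact h i t t' ht ht' (htt.trans ((min_le_right _ _).trans
        (Finset.inf'_le _ (by simpa [Nat.lt_succ_iff] using hi))))
  choose δ hδ0 hδ1 hδ using hδ
  -- make `δ` antitone
  let δ' : ℕ → ℝ := fun m => (Finset.range (m + 1)).inf' ⟨0, by simp⟩ δ
  have hδ'0 : ∀ m, 0 < δ' m := fun m => (Finset.lt_inf'_iff _).2 fun i _ => hδ0 i
  have hδ'le : ∀ m, δ' m ≤ δ m := fun m => Finset.inf'_le _ (by simp)
  have hδ'anti : ∀ m n, m ≤ n → δ' n ≤ δ' m := fun m n h =>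
    Finset.inf'_mono _ (Finset.range_mono (by omega)) _
  let r : ℕ → ℝ := fun k => Nat.rec 1 (fun _ x => x + δ' ⌈x⌉₊) k
  have hr : ∀ k, r (k + 1) = r k + δ' ⌈r k⌉₊ := fun _ => rfl
  have hmono : StrictMono r := strictMono_nat_of_lt_succ fun k => by
    rw [hr]; linarith [hδ'0 ⌈r k⌉₊]
  have hr1 : ∀ k, 1 ≤ r k := fun k => hmono.monotone (Nat.zero_le k)
  have htop : Tendsto r atTop atTop := by
    refine tendsto_atTop_atTop_of_monotone hmono.monotone fun b => ?_
    by_contra hb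
    push Not at hb
    -- as long as `r` stays below `b`, its increments are at least `δ' ⌈b⌉₊`
    have h1 : ∀ k : ℕ, k * δ' ⌈b⌉₊ ≤ r k := by
      intro k
      induction k with
      | zero => simpa using zero_le_one.trans (hr1 0)
      | succ k ih =>
        rw [hr]
        push_cast
        linarith [hδ'anti ⌈r k⌉₊ ⌈b⌉₊ (Nat.ceil_mono (hb k).le)]
    obtain ⟨k, hk⟩ := exists_nat_gt (b / δ' ⌈b⌉₊)
    rw [div_lt_iff₀ (hδ'0 _)] at hk
    linarith [h1 k, hb k]
  refine ⟨⟨fun k => ⟨r k, hr1 k⟩, rfl, fun k l h => hmono h, ?_⟩, fun i ε hε => ?_⟩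
  · refine tendsto_atTop.2 fun b => ?_
    filter_upwards [tendsto_atTop.1 htop b] with k hk using hk
  · obtain ⟨n, hn⟩ := exists_nat_one_div_lt hε
    obtain ⟨K, hK⟩ := eventually_atTop.1 (tendsto_atTop.1 htop ((max i n : ℕ) : ℝ))
    refine ⟨K, fun k hk t t' h1 h2 h3 h4 => ?_⟩
    set m := ⌈r k⌉₊ with hm
    have hrm : r k ≤ m := Nat.le_ceil _
    have hmi : max i n ≤ m := by exact_mod_cast (hK k hk).trans hrm
    have h1' : r k ≤ t := h1
    have h2' : (t : ℝ) ≤ r k + δ' m := h2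
    have h3' : r k ≤ t' := h3
    have h4' : (t' : ℝ) ≤ r k + δ' m := h4
    have hd := hδ'le m
    have hd1 := hδ1 m
    refine (hδ m i ((le_max_left _ _).trans hmi) t t' (by linarith) (by linarith) ?_).trans ?_
    · rw [abs_le]; constructor <;> linarith
    · refine le_trans ?_ hn.le
      have : (n : ℝ) ≤ m := by exact_mod_cast (le_max_right _ _).trans hmi
      gcongr

namespace Grid

variable (g : Grid)

theorem exists_lt_pt (t : Set.Ici (1 : ℝ)) : ∃ k, t < g.pt (k + 1) := by
  have h := ((tendsto_add_atTop_iff_nat 1).2 g.tendsto).eventually_gt_atTop t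
  exact h.exists

open Classical in
/-- The index `k` of the interval `[g.pt k, g.pt (k + 1))` that contains `t`. -/
noncomputable def index (t : Set.Ici (1 : ℝ)) : ℕ := Nat.find (g.exists_lt_pt t)

/-- The relative position of `t` in the interval of the partition that contains `t`. -/
noncomputable def pos (t : Set.Ici (1 : ℝ)) : ℝ :=
  ((t : ℝ) - g.pt (g.index t)) / ((g.pt (g.index t + 1) : ℝ) - g.pt (g.index t))

/-- The piecewise linear function on `[1,∞)` with the value `ψ k` at `g.pt k`. -/
noncomputable def interp {E : Type*} [AddCommGroup E] [Module ℂ E] (ψ : ℕ → E)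
    (t : Set.Ici (1 : ℝ)) : E :=
  ψ (g.index t) + (g.pos t : ℂ) • (ψ (g.index t + 1) - ψ (g.index t))

theorem lt_pt_succ (t : Set.Ici (1 : ℝ)) : t < g.pt (g.index t + 1) := by
  classical
  exact Nat.find_spec (g.exists_lt_pt t)

theorem pt_le (t : Set.Ici (1 : ℝ)) : g.pt (g.index t) ≤ t := by
  classical
  have h := g.exists_lt_pt t
  rw [index]
  rcases hk : Nat.find h with _ | k
  · rw [g.pt_zero]; exact t.2
  · exact not_lt.1 (Nat.find_min h (by omega : k < Nat.find h))

theorem index_eq {t : Set.Ici (1 : ℝ)} {k : ℕ} (h1 : g.pt k ≤ t) (h2 : t < g.pt (k + 1)) :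
    g.index t = k := by
  have h3 := g.strictMono.lt_iff_lt.1 ((g.pt_le t).trans_lt h2)
  have h4 := g.strictMono.lt_iff_lt.1 (h1.trans_lt (g.lt_pt_succ t))
  omega

theorem pos_nonneg (t : Set.Ici (1 : ℝ)) : 0 ≤ g.pos t := by
  have h1 : (g.pt (g.index t) : ℝ) ≤ t := g.pt_le t
  have h2 : (t : ℝ) < g.pt (g.index t + 1) := g.lt_pt_succ t
  exact div_nonneg (by linarith) (by linarith)

theorem pos_le_one (t : Set.Ici (1 : ℝ)) : g.pos t ≤ 1 := by
  have h1 : (g.pt (g.index t) : ℝ) ≤ t := g.pt_le t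
  have h2 : (t : ℝ) < g.pt (g.index t + 1) := g.lt_pt_succ t
  exact div_le_one_of_le₀ (by linarith) (by linarith)

theorem tendsto_index : Tendsto g.index atTop atTop := by
  refine tendsto_atTop.2 fun k => ?_
  filter_upwards [eventually_ge_atTop (g.pt k)] with t ht
  have h := g.strictMono.lt_iff_lt.1 (ht.trans_lt (g.lt_pt_succ t))
  omega

theorem interp_eq {E : Type*} [AddCommGroup E] [Module ℂ E] (ψ : ℕ → E) {t : Set.Ici (1 : ℝ)}
    {k : ℕ} (h1 : g.pt k ≤ t) (h2 : t ≤ g.pt (k + 1)) :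
    g.interp ψ t = ψ k + ((((t : ℝ) - g.pt k) / ((g.pt (k + 1) : ℝ) - g.pt k) : ℝ) : ℂ)
      • (ψ (k + 1) - ψ k) := by
  rcases h2.lt_or_eq with h | rfl
  · rw [interp, pos, g.index_eq h1 h]
  · have h3 : g.index (g.pt (k + 1)) = k + 1 :=
      g.index_eq le_rfl (g.strictMono (Nat.lt_succ_self _))
    have h4 : (g.pt k : ℝ) < g.pt (k + 1) := g.strictMono (Nat.lt_succ_self k)
    rw [interp, pos, h3, sub_self, zero_div, div_self (by linarith)]
    simp

theorem continuous_interp {E : Type*} [AddCommGroup E] [Module ℂ E] [TopologicalSpace E]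
    [IsTopologicalAddGroup E] [ContinuousSMul ℂ E] (ψ : ℕ → E) : Continuous (g.interp ψ) := by
  have hfin : LocallyFinite fun k => Set.Icc (g.pt k) (g.pt (k + 1)) := by
    intro t
    obtain ⟨t', ht'⟩ : ∃ t' : Set.Ici (1 : ℝ), t < t' := exists_gt t
    refine ⟨Set.Iio t', Iio_mem_nhds ht', ?_⟩
    refine (Set.finite_le_nat (g.index t')).subset ?_
    rintro k ⟨x, hx, hxt⟩
    have h := g.strictMono.lt_iff_lt.1 ((hx.1.trans_lt hxt).trans (g.lt_pt_succ t'))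
    exact Nat.lt_succ_iff.1 h
  refine hfin.continuous (Set.eq_univ_of_forall fun t => Set.mem_iUnion.2
    ⟨g.index t, g.pt_le t, (g.lt_pt_succ t).le⟩) (fun k => isClosed_Icc) fun k => ?_
  refine ContinuousOn.congr (f := fun t : Set.Ici (1 : ℝ) => ψ k
    + ((((t : ℝ) - g.pt k) / ((g.pt (k + 1) : ℝ) - g.pt k) : ℝ) : ℂ) • (ψ (k + 1) - ψ k)) ?_
    fun t ht => g.interp_eq ψ ht.1 ht.2
  refine Continuous.continuousOn (continuous_const.add (Continuous.smul ?_ continuous_const))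
  exact Complex.continuous_ofReal.comp ((continuous_subtype_val.sub continuous_const).div_const _)

end Grid

end Grids

/-! ### Compressions of asymptotically multiplicative families -/

section Families

/-- The filter of `k → ∞`, uniformly in `n ≥ k`, on pairs `(k, n)`. -/
def tailFilter : Filter (ℕ × ℕ) := comap Prod.fst atTop ⊓ 𝓟 {p | p.1 ≤ p.2}

theorem eventually_tailFilter {P : ℕ × ℕ → Prop} :
    (∀ᶠ p in tailFilter, P p) ↔ ∃ K, ∀ k ≥ K, ∀ n ≥ k, P (k, n) := by
  rw [tailFilter, eventually_inf_principal, eventually_comap]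
  simp only [eventually_atTop]
  constructor
  · rintro ⟨K, hK⟩
    exact ⟨K, fun k hk n hn => hK k hk (k, n) rfl hn⟩
  · rintro ⟨K, hK⟩
    exact ⟨K, fun k hk p hp hpn => by subst hp; exact hK _ hk _ hpn⟩

/-- To test whether asymptotically Lipschitz maps tend to `0` pointwise, a dense sequence of points
suffices. -/
theorem tendsto_zero_of_dense {A E : Type*} [SeminormedAddCommGroup A] [SeminormedAddCommGroup E]
    {x : ℕ → A} (hx : DenseRange x) (F : ℕ → A → E) {C : ℝ}
    (hF : ∀ a b δ, ‖a - b‖ < δ → ∀ᶠ k in atTop, ‖F k a - F k b‖ ≤ C * δ)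
    (h : ∀ i, Tendsto (fun k => F k (x i)) atTop (𝓝 0)) (a : A) :
    Tendsto (fun k => F k a) atTop (𝓝 0) := by
  rw [tendsto_zero_iff_norm_tendsto_zero, Metric.tendsto_atTop']
  intro ε hε
  obtain ⟨_, ⟨i, rfl⟩, hi⟩ := Metric.mem_closure_iff.1 (hx a) (ε / (2 * (|C| + 1))) (by positivity)
  rw [dist_eq_norm] at hi
  have hC : C * (ε / (2 * (|C| + 1))) ≤ ε / 2 := by
    calc _ ≤ (|C| + 1) * (ε / (2 * (|C| + 1))) := by
          gcongr; linarith [le_abs_self C]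
      _ = ε / 2 := by field_simp
  have h1 := (hF a (x i) _ hi).and
    (((h i).norm.eventually (gt_mem_nhds (by simpa using half_pos hε : ‖(0 : E)‖ < ε / 2))))
  obtain ⟨N, hN⟩ := eventually_atTop.1 h1
  refine ⟨N, fun k hk => ?_⟩
  have h2 := hN k hk.le
  rw [dist_zero_right, norm_norm]
  calc ‖F k a‖ = ‖(F k a - F k (x i)) + F k (x i)‖ := by rw [sub_add_cancel]
    _ ≤ ‖F k a - F k (x i)‖ + ‖F k (x i)‖ := norm_add_le _ _
    _ < ε := by linarith [h2.1, h2.2]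

/-- A doubly indexed family of maps `y k n : A → M(D)` that, as `k → ∞` uniformly in `n ≥ k`, is
asymptotically multiplicative and Lipschitz, and varies slowly with `k` and `n`. -/
structure IsAsympFamily {A D : Type*} [NonUnitalCStarAlgebra A] [NonUnitalCStarAlgebra D]
    (y : ℕ → ℕ → A → 𝓜(ℂ, D)) : Prop where
  bdd : ∀ a, ∃ M : ℝ, ∀ k n, ‖y k n a‖ ≤ M
  asympMul : IsAsympMul tailFilter fun p a => y p.1 p.2 a
  lipschitz : ∀ a b δ, ‖a - b‖ < δ → ∀ᶠ p in tailFilter, ‖y p.1 p.2 a - y p.1 p.2 b‖ ≤ 5 * δ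
  slow : ∀ a, Tendsto (fun p : ℕ × ℕ => y p.1 p.2 a - y p.1 (p.2 + 1) a) tailFilter (𝓝 0)
  slow' : ∀ a, Tendsto (fun p : ℕ × ℕ => y (p.1 + 1) p.2 a - y p.1 p.2 a) tailFilter (𝓝 0)

variable {A D : Type*} [NonUnitalCStarAlgebra A] [NonUnitalCStarAlgebra D] {S : QCSystem D}
  {y : ℕ → ℕ → A → 𝓜(ℂ, D)}

theorem eventually_norm_T_le {Y : ℕ → ℕ → 𝓜(ℂ, D)} {M : ℝ} (hY : ∀ k n, ‖Y k n‖ ≤ M) {C : ℝ}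
    (h : ∀ᶠ p in tailFilter, ‖Y p.1 p.2‖ ≤ C) : ∀ᶠ k in atTop, ‖S.T k (Y k)‖ ≤ C := by
  obtain ⟨K, hK⟩ := eventually_tailFilter.1 h
  filter_upwards [eventually_ge_atTop K] with k hk
  exact QCSystem.norm_T_le (hY k) (hK k hk)

theorem tendsto_T_zero {Y : ℕ → ℕ → 𝓜(ℂ, D)} {M : ℝ} (hY : ∀ k n, ‖Y k n‖ ≤ M)
    (h : Tendsto (fun p : ℕ × ℕ => Y p.1 p.2) tailFilter (𝓝 0)) :
    Tendsto (fun k => S.T k (Y k)) atTop (𝓝 0) := by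
  rw [NormedAddGroup.tendsto_nhds_zero]
  intro ε hε
  filter_upwards [eventually_norm_T_le (S := S) hY (eventually_norm_le h (half_pos hε))] with k hk
  linarith

theorem tendsto_half_pow : Tendsto (fun k : ℕ => (1 / 2 : ℝ) ^ k) atTop (𝓝 0) :=
  tendsto_pow_atTop_nhds_zero_of_lt_one (by norm_num) (by norm_num)

/-- The compressions `T k (y k · a)` of an asymptotic family almost commuting with the system are
asymptotically multiplicative. -/
theorem IsAsympFamily.isAsympMul_T (h : IsAsympFamily y) {x : ℕ → A} (hx : DenseRange x)
    (hq : ∀ i k, i ≤ k → S.QuasiCommutes k fun n => y k n (x i)) :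
    IsAsympMul atTop fun k a => S.T k fun n => y k n a := by
  choose M hM using h.bdd
  have hM0 : ∀ a, 0 ≤ M a := fun a => (norm_nonneg _).trans (hM a 0 0)
  refine ⟨fun a => ⟨M a, Eventually.of_forall fun k =>
    QCSystem.norm_T_le (hM a k) fun n _ => hM a k n⟩, fun a b => ?_, fun c a => ?_, fun a b => ?_,
    fun a => ?_⟩
  · have h1 := tendsto_T_zero (S := S) (Y := fun k n => y k n (a + b) - (y k n a + y k n b))
      (fun k n => norm_sub_le_of_le (hM _ k n) (norm_add_le_of_le (hM a k n) (hM b k n)))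
      (h.asympMul.add a b)
    refine h1.congr fun k => ?_
    rw [QCSystem.T_sub (hM _ k) (fun n => norm_add_le_of_le (hM a k n) (hM b k n)),
      QCSystem.T_add (hM a k) (hM b k)]
  · have hc : ∀ k n, ‖c • y k n a‖ ≤ ‖c‖ * M a := fun k n => by
      rw [norm_smul]; exact mul_le_mul_of_nonneg_left (hM a k n) (norm_nonneg c)
    have h1 := tendsto_T_zero (S := S) (Y := fun k n => y k n (c • a) - c • y k n a)
      (fun k n => norm_sub_le_of_le (hM _ k n) (hc k n)) (h.asympMul.smul c a)
    refine h1.congr fun k => ?_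
    rw [QCSystem.T_sub (hM _ k) (hc k), QCSystem.T_smul c (hM a k)]
  · have hab : ∀ a b k n, ‖y k n a * y k n b‖ ≤ M a * M b := fun a b k n =>
      norm_mul_le_of_le (hM a k n) (hM b k n)
    have h1 := tendsto_T_zero (S := S) (Y := fun k n => y k n (a * b) - y k n a * y k n b)
      (fun k n => norm_sub_le_of_le (hM _ k n) (hab a b k n)) (h.asympMul.mul a b)
    let δ : ℕ → A → A → 𝓜(ℂ, D) := fun k a b => S.T k (fun n => y k n a * y k n b)
      - S.T k (fun n => y k n a) * S.T k fun n => y k n b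
    have hdense : ∀ i j, Tendsto (fun k => δ k (x i) (x j)) atTop (𝓝 0) := by
      intro i j
      set R := max (M (x i)) (M (x j))
      rw [NormedAddGroup.tendsto_nhds_zero]
      intro ε hε
      have hR : 0 ≤ R := (hM0 _).trans (le_max_left _ _)
      obtain ⟨K, hK⟩ := eventually_tailFilter.1 (eventually_norm_le (h.slow (x i))
        (show 0 < ε / (4 * (R + 1)) by positivity))
      have h2 : Tendsto (fun k : ℕ => (2 * R + 8 * R * (R + 2)) * (1 / 2 : ℝ) ^ k) atTop (𝓝 0) := by
        simpa using tendsto_half_pow.const_mul (2 * R + 8 * R * (R + 2))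
      filter_upwards [eventually_ge_atTop (max K (max i j)),
        h2.eventually (gt_mem_nhds (half_pos hε))] with k hk hk2
      have h3 := QCSystem.norm_T_mul_sub_mul_le (S := S)
        (fun n => (hM (x i) k n).trans (le_max_left _ _))
        (fun n => (hM (x j) k n).trans (le_max_right _ _))
        (hq i k (by omega)) (hq j k (by omega)) (hK k (by omega))
      refine h3.trans_lt ?_
      have h4 : 2 * R * (ε / (4 * (R + 1))) ≤ ε / 2 := by
        rw [← mul_div_assoc, div_le_div_iff₀ (by positivity) two_pos]
        nlinarith
      linarith
    have hδ : ∀ {u v : ℕ → 𝓜(ℂ, D)} {k : ℕ} {P Q U V : ℝ}, (∀ n, ‖u n‖ ≤ P) → (∀ n, ‖v n‖ ≤ Q) →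
        (∀ n ≥ k, ‖u n‖ ≤ U) → (∀ n ≥ k, ‖v n‖ ≤ V) →
        ‖S.T k (fun n => u n * v n) - S.T k u * S.T k v‖ ≤ U * V + U * V :=
      fun {u v k P Q U V} hP hQ hU hV =>
        norm_sub_le_of_le (QCSystem.norm_T_le (fun n => norm_mul_le_of_le (hP n) (hQ n))
          fun n hn => norm_mul_le_of_le (hU n hn) (hV n hn))
          (norm_mul_le_of_le (QCSystem.norm_T_le hP hU) (QCSystem.norm_T_le hQ hV))
    have hr : ∀ i b, Tendsto (fun k => δ k (x i) b) atTop (𝓝 0) := by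
      intro i
      refine tendsto_zero_of_dense hx (fun k b => δ k (x i) b) (C := 10 * M (x i))
        (fun b b' ε hε => ?_) (hdense i)
      obtain ⟨K, hK⟩ := eventually_tailFilter.1 (h.lipschitz b b' ε hε)
      filter_upwards [eventually_ge_atTop K] with k hk
      have hbb : ∀ n, ‖y k n b - y k n b'‖ ≤ M b + M b' := fun n =>
        norm_sub_le_of_le (hM b k n) (hM b' k n)
      have e : δ k (x i) b - δ k (x i) b' = S.T k (fun n => y k n (x i) * (y k n b - y k n b'))
          - S.T k (fun n => y k n (x i)) * S.T k fun n => y k n b - y k n b' := by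
        simp only [δ, mul_sub]
        rw [QCSystem.T_sub (hab _ b k) (hab _ b' k), QCSystem.T_sub (hM b k) (hM b' k)]
        noncomm_ring
      rw [e]
      refine (hδ (hM _ k) hbb (fun n _ => hM _ k n) (hK k hk)).trans (le_of_eq (by ring))
    have hl : ∀ a b, Tendsto (fun k => δ k a b) atTop (𝓝 0) := by
      intro a b
      refine tendsto_zero_of_dense hx (fun k a => δ k a b) (C := 10 * M b)
        (fun a a' ε hε => ?_) (fun i => hr i b) a
      obtain ⟨K, hK⟩ := eventually_tailFilter.1 (h.lipschitz a a' ε hε)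
      filter_upwards [eventually_ge_atTop K] with k hk
      have haa : ∀ n, ‖y k n a - y k n a'‖ ≤ M a + M a' := fun n =>
        norm_sub_le_of_le (hM a k n) (hM a' k n)
      have e : δ k a b - δ k a' b = S.T k (fun n => (y k n a - y k n a') * y k n b)
          - S.T k (fun n => y k n a - y k n a') * S.T k fun n => y k n b := by
        simp only [δ, sub_mul]
        rw [QCSystem.T_sub (hab a _ k) (hab a' _ k), QCSystem.T_sub (hM a k) (hM a' k)]
        noncomm_ring
      rw [e]
      refine (hδ haa (hM _ k) (hK k hk) (fun n _ => hM _ k n)).trans (le_of_eq (by ring))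
    have h2 := h1.add (hl a b)
    rw [add_zero] at h2
    refine h2.congr fun k => ?_
    rw [QCSystem.T_sub (hM _ k) (hab a b k)]
    simp only [δ]
    abel
  · have h1 := tendsto_T_zero (S := S) (Y := fun k n => y k n (star a) - star (y k n a))
      (fun k n => norm_sub_le_of_le (hM _ k n) ((norm_star _).trans_le (hM a k n)))
      (h.asympMul.star a)
    refine h1.congr fun k => ?_
    rw [QCSystem.T_sub (hM _ k) (fun n => (norm_star _).trans_le (hM a k n)),
      QCSystem.T_star (hM a k)]

/-- Successive compressions `T k (y k · a)` are asymptotically equal. -/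
theorem IsAsympFamily.tendsto_T_succ_sub (h : IsAsympFamily y) {x : ℕ → A} (hx : DenseRange x)
    (hq : ∀ i k, i ≤ k → S.QuasiCommutes k fun n => y k n (x i)) (a : A) :
    Tendsto (fun k => S.T (k + 1) (fun n => y (k + 1) n a) - S.T k fun n => y k n a)
      atTop (𝓝 0) := by
  choose M hM using h.bdd
  have h1 : Tendsto (fun k => S.T (k + 1) fun n => y (k + 1) n a - y k n a) atTop (𝓝 0) := by
    rw [NormedAddGroup.tendsto_nhds_zero]
    intro ε hε
    obtain ⟨K, hK⟩ := eventually_tailFilter.1 (eventually_norm_le (h.slow' a) (half_pos hε))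
    filter_upwards [eventually_ge_atTop K] with k hk
    exact (QCSystem.norm_T_le (fun n => norm_sub_le_of_le (hM a _ n) (hM a k n))
      fun n hn => hK k hk n (by omega)).trans_lt (half_lt_self hε)
  have h2 : Tendsto (fun k => S.T k (fun n => y k n a) - S.T (k + 1) fun n => y k n a)
      atTop (𝓝 0) := by
    refine tendsto_zero_of_dense hx
      (fun k a => S.T k (fun n => y k n a) - S.T (k + 1) fun n => y k n a) (C := 10)
      (fun a b δ hδ => ?_) (fun i => ?_) a
    · obtain ⟨K, hK⟩ := eventually_tailFilter.1 (h.lipschitz a b δ hδ)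
      filter_upwards [eventually_ge_atTop K] with k hk
      have hab : ∀ n, ‖y k n a - y k n b‖ ≤ M a + M b := fun n =>
        norm_sub_le_of_le (hM a k n) (hM b k n)
      have e : S.T k (fun n => y k n a) - S.T (k + 1) (fun n => y k n a)
          - (S.T k (fun n => y k n b) - S.T (k + 1) fun n => y k n b)
          = S.T k (fun n => y k n a - y k n b) - S.T (k + 1) fun n => y k n a - y k n b := by
        rw [QCSystem.T_sub (hM a k) (hM b k), QCSystem.T_sub (hM a k) (hM b k)]; abel
      rw [e]
      refine (norm_sub_le_of_le (QCSystem.norm_T_le hab (hK k hk))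
        (QCSystem.norm_T_le hab fun n hn => hK k hk n (by omega))).trans (le_of_eq (by ring))
    · have h3 : Tendsto (fun k => y k k (x i) - y k (k + 1) (x i)) atTop (𝓝 0) := by
        refine (h.slow (x i)).comp (f := fun k : ℕ => ((k, k) : ℕ × ℕ)) ?_
        refine tendsto_inf.2 ⟨tendsto_comap_iff.2 tendsto_id, tendsto_principal.2
          (Eventually.of_forall fun k => le_refl k)⟩
      have h4 := h3.norm.add (tendsto_half_pow.const_mul (3 * M (x i) + 5))
      rw [norm_zero, mul_zero, add_zero] at h4
      refine squeeze_zero_norm' ?_ h4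
      filter_upwards [eventually_ge_atTop i] with k hk
      exact QCSystem.norm_T_sub_T_succ_le (hM (x i) k) (hq i k hk)
  have h3 := h1.sub h2
  rw [sub_zero] at h3
  refine h3.congr fun k => ?_
  rw [QCSystem.T_sub (hM a (k + 1)) (hM a k)]
  abel

/-- Quasi-central systems adapted to finitely many doubly indexed families of sequences. -/
theorem exists_qcSystem_families [TopologicalSpace.SeparableSpace D] {ι κ : Type*} [Fintype ι]
    [Fintype κ] (Y : ι → ℕ → ℕ → ℕ → 𝓜(ℂ, D)) (β : κ → ℕ → ℕ → ℕ → D) :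
    ∃ S : QCSystem D, (∀ j i k l, i ≤ l → k ≤ l → S.QuasiCommutes l (Y j i k)) ∧
      ∀ j i k n, i ≤ n → k ≤ n → ‖S.c n * toM (β j i k (n + 1))‖ ≤ (1 / 2) ^ n := by
  classical
  obtain ⟨S, h1, h2⟩ := exists_qcSystem
    (fun n => (Finset.univ ×ˢ Finset.range (n + 1) ×ˢ Finset.range (n + 1) ×ˢ
      Finset.range (n + 2)).image fun p : ι × ℕ × ℕ × ℕ => Y p.1 p.2.1 p.2.2.1 p.2.2.2)
    (fun n => (Finset.univ ×ˢ Finset.range (n + 1) ×ˢ Finset.range (n + 1)).image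
      fun p : κ × ℕ × ℕ => β p.1 p.2.1 p.2.2 (n + 1))
  refine ⟨S, fun j i k l hi hk n hn m hm => h1 n _ (Finset.mem_image.2 ⟨(j, i, k, m), ?_, rfl⟩),
    fun j i k n hi hk => h2 n _ (Finset.mem_image.2 ⟨(j, i, k), ?_, rfl⟩)⟩
  · simp only [Finset.mem_product, Finset.mem_univ, Finset.mem_range, true_and]
    omega
  · simp only [Finset.mem_product, Finset.mem_univ, Finset.mem_range, true_and]
    omega

end Families

/-! ### Multipliers along a curve of times, and cut-off times -/

section Diagonal

variable {B : Type*} [NonUnitalCStarAlgebra B]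

theorem continuous_fst_apply {D : Type*} [NonUnitalCStarAlgebra D] (b : D) :
    Continuous fun m : 𝓜(ℂ, D) => m.fst b := by
  refine (LipschitzWith.of_dist_le_mul (K := ‖b‖₊) fun m n => ?_).continuous
  rw [dist_eq_norm, dist_eq_norm, coe_nnnorm, mul_comm]
  exact norm_fst_le (m - n) b

theorem continuous_snd_apply {D : Type*} [NonUnitalCStarAlgebra D] (b : D) :
    Continuous fun m : 𝓜(ℂ, D) => m.snd b := by
  refine (LipschitzWith.of_dist_le_mul (K := ‖b‖₊) fun m n => ?_).continuous
  rw [dist_eq_norm, dist_eq_norm, coe_nnnorm, mul_comm]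
  exact norm_snd_le (m - n) b

/-- The multiplier of `C([0,1], B)` whose value at `s` is the value at `s` of `G (τ s)`. -/
noncomputable def diag (G : C(Set.Ici (1 : ℝ), 𝓜(ℂ, C(I, B)))) (τ : C(I, Set.Ici (1 : ℝ))) :
    𝓜(ℂ, C(I, B)) :=
  ofFamily (fun s => evM s (G (τ s))) ‖G.comp τ‖
    (fun s => (norm_evM_le s _).trans ((G.comp τ).norm_coe_le_norm s))
    (fun b => by
      have h : Continuous fun s => (G (τ s)).fst (ContinuousMap.const I b) :=
        (continuous_fst_apply _).comp (G.continuous.comp τ.continuous)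
      exact h.eval continuous_id)
    fun b => by
      have h : Continuous fun s => (G (τ s)).snd (ContinuousMap.const I b) :=
        (continuous_snd_apply _).comp (G.continuous.comp τ.continuous)
      exact h.eval continuous_id

theorem evM_diag (G : C(Set.Ici (1 : ℝ), 𝓜(ℂ, C(I, B)))) (τ : C(I, Set.Ici (1 : ℝ))) (s : I) :
    evM s (diag G τ) = evM s (G (τ s)) :=
  evM_ofFamily (fun s => evM s (G (τ s))) _ _ _ _ s

theorem evM_mem (s : I) {m : 𝓜(ℂ, C(I, B))} (h : m ∈ inM C(I, B)) : evM s m ∈ inM B := by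
  obtain ⟨f, rfl⟩ := h
  exact ⟨f s, rfl⟩

theorem diag_mem (G : C(Set.Ici (1 : ℝ), 𝓜(ℂ, C(I, B)))) (hG : ∀ t, G t ∈ inM C(I, B))
    (τ : C(I, Set.Ici (1 : ℝ))) : diag G τ ∈ inM C(I, B) := by
  choose f hf using hG
  have hfc : Continuous f := by
    refine (Isometry.isEmbedding (isometry_toM (D := C(I, B)))).isInducing.continuous_iff.2 ?_
    convert G.continuous using 1
    exact funext hf
  refine ⟨⟨fun s => f (τ s) s, (hfc.comp τ.continuous).eval continuous_id⟩, evM_ext fun s => ?_⟩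
  rw [evM_diag, ← hf]
  rfl

theorem evM_T_eq_zero {S : QCSystem C(I, B)} {z : ℕ → 𝓜(ℂ, C(I, B))} {M : ℝ}
    (hz : ∀ n, ‖z n‖ ≤ M) {k : ℕ} {s : I} (h : ∀ n ≥ k, evM s (z n) = 0) :
    evM s (S.T k z) = 0 := by
  have h1 : ∀ N, evM s (S.partialT z k N) = 0 := fun N => by
    induction N generalizing k with
    | zero => rw [QCSystem.partialT_zero, map_zero]
    | succ N ih =>
      rw [QCSystem.partialT_succ, map_add, map_mul, map_mul, map_mul, map_mul, h k le_rfl,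
        ih fun n hn => h n (by omega)]
      simp
  refine ext_fst fun b => ?_
  have h2 := QCSystem.tendsto_T (S := S) hz k (ContinuousMap.const I b)
  have h3 := ((ContinuousEvalConst.continuous_eval_const s).tendsto _).comp h2
  refine tendsto_nhds_unique h3 (tendsto_const_nhds.congr fun N => ?_)
  exact (congrArg (fun m : 𝓜(ℂ, B) => m.fst b) (h1 N)).symm

theorem evM_T_congr {S : QCSystem C(I, B)} {y z : ℕ → 𝓜(ℂ, C(I, B))} {M M' : ℝ}
    (hy : ∀ n, ‖y n‖ ≤ M) (hz : ∀ n, ‖z n‖ ≤ M') {k : ℕ} {s : I}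
    (h : ∀ n ≥ k, evM s (y n) = evM s (z n)) : evM s (S.T k y) = evM s (S.T k z) := by
  rw [← sub_eq_zero, ← map_sub, ← QCSystem.T_sub hy hz]
  exact evM_T_eq_zero (fun n => norm_sub_le_of_le (hy n) (hz n)) fun n hn => by
    rw [map_sub, h n hn, sub_self]

end Diagonal

namespace Grid

variable (g : Grid) (γ : C(I, I))

theorem pt_pos (k : ℕ) : 0 < (g.pt k : ℝ) := zero_lt_one.trans_le (g.pt k).2

theorem inv_pt_anti {k n : ℕ} (h : k ≤ n) : (g.pt n : ℝ)⁻¹ ≤ (g.pt k : ℝ)⁻¹ :=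
  inv_anti₀ (g.pt_pos k) (g.strictMono.monotone h)

theorem inv_pt_le_one (k : ℕ) : (g.pt k : ℝ)⁻¹ ≤ 1 := inv_le_one_of_one_le₀ (g.pt k).2

/-- The time `min (pt n) (max (pt k) (1 / γ))`, as a function on `[0,1]` with values in `[1,∞)`: it
is `pt k` where `γ = 1` and `pt n` where `γ = 0`. -/
noncomputable def cutoff (k n : ℕ) : C(I, Set.Ici (1 : ℝ)) where
  toFun s := ⟨(max (g.pt n : ℝ)⁻¹ (min (g.pt k : ℝ)⁻¹ (γ s)))⁻¹,
    one_le_inv₀ (lt_max_of_lt_left (inv_pos.2 (g.pt_pos n))) |>.2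
      (max_le (g.inv_pt_le_one n) ((min_le_left _ _).trans (g.inv_pt_le_one k)))⟩
  continuous_toFun := by
    refine Continuous.subtype_mk (Continuous.inv₀ ?_ fun s =>
      (lt_max_of_lt_left (inv_pos.2 (g.pt_pos n))).ne') _
    exact continuous_const.max (continuous_const.min
      (continuous_subtype_val.comp γ.continuous))

variable {γ}

theorem coe_cutoff (k n : ℕ) (s : I) : (g.cutoff γ k n s : ℝ)
    = (max (g.pt n : ℝ)⁻¹ (min (g.pt k : ℝ)⁻¹ (γ s)))⁻¹ := rfl

theorem cutoff_le (k n : ℕ) (s : I) : g.cutoff γ k n s ≤ g.pt n := by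
  change (g.cutoff γ k n s : ℝ) ≤ g.pt n
  rw [coe_cutoff]
  exact inv_le_of_inv_le₀ (g.pt_pos n) (le_max_left _ _)

theorem le_cutoff {j k n : ℕ} (hk : j ≤ k) (hn : j ≤ n) (s : I) : g.pt j ≤ g.cutoff γ k n s := by
  change (g.pt j : ℝ) ≤ g.cutoff γ k n s
  rw [coe_cutoff]
  refine le_inv_of_le_inv₀ (lt_max_of_lt_left (inv_pos.2 (g.pt_pos n))) ?_
  exact max_le (g.inv_pt_anti hn) ((min_le_left _ _).trans (g.inv_pt_anti hk))

/-- Beyond `N`, the cut-off time is either independent of `n` or at least `pt N`. -/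
theorem cutoff_eq_or_le {k N n : ℕ} (hn : N ≤ n) (s : I) :
    g.cutoff γ k n s = g.cutoff γ k N s ∨ (g.pt N ≤ g.cutoff γ k n s ∧ g.cutoff γ k N s = g.pt N) := by
  rcases le_total (g.pt N : ℝ)⁻¹ (min (g.pt k : ℝ)⁻¹ (γ s)) with h | h
  · left
    apply Subtype.ext
    rw [coe_cutoff, coe_cutoff, max_eq_right h, max_eq_right ((g.inv_pt_anti hn).trans h)]
  · right
    constructor
    · change (g.pt N : ℝ) ≤ g.cutoff γ k n s
      rw [coe_cutoff]
      exact le_inv_of_le_inv₀ (lt_max_of_lt_left (inv_pos.2 (g.pt_pos n)))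
        (max_le (g.inv_pt_anti hn) h)
    · apply Subtype.ext
      rw [coe_cutoff, max_eq_left h, inv_inv]

/-- Passing from `k` to `k + 1` changes the cut-off time only within `[pt k, pt (k + 1)]`, and by an
amount independent of `n > k`. -/
theorem cutoff_succ (k : ℕ) (s : I) :
    (∀ n, g.cutoff γ (k + 1) n s = g.cutoff γ k n s) ∨ ∀ n ≥ k + 1,
      g.cutoff γ (k + 1) n s = g.pt (k + 1) ∧ g.cutoff γ k n s = g.cutoff γ k (k + 1) s := by
  rcases le_total (γ s : ℝ) (g.pt (k + 1) : ℝ)⁻¹ with h | h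
  · refine Or.inl fun n => Subtype.ext ?_
    rw [coe_cutoff, coe_cutoff, min_eq_right h,
      min_eq_right (h.trans (g.inv_pt_anti (Nat.le_succ k)))]
  · refine Or.inr fun n hn => ⟨Subtype.ext ?_, Subtype.ext ?_⟩
    · rw [coe_cutoff, min_eq_left h, max_eq_right (g.inv_pt_anti hn), inv_inv]
    · have h' := le_min (g.inv_pt_anti (Nat.le_succ k)) h
      rw [coe_cutoff, coe_cutoff, max_eq_right h', max_eq_right ((g.inv_pt_anti hn).trans h')]

theorem cutoff_self (k l : ℕ) (h : k ≤ l) (s : I) : g.cutoff γ l k s = g.pt k := by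
  refine le_antisymm (g.cutoff_le l k s) (g.le_cutoff h le_rfl s)

theorem cutoff_of_eq_one {k n : ℕ} (hn : k ≤ n) {s : I} (hs : γ s = 1) :
    g.cutoff γ k n s = g.pt k := by
  apply Subtype.ext
  rw [coe_cutoff, hs, Set.Icc.coe_one, min_eq_left (g.inv_pt_le_one k),
    max_eq_right (g.inv_pt_anti hn), inv_inv]

theorem cutoff_of_eq_zero (k n : ℕ) {s : I} (hs : γ s = 0) : g.cutoff γ k n s = g.pt n := by
  apply Subtype.ext
  rw [coe_cutoff, hs, Set.Icc.coe_zero, min_eq_right (inv_nonneg.2 (g.pt_pos k).le),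
    max_eq_left (inv_nonneg.2 (g.pt_pos n).le), inv_inv]

theorem interp_start {E : Type*} [AddCommGroup E] [Module ℂ E] (ψ : ℕ → E) :
    g.interp ψ start = ψ 0 := by
  have h1 : g.pt 0 ≤ start := g.pt_zero.le
  have h2 : start ≤ g.pt (0 + 1) := g.pt_zero ▸ (g.strictMono (Nat.lt_succ_self 0)).le
  rw [g.interp_eq ψ h1 h2, g.pt_zero, sub_self, zero_div, Complex.ofReal_zero, zero_smul, add_zero]

theorem interp_mem {E : Type*} [AddCommGroup E] [Module ℂ E] (P : AddSubgroup E)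
    (hP : ∀ (c : ℂ) x, x ∈ P → c • x ∈ P) {ψ : ℕ → E} (h : ∀ k, ψ k ∈ P) (t : Set.Ici (1 : ℝ)) :
    g.interp ψ t ∈ P :=
  add_mem (h _) (hP _ _ (sub_mem (h _) (h _)))

theorem interp_sub_mem {E : Type*} [AddCommGroup E] [Module ℂ E] (P : AddSubgroup E)
    (hP : ∀ (c : ℂ) x, x ∈ P → c • x ∈ P) {ψ : ℕ → E} (h : ∀ k, ψ (k + 1) - ψ k ∈ P)
    (t : Set.Ici (1 : ℝ)) : g.interp ψ t - g.interp ψ start ∈ P := by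
  have h1 : ∀ k, ψ k - ψ 0 ∈ P := fun k => by
    induction k with
    | zero => rw [sub_self]; exact zero_mem _
    | succ k ih =>
      rw [← sub_add_sub_cancel]; exact add_mem (h k) ih
  rw [g.interp_start, interp, add_sub_right_comm]
  exact add_mem (h1 _) (hP _ _ (h _))

theorem norm_interp_sub_le {E : Type*} [SeminormedAddCommGroup E] [NormedSpace ℂ E] (ψ : ℕ → E)
    (t : Set.Ici (1 : ℝ)) :
    ‖g.interp ψ t - ψ (g.index t)‖ ≤ ‖ψ (g.index t + 1) - ψ (g.index t)‖ := by
  rw [interp, add_sub_cancel_left, norm_smul, Complex.norm_real,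
    Real.norm_of_nonneg (g.pos_nonneg t)]
  exact mul_le_of_le_one_left (norm_nonneg _) (g.pos_le_one t)

/-- Interpolation of an asymptotically multiplicative sequence with increments tending to `0`. -/
theorem isAsympMul_interp {A E : Type*} [NonUnitalCStarAlgebra A] [NonUnitalCStarAlgebra E]
    {ψ : ℕ → A → E} (h : IsAsympMul atTop ψ)
    (h' : ∀ a, Tendsto (fun k => ψ (k + 1) a - ψ k a) atTop (𝓝 0)) :
    IsAsympMul atTop fun t a => g.interp (fun k => ψ k a) t :=
  (h.comp g.tendsto_index).perturb fun a =>
    squeeze_zero_norm (fun t => g.norm_interp_sub_le (fun k => ψ k a) t)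
      (by simpa using ((h' a).comp g.tendsto_index).norm)

end Grid

/-! ### Compression of homotopies -/

section CutoffFamily

variable {A B : Type*} [NonUnitalCStarAlgebra A] [NonUnitalCStarAlgebra B]

/-- The oscillation of `φ` on the intervals of the partition tends to `0` pointwise. -/
def SlowOn {E : Type*} [NonUnitalCStarAlgebra E] (g : Grid) (φ : Set.Ici (1 : ℝ) → A → E) : Prop :=
  ∀ a, ∀ ε > 0, ∃ K, ∀ k ≥ K, ∀ t t' : Set.Ici (1 : ℝ),
    g.pt k ≤ t → t ≤ g.pt (k + 1) → g.pt k ≤ t' → t' ≤ g.pt (k + 1) → ‖φ t a - φ t' a‖ ≤ ε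

theorem exists_slowOn [TopologicalSpace.SeparableSpace A] {E : Type*} [CStarAlgebra E]
    {φ : Set.Ici (1 : ℝ) → A → E} (h : IsAsymptoticHom φ) : ∃ g : Grid, SlowOn g φ := by
  obtain ⟨g, hg⟩ := exists_grid (fun i t => φ t (TopologicalSpace.denseSeq A i))
    fun i => h.continuous _
  refine ⟨g, fun a ε hε => ?_⟩
  obtain ⟨_, ⟨i, rfl⟩, hi⟩ := Metric.mem_closure_iff.1
    (TopologicalSpace.denseRange_denseSeq A a) (ε / 15) (by positivity)
  rw [dist_eq_norm] at hi
  obtain ⟨t₀, ht₀⟩ := eventually_atTop.1 (h.eventually_norm_sub_le hi)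
  obtain ⟨K, hK⟩ := hg i (ε / 3) (by positivity)
  obtain ⟨K', hK'⟩ := eventually_atTop.1 (tendsto_atTop.1 g.tendsto t₀)
  refine ⟨max K K', fun k hk t t' h1 h2 h3 h4 => ?_⟩
  have hkt := hK' k (by omega)
  have e1 := ht₀ t (hkt.trans h1)
  have e2 := ht₀ t' (hkt.trans h3)
  have e3 := hK k (by omega) t t' h1 h2 h3 h4
  have e : φ t a - φ t' a = (φ t a - φ t (TopologicalSpace.denseSeq A i))
      + (φ t (TopologicalSpace.denseSeq A i) - φ t' (TopologicalSpace.denseSeq A i))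
      - (φ t' a - φ t' (TopologicalSpace.denseSeq A i)) := by abel
  rw [e]
  exact (norm_sub_le_of_le (norm_add_le_of_le e1 e3) e2).trans (by linarith)

variable (g : Grid) (γ : C(I, I))

variable {g γ} in
theorem eventually_cutoff {P : Set.Ici (1 : ℝ) → Prop} (h : ∀ᶠ t in atTop, P t) :
    ∀ᶠ p in tailFilter, ∀ s, P (g.cutoff γ p.1 p.2 s) := by
  obtain ⟨t₀, ht₀⟩ := eventually_atTop.1 h
  obtain ⟨K, hK⟩ := eventually_atTop.1 (tendsto_atTop.1 g.tendsto t₀)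
  exact eventually_tailFilter.2 ⟨K, fun k hk n hn s =>
    ht₀ _ ((hK k hk).trans (g.le_cutoff le_rfl hn s))⟩

variable {g γ} in
theorem tendsto_tailFilter_zero {Z : ℕ → ℕ → 𝓜(ℂ, C(I, B))}
    {H : Set.Ici (1 : ℝ) → 𝓜(ℂ, C(I, B))} (hH : Tendsto H atTop (𝓝 0))
    (h : ∀ k n s, evM s (Z k n) = evM s (H (g.cutoff γ k n s))) :
    Tendsto (fun p : ℕ × ℕ => Z p.1 p.2) tailFilter (𝓝 0) := by
  rw [NormedAddGroup.tendsto_nhds_zero]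
  intro ε hε
  filter_upwards [eventually_cutoff (g := g) (γ := γ) (eventually_norm_le hH (half_pos hε))]
    with p hp
  refine (norm_le_of_evM (half_pos hε).le fun s => ?_).trans_lt (half_lt_self hε)
  rw [h]
  exact (norm_evM_le _ _).trans (hp s)

/-- The path `t ↦ φ t a`, as a bundled continuous function. -/
def pathOf {E : Type*} [NonUnitalCStarAlgebra E] {φ : Set.Ici (1 : ℝ) → A → E}
    (h : IsAsymptoticHom φ) (a : A) : C(Set.Ici (1 : ℝ), E) := ⟨fun t => φ t a, h.continuous a⟩

variable {φ : Set.Ici (1 : ℝ) → A → 𝓜(ℂ, C(I, B))} (h : IsAsymptoticHom φ)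

/-- The family of maps `A → M(C([0,1], B))` that at `s` are `φ`, at the time `g.cutoff γ k n s`. -/
noncomputable def cutoffFamily (k n : ℕ) (a : A) : 𝓜(ℂ, C(I, B)) :=
  diag (pathOf h a) (g.cutoff γ k n)

theorem evM_cutoffFamily (k n : ℕ) (a : A) (s : I) :
    evM s (cutoffFamily g γ h k n a) = evM s (φ (g.cutoff γ k n s) a) := by
  rw [cutoffFamily, evM_diag, pathOf, ContinuousMap.coe_mk]

variable {g γ} in
theorem isAsympFamily_cutoffFamily (hg : SlowOn g φ) : IsAsympFamily (cutoffFamily g γ h) where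
  bdd a := by
    obtain ⟨M, hM⟩ := h.exists_bound a
    refine ⟨M, fun k n => norm_le_of_evM ((norm_nonneg _).trans (hM start)) fun s => ?_⟩
    rw [evM_cutoffFamily]
    exact (norm_evM_le _ _).trans (hM _)
  asympMul :=
    { bdd := fun a => by
        obtain ⟨M, hM⟩ := h.exists_bound a
        refine ⟨M, Eventually.of_forall fun p =>
          norm_le_of_evM ((norm_nonneg _).trans (hM start)) fun s => ?_⟩
        rw [evM_cutoffFamily]
        exact (norm_evM_le _ _).trans (hM _)
      add := fun a b => tendsto_tailFilter_zero (g := g) (γ := γ)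
        (Z := fun k n => cutoffFamily g γ h k n (a + b)
          - (cutoffFamily g γ h k n a + cutoffFamily g γ h k n b)) (h.add a b) fun k n s => by
        simp only [map_sub, map_add, evM_cutoffFamily]
      smul := fun c a => tendsto_tailFilter_zero (g := g) (γ := γ)
        (Z := fun k n => cutoffFamily g γ h k n (c • a) - c • cutoffFamily g γ h k n a)
        (h.smul c a) fun k n s => by
        simp only [map_sub, map_smul, evM_cutoffFamily]
      mul := fun a b => tendsto_tailFilter_zero (g := g) (γ := γ)
        (Z := fun k n => cutoffFamily g γ h k n (a * b)
          - cutoffFamily g γ h k n a * cutoffFamily g γ h k n b) (h.mul a b) fun k n s => by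
        simp only [map_sub, map_mul, evM_cutoffFamily]
      star := fun a => tendsto_tailFilter_zero (g := g) (γ := γ)
        (Z := fun k n => cutoffFamily g γ h k n (star a) - star (cutoffFamily g γ h k n a))
        (h.star a) fun k n s => by
        simp only [map_sub, map_star, evM_cutoffFamily] }
  lipschitz a b δ hab := by
    have hδ : 0 < δ := (norm_nonneg _).trans_lt hab
    filter_upwards [eventually_cutoff (g := g) (γ := γ) (h.eventually_norm_sub_le hab)] with p hp
    refine norm_le_of_evM (by positivity) fun s => ?_
    rw [map_sub, evM_cutoffFamily, evM_cutoffFamily, ← map_sub]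
    exact (norm_evM_le _ _).trans (hp s)
  slow a := by
    rw [NormedAddGroup.tendsto_nhds_zero]
    intro ε hε
    obtain ⟨K, hK⟩ := hg a (ε / 2) (half_pos hε)
    refine eventually_tailFilter.2 ⟨K, fun k hk n hn => ?_⟩
    refine (norm_le_of_evM (half_pos hε).le fun s => ?_).trans_lt (half_lt_self hε)
    simp only [map_sub, evM_cutoffFamily]
    rcases g.cutoff_eq_or_le (γ := γ) (k := k) (Nat.le_succ n) s with h1 | ⟨h1, h2⟩
    · rw [h1, sub_self, norm_zero]; exact (half_pos hε).le
    · rw [← map_sub]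
      refine (norm_evM_le _ _).trans (hK n (by omega) _ _ ?_ ?_ h1 (g.cutoff_le _ _ _))
      · rw [h2]
      · rw [h2]; exact g.strictMono.monotone (Nat.le_succ n)
  slow' a := by
    rw [NormedAddGroup.tendsto_nhds_zero]
    intro ε hε
    obtain ⟨K, hK⟩ := hg a (ε / 2) (half_pos hε)
    refine eventually_tailFilter.2 ⟨K, fun k hk n hn => ?_⟩
    refine (norm_le_of_evM (half_pos hε).le fun s => ?_).trans_lt (half_lt_self hε)
    simp only [map_sub, evM_cutoffFamily]
    rcases hn.lt_or_eq with hn' | rfl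
    · rcases g.cutoff_succ (γ := γ) k s with h1 | h1
      · rw [h1, sub_self, norm_zero]; exact (half_pos hε).le
      · rw [(h1 n hn').1, (h1 n hn').2, ← map_sub]
        exact (norm_evM_le _ _).trans (hK k hk _ _ (g.strictMono.monotone (Nat.le_succ k)) le_rfl
          (g.le_cutoff le_rfl (Nat.le_succ k) s) (g.cutoff_le _ _ _))
    · rw [g.cutoff_self k (k + 1) (Nat.le_succ k), g.cutoff_self k k le_rfl, sub_self, norm_zero]
      exact (half_pos hε).le

end CutoffFamily

section Compressions

variable {A B : Type*} [NonUnitalCStarAlgebra A] [NonUnitalCStarAlgebra B]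

/-- If a dense sequence of `D` almost commutes with the system, the compressions of constant
sequences in `D` are in `D`. -/
theorem T_const_mem {D : Type*} [NonUnitalCStarAlgebra D] {S : QCSystem D} {b : ℕ → D}
    (hb : DenseRange b) (hT : ∀ i k, S.T k (fun _ => toM (b i)) ∈ inM D) {q : 𝓜(ℂ, D)}
    (hq : q ∈ inM D) (k : ℕ) : S.T k (fun _ => q) ∈ inM D := by
  obtain ⟨q, rfl⟩ := hq
  refine QCSystem.T_mem_of_approx (M := ‖toM q‖) (fun _ => le_rfl) (fun ε hε => ?_) k
  obtain ⟨_, ⟨i, rfl⟩, hi⟩ := Metric.mem_closure_iff.1 (hb q) ε hε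
  refine ⟨fun _ => toM (b i), ‖toM (b i)‖, 0, fun _ => le_rfl, hT i, fun n _ => ?_⟩
  rw [dist_eq_norm, ← norm_toM, map_sub] at hi
  exact hi.le

/-- A quasi-central system that almost commutes with the family `cutoffFamily g γ` of a homotopy `Φ`
and with `Φ` itself, on a dense sequence `a`, and whose compressions preserve `C([0,1], B)`. -/
structure IsAdapted {J : NonUnitalStarSubalgebra ℂ A} (Φ : ExtHom J C(I, B)) (g : Grid)
    (γ : C(I, I)) (a : ℕ → A) (S : QCSystem C(I, B)) : Prop where
  slowOn : SlowOn g Φ.toFun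
  denseRange : DenseRange a
  commutes : ∀ i k, i ≤ k →
    S.QuasiCommutes k fun n => cutoffFamily g γ Φ.isAsymptoticHom k n (a i)
  commutes_const : ∀ i k, i ≤ k → S.QuasiCommutes k fun _ => Φ.toFun (g.pt k) (a i)
  const_mem : ∀ q ∈ inM C(I, B), ∀ k, S.T k (fun _ => q) ∈ inM C(I, B)
  mem : ∀ k, ∀ z ∈ J,
    S.T k (fun n => cutoffFamily g γ Φ.isAsymptoticHom k n z) ∈ inM C(I, B)

/-- Compressions of an extended homotopy map `J` into `C([0,1], B)` if they do so for a dense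
sequence in `J` and for constant sequences in `C([0,1], B)`: beyond a late time `g.pt N`, the tail of
the family at `z` is close to that at `x j`, up to a term in `C([0,1], B)` independent of `n`. -/
theorem T_cutoffFamily_mem {J : NonUnitalStarSubalgebra ℂ A} (Φ : ExtHom J C(I, B)) {g : Grid}
    (hg : SlowOn g Φ.toFun) {γ : C(I, I)} {S : QCSystem C(I, B)} {x : ℕ → J} (hx : DenseRange x)
    (hq : ∀ q ∈ inM C(I, B), ∀ k, S.T k (fun _ => q) ∈ inM C(I, B))
    (hTx : ∀ j k l, S.T l (fun n => cutoffFamily g γ Φ.isAsymptoticHom k n (x j)) ∈ inM C(I, B))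
    (k : ℕ) {z : A} (hz : z ∈ J) :
    S.T k (fun n => cutoffFamily g γ Φ.isAsymptoticHom k n z) ∈ inM C(I, B) := by
  have hΦ := Φ.isAsymptoticHom
  set y := cutoffFamily g γ hΦ with hy
  have hyJ : ∀ k n, ∀ x ∈ J, y k n x ∈ inM C(I, B) := fun k n x hx =>
    diag_mem _ (fun t => Φ.extended t x hx) _
  choose M hM using (isAsympFamily_cutoffFamily (γ := γ) hΦ hg).bdd
  refine QCSystem.T_mem_of_approx (hM z k) (fun ε hε => ?_) k
  obtain ⟨_, ⟨j, rfl⟩, hj⟩ := Metric.mem_closure_iff.1 (hx ⟨z, hz⟩) (ε / 10) (by positivity)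
  have hj' : ‖z - x j‖ < ε / 10 := by rw [← dist_eq_norm]; exact hj
  obtain ⟨t₀, ht₀⟩ := eventually_atTop.1 (hΦ.eventually_norm_sub_le hj')
  obtain ⟨N, hN⟩ := (tendsto_atTop.1 g.tendsto t₀).exists
  have hq' : y k N z - y k N (x j) ∈ inM C(I, B) := sub_mem (hyJ _ _ _ hz) (hyJ _ _ _ (x j).2)
  refine ⟨fun n => y k n (x j) + (y k N z - y k N (x j)),
    M (x j) + ‖y k N z - y k N (x j)‖, N,
    fun n => norm_add_le_of_le (hM _ k n) le_rfl, fun l => ?_, fun n hn => ?_⟩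
  · rw [QCSystem.T_add (hM (x j) k) (fun _ => le_rfl)]
    exact add_mem (hTx j k l) (hq _ hq' l)
  · refine norm_le_of_evM hε.le fun s => ?_
    have hlate : ∀ t, g.pt N ≤ t →
        ‖evM s (Φ.toFun t z) - evM s (Φ.toFun t (x j))‖ ≤ 5 * (ε / 10) := fun t ht => by
      rw [← map_sub]
      exact (norm_evM_le _ _).trans (ht₀ t (hN.trans ht))
    simp only [map_sub, map_add, hy, evM_cutoffFamily]
    rcases g.cutoff_eq_or_le (γ := γ) (k := k) hn s with h1 | ⟨h1, h2⟩
    · rw [h1, add_sub_cancel, sub_self, norm_zero]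
      exact hε.le
    · rw [← sub_sub]
      refine (norm_sub_le_of_le (hlate _ h1) (hlate _ h2.ge)).trans ?_
      linarith

/-- Adapted systems exist: besides the sequence `a`, the system is made to almost commute with, and
to almost absorb, dense sequences of `J` and of `C([0,1], B)`. -/
theorem exists_isAdapted [TopologicalSpace.SeparableSpace A] [TopologicalSpace.SeparableSpace B]
    {J : NonUnitalStarSubalgebra ℂ A} (Φ : ExtHom J C(I, B)) (γ : C(I, I)) :
    ∃ g a S, IsAdapted Φ g γ a S := by
  have hΦ := Φ.isAsymptoticHom
  obtain ⟨g, hg⟩ := exists_slowOn hΦ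
  obtain ⟨y, hyd⟩ : ∃ y, y = cutoffFamily g γ hΦ := ⟨_, rfl⟩
  have hy : IsAsympFamily y := hyd ▸ isAsympFamily_cutoffFamily hΦ hg
  have : SecondCountableTopology B := UniformSpace.secondCountable_of_separable B
  have : SecondCountableTopology A := UniformSpace.secondCountable_of_separable A
  have ha := TopologicalSpace.denseRange_denseSeq A
  have hx := TopologicalSpace.denseRange_denseSeq J
  have hb := TopologicalSpace.denseRange_denseSeq C(I, B)
  generalize TopologicalSpace.denseSeq A = a at ha
  generalize TopologicalSpace.denseSeq J = x at hx
  generalize TopologicalSpace.denseSeq C(I, B) = b at hb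
  have hxJ : ∀ j k n, ∃ c : C(I, B), toM c = y k n (x j) := fun j k n => by
    have : cutoffFamily g γ hΦ k n (x j) ∈ inM C(I, B) :=
      diag_mem _ (fun t => Φ.extended t _ (x j).2) _
    rwa [← hyd] at this
  choose c hc using hxJ
  obtain ⟨S, hS, hS'⟩ := exists_qcSystem_families
    ![fun i k n => y k n (a i), fun i k n => y k n (x i), fun i _ _ => toM (b i),
      fun i k _ => Φ.toFun (g.pt k) (a i)]
    ![c, fun i _ _ => b i]
  have hya : ∀ i k, i ≤ k → S.QuasiCommutes k fun n => y k n (a i) :=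
    fun i k hi => hS 0 i k k hi le_rfl
  have hyx : ∀ i k l, i ≤ l → k ≤ l → S.QuasiCommutes l fun n => y k n (x i) := hS 1
  have hyb : ∀ i k, i ≤ k → S.QuasiCommutes k fun _ => toM (b i) :=
    fun i k hi => hS 2 i k k hi le_rfl
  have hyc : ∀ i k, i ≤ k → S.QuasiCommutes k fun _ => Φ.toFun (g.pt k) (a i) :=
    fun i k hi => hS 3 i k k hi le_rfl
  have hcx : ∀ i k n, i ≤ n → k ≤ n → ‖S.c n * toM (c i k (n + 1))‖ ≤ (1 / 2) ^ n := hS' 0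
  have hcb : ∀ i n, i ≤ n → ‖S.c n * toM (b i)‖ ≤ (1 / 2) ^ n :=
    fun i n hi => hS' 1 i 0 n hi (Nat.zero_le n)
  clear hS hS'
  have hTb : ∀ i k, S.T k (fun _ => toM (b i)) ∈ inM C(I, B) := fun i k =>
    QCSystem.T_mem_of_absorbed (M := ‖toM (b i)‖) (fun _ => le_rfl) (N := i) (C := 1)
      (fun n hn => (hcb i n hn).trans_eq (one_mul _).symm)
      (fun n hn => (hyb i n hn n le_rfl n (Or.inl rfl)).2.trans_eq (one_mul _).symm) k
  have hTc : ∀ q ∈ inM C(I, B), ∀ k, S.T k (fun _ => q) ∈ inM C(I, B) := fun q hq k =>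
    T_const_mem hb hTb hq k
  choose M hM using hy.bdd
  have hTx : ∀ j k l, S.T l (fun n => y k n (x j)) ∈ inM C(I, B) := fun j k l =>
    QCSystem.T_mem_of_absorbed (hM (x j) k) (N := max j k) (C := 1)
      (fun n hn => by
        rw [one_mul, ← hc]
        exact hcx j k n ((le_max_left _ _).trans hn) ((le_max_right _ _).trans hn))
      (fun n hn => (hyx j k n ((le_max_left _ _).trans hn) ((le_max_right _ _).trans hn) n le_rfl n
        (Or.inl rfl)).2.trans_eq (one_mul _).symm) l
  subst hyd
  exact ⟨g, a, S, hg, ha, hya, hyc, hTc, fun k z hz => T_cutoffFamily_mem Φ hg hx hTc hTx k hz⟩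

namespace IsAdapted

variable {J : NonUnitalStarSubalgebra ℂ A} {Φ : ExtHom J C(I, B)} {g : Grid} {γ : C(I, I)}
  {a : ℕ → A} {S : QCSystem C(I, B)}

/-- The compressions of `cutoffFamily g γ`. -/
noncomputable def seq (Φ : ExtHom J C(I, B)) (g : Grid) (γ : C(I, I)) (S : QCSystem C(I, B))
    (k : ℕ) (z : A) : 𝓜(ℂ, C(I, B)) :=
  S.T k fun n => cutoffFamily g γ Φ.isAsymptoticHom k n z

theorem isAsympFamily (h : IsAdapted Φ g γ a S) :
    IsAsympFamily (cutoffFamily g γ Φ.isAsymptoticHom) :=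
  isAsympFamily_cutoffFamily _ h.slowOn

theorem isAsympMul_seq (h : IsAdapted Φ g γ a S) : IsAsympMul atTop (seq Φ g γ S) :=
  h.isAsympFamily.isAsympMul_T h.denseRange h.commutes

theorem tendsto_seq_succ_sub (h : IsAdapted Φ g γ a S) (z : A) :
    Tendsto (fun k => seq Φ g γ S (k + 1) z - seq Φ g γ S k z) atTop (𝓝 0) :=
  h.isAsympFamily.tendsto_T_succ_sub h.denseRange h.commutes z

/-- The compression of a homotopy: the piecewise linear interpolation of `seq`. -/
noncomputable def compression (h : IsAdapted Φ g γ a S) : ExtHom J C(I, B) where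
  toFun t z := g.interp (fun k => seq Φ g γ S k z) t
  isAsymptoticHom := (g.isAsympMul_interp h.isAsympMul_seq h.tendsto_seq_succ_sub).isAsymptoticHom
    fun _ => g.continuous_interp _
  extended t z hz := g.interp_mem _ (fun c _ => inM_smul c) (fun k => h.mem k z hz) t

theorem evM_compression (h : IsAdapted Φ g γ a S) (s : I) (t : Set.Ici (1 : ℝ)) (z : A) :
    evM s (h.compression.toFun t z) = g.interp (fun k => evM s (seq Φ g γ S k z)) t := by
  simp only [compression, Grid.interp, map_add, map_smul, map_sub]

/-- Modulo `C([0,1], B)`, the increments of `seq` are compressions of increments of the family. -/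
theorem seq_succ_sub_mem (h : IsAdapted Φ g γ a S) (k : ℕ) (z : A) :
    seq Φ g γ S (k + 1) z - seq Φ g γ S k z
      - S.T (k + 1) (fun n => cutoffFamily g γ Φ.isAsymptoticHom (k + 1) n z
        - cutoffFamily g γ Φ.isAsymptoticHom k n z) ∈ inM C(I, B) := by
  obtain ⟨M, hM⟩ := h.isAsympFamily.bdd z
  have := QCSystem.T_sub_T_succ_mem (S := S) (hM k) k
  rw [QCSystem.T_sub (hM (k + 1)) (hM k)]
  convert neg_mem this using 1
  simp only [seq]
  abel

/-- Compressions of constant sequences are asymptotically the identity. -/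
theorem tendsto_T_const_sub (h : IsAdapted Φ g γ a S) (z : A) :
    Tendsto (fun k => S.T k (fun _ => Φ.toFun (g.pt k) z) - Φ.toFun (g.pt k) z) atTop (𝓝 0) := by
  refine tendsto_zero_of_dense h.denseRange
    (fun k z => S.T k (fun _ => Φ.toFun (g.pt k) z) - Φ.toFun (g.pt k) z) (C := 10)
    (fun z w δ hδ => ?_) (fun i => ?_) z
  · filter_upwards [g.tendsto.eventually (Φ.isAsymptoticHom.eventually_norm_sub_le hδ)] with k hk
    have e : S.T k (fun _ => Φ.toFun (g.pt k) z) - Φ.toFun (g.pt k) z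
        - (S.T k (fun _ => Φ.toFun (g.pt k) w) - Φ.toFun (g.pt k) w)
        = S.T k (fun _ => Φ.toFun (g.pt k) z - Φ.toFun (g.pt k) w)
          - (Φ.toFun (g.pt k) z - Φ.toFun (g.pt k) w) := by
      rw [QCSystem.T_sub (M := ‖Φ.toFun (g.pt k) z‖) (M' := ‖Φ.toFun (g.pt k) w‖)
        (fun _ => le_rfl) (fun _ => le_rfl)]
      abel
    rw [e]
    exact (norm_sub_le_of_le (QCSystem.norm_T_le (fun _ => le_rfl) fun _ _ => hk) hk).trans
      (le_of_eq (by ring))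
  · refine squeeze_zero_norm' (a := fun k => 4 * (1 / 2) ^ k) ?_
      ((tendsto_half_pow.const_mul 4).trans (by rw [mul_zero]))
    filter_upwards [eventually_ge_atTop i] with k hk
    exact QCSystem.norm_T_const_sub_le (h.commutes_const i k hk)

/-- Where `γ = 1`, the compression is asymptotic to the given homotopy. -/
theorem tendsto_evM_compression_sub (h : IsAdapted Φ g γ a S) {s : I} (hs : γ s = 1) (z : A) :
    Tendsto (fun t => evM s (h.compression.toFun t z) - evM s (Φ.toFun t z)) atTop (𝓝 0) := by
  obtain ⟨M, hM⟩ := h.isAsympFamily.bdd z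
  have h2 : Tendsto (fun t => h.compression.toFun t z - seq Φ g γ S (g.index t) z) atTop (𝓝 0) :=
    squeeze_zero_norm (fun t => g.norm_interp_sub_le (fun k => seq Φ g γ S k z) t)
      (by simpa using ((h.tendsto_seq_succ_sub z).comp g.tendsto_index).norm)
  have h3 : Tendsto (fun t => Φ.toFun (g.pt (g.index t)) z - Φ.toFun t z) atTop (𝓝 0) := by
    rw [NormedAddGroup.tendsto_nhds_zero]
    intro ε hε
    obtain ⟨K, hK⟩ := h.slowOn z (ε / 2) (half_pos hε)
    filter_upwards [g.tendsto_index.eventually (eventually_ge_atTop K)] with t ht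
    exact (hK _ ht _ _ le_rfl (g.strictMono.monotone (Nat.le_succ _)) (g.pt_le t)
      (g.lt_pt_succ t).le).trans_lt (half_lt_self hε)
  have h4 := (h2.add ((h.tendsto_T_const_sub z).comp g.tendsto_index)).add h3
  rw [add_zero, add_zero] at h4
  refine squeeze_zero_norm (fun t => ?_) (by simpa using h4.norm)
  have e : evM s (seq Φ g γ S (g.index t) z)
      = evM s (S.T (g.index t) fun _ => Φ.toFun (g.pt (g.index t)) z) :=
    evM_T_congr (hM _) (fun _ => le_rfl) fun n hn => by
      rw [evM_cutoffFamily, g.cutoff_of_eq_one hn hs]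
  have e' : evM s (h.compression.toFun t z) - evM s (Φ.toFun t z)
      = evM s (h.compression.toFun t z - seq Φ g γ S (g.index t) z
        + (S.T (g.index t) (fun _ => Φ.toFun (g.pt (g.index t)) z)
          - Φ.toFun (g.pt (g.index t)) z)
        + (Φ.toFun (g.pt (g.index t)) z - Φ.toFun t z)) := by
    simp only [map_add, map_sub, e]
    abel
  rw [e']
  exact norm_evM_le _ _

/-- Where `γ = 0`, the compression is constantly extended. -/
theorem evM_compression_sub_mem (h : IsAdapted Φ g γ a S) {s : I} (hs : γ s = 0)
    (t : Set.Ici (1 : ℝ)) (z : A) :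
    evM s (h.compression.toFun t z) - evM s (h.compression.toFun start z) ∈ inM B := by
  obtain ⟨M, hM⟩ := h.isAsympFamily.bdd z
  simp only [evM_compression]
  refine g.interp_sub_mem _ (fun c _ => inM_smul c) (fun k => ?_) t
  have h1 : evM s (S.T (k + 1) fun n => cutoffFamily g γ Φ.isAsymptoticHom (k + 1) n z
      - cutoffFamily g γ Φ.isAsymptoticHom k n z) = 0 :=
    evM_T_eq_zero (fun n => norm_sub_le_of_le (hM _ n) (hM k n)) fun n _ => by
      rw [map_sub, sub_eq_zero, evM_cutoffFamily, evM_cutoffFamily,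
        g.cutoff_of_eq_zero _ _ hs, g.cutoff_of_eq_zero _ _ hs]
  have h2 := evM_mem s (h.seq_succ_sub_mem k z)
  rwa [map_sub, h1, sub_zero, map_sub] at h2

/-- The compression is constantly extended everywhere if the given homotopy is constantly extended,
through functions in `C([0,1], B)`, on the set where `γ ≠ 0`. -/
theorem compression_sub_mem (h : IsAdapted Φ g γ a S) {z : A} {f : Set.Ici (1 : ℝ) → C(I, B)}
    (hfc : Continuous f)
    (hf : ∀ t s, γ s ≠ 0 → evM s (Φ.toFun t z) - evM s (Φ.toFun start z) = toM (f t s))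
    (t : Set.Ici (1 : ℝ)) :
    h.compression.toFun t z - h.compression.toFun start z ∈ inM C(I, B) := by
  refine g.interp_sub_mem _ (fun c _ => inM_smul c) (fun k => ?_) t
  generalize hy : cutoffFamily g γ Φ.isAsymptoticHom = y
  have hind : ∀ n ≥ k + 1, y (k + 1) n z - y k n z = y (k + 1) (k + 1) z - y k (k + 1) z := by
    subst hy
    intro n hn
    refine evM_ext fun s => ?_
    simp only [map_sub, evM_cutoffFamily]
    rcases g.cutoff_succ (γ := γ) k s with h1 | h1
    · rw [h1, h1, sub_self, sub_self]
    · rw [(h1 n hn).1, (h1 n hn).2, (h1 (k + 1) le_rfl).1]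
  have hq : y (k + 1) (k + 1) z - y k (k + 1) z ∈ inM C(I, B) := by
    subst hy
    refine ⟨⟨fun s => f (g.cutoff γ (k + 1) (k + 1) s) s - f (g.cutoff γ k (k + 1) s) s, ?_⟩, ?_⟩
    · exact ((hfc.comp (g.cutoff γ (k + 1) (k + 1)).continuous).eval continuous_id).sub
        ((hfc.comp (g.cutoff γ k (k + 1)).continuous).eval continuous_id)
    · refine evM_ext fun s => ?_
      rw [map_sub, evM_cutoffFamily, evM_cutoffFamily]
      change toM (f (g.cutoff γ (k + 1) (k + 1) s) s - f (g.cutoff γ k (k + 1) s) s) = _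
      by_cases hs : γ s = 0
      · rw [g.cutoff_of_eq_zero _ _ hs, g.cutoff_of_eq_zero _ _ hs, sub_self, sub_self, map_zero]
      · rw [map_sub, ← hf _ s hs, ← hf _ s hs, sub_sub_sub_cancel_right]
  have h1 : S.T (k + 1) (fun n => y (k + 1) n z - y k n z) ∈ inM C(I, B) := by
    rw [QCSystem.T_congr hind]
    exact h.const_mem _ hq _
  have h2 := add_mem (h.seq_succ_sub_mem k z) (hy ▸ h1)
  rwa [sub_add_cancel] at h2

end IsAdapted

end Compressions

/-! ### Homotopies, and the bijection -/

section Homotopies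

variable {A B : Type*} [NonUnitalCStarAlgebra A] [NonUnitalCStarAlgebra B]
  {J : NonUnitalStarSubalgebra ℂ A}

/-- The multiplier of `C([0,1], B)` whose value at `s` is `s • m`. -/
noncomputable def rampM (m : 𝓜(ℂ, B)) : 𝓜(ℂ, C(I, B)) :=
  ofFamily (fun s => ((s : ℝ) : ℂ) • m) ‖m‖
    (fun s => by
      rw [norm_smul, Complex.norm_real, Real.norm_of_nonneg s.2.1]
      exact mul_le_of_le_one_left (norm_nonneg m) s.2.2)
    (fun b => by
      have h : Continuous fun s : I => ((s : ℝ) : ℂ) • m.fst b := by fun_prop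
      exact h)
    fun b => by
      have h : Continuous fun s : I => ((s : ℝ) : ℂ) • m.snd b := by fun_prop
      exact h

theorem evM_rampM (m : 𝓜(ℂ, B)) (s : I) : evM s (rampM m) = ((s : ℝ) : ℂ) • m := by
  rw [rampM, evM_ofFamily]

theorem evM_constM (m : 𝓜(ℂ, B)) (s : I) : evM s (constM m) = m := by
  rw [constM, evM_ofFamily]

theorem rampM_sub (m n : 𝓜(ℂ, B)) : rampM (m - n) = rampM m - rampM n :=
  evM_ext fun s => by rw [map_sub, evM_rampM, evM_rampM, evM_rampM, smul_sub]

theorem norm_rampM_le (m : 𝓜(ℂ, B)) : ‖rampM m‖ ≤ ‖m‖ :=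
  norm_le_of_evM (norm_nonneg m) fun s => by
    rw [evM_rampM, norm_smul, Complex.norm_real, Real.norm_of_nonneg s.2.1]
    exact mul_le_of_le_one_left (norm_nonneg m) s.2.2

theorem continuous_rampM : Continuous (rampM : 𝓜(ℂ, B) → 𝓜(ℂ, C(I, B))) :=
  (LipschitzWith.of_dist_le_mul (K := 1) fun m n => by
    rw [dist_eq_norm, dist_eq_norm, ← rampM_sub, NNReal.coe_one, one_mul]
    exact norm_rampM_le _).continuous

theorem rampM_mem {m : 𝓜(ℂ, B)} (h : m ∈ inM B) : rampM m ∈ inM C(I, B) := by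
  obtain ⟨b, rfl⟩ := h
  refine ⟨⟨fun s => ((s : ℝ) : ℂ) • b, by fun_prop⟩, evM_ext fun s => ?_⟩
  rw [evM_rampM]
  exact map_smul toM _ _

namespace ExtHom

/-- The straight-line homotopy between asymptotic extended asymptotic homomorphisms. -/
noncomputable def line (φ ψ : ExtHom J B)
    (h : ∀ a, Tendsto (fun t => ψ.toFun t a - φ.toFun t a) atTop (𝓝 0)) : ExtHom J C(I, B) where
  toFun t a := constM (φ.toFun t a) + rampM (ψ.toFun t a - φ.toFun t a)
  isAsymptoticHom :=
    (φ.const.isAsymptoticHom.isAsympMul.perturb fun a => squeeze_zero_norm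
      (fun t => (congrArg norm (add_sub_cancel_left (constM (φ.toFun t a)) _)).trans_le
        (norm_rampM_le _)) (by simpa using (h a).norm)).isAsymptoticHom fun a =>
      (φ.const.isAsymptoticHom.continuous a).add (continuous_rampM.comp
        ((ψ.isAsymptoticHom.continuous a).sub (φ.isAsymptoticHom.continuous a)))
  extended t x hx := add_mem (constM_mem (φ.extended t x hx))
    (rampM_mem (sub_mem (ψ.extended t x hx) (φ.extended t x hx)))

theorem evM_zero_line (φ ψ : ExtHom J B)
    (h : ∀ a, Tendsto (fun t => ψ.toFun t a - φ.toFun t a) atTop (𝓝 0)) (t : Set.Ici (1 : ℝ))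
    (a : A) : evM 0 ((φ.line ψ h).toFun t a) = φ.toFun t a := by
  simp only [line, map_add, evM_constM, evM_rampM]
  simp

theorem evM_one_line (φ ψ : ExtHom J B)
    (h : ∀ a, Tendsto (fun t => ψ.toFun t a - φ.toFun t a) atTop (𝓝 0)) (t : Set.Ici (1 : ℝ))
    (a : A) : evM 1 ((φ.line ψ h).toFun t a) = ψ.toFun t a := by
  simp only [line, map_add, evM_constM, evM_rampM]
  simp

theorem homotopic_of_tendsto {φ ψ : ExtHom J B}
    (h : ∀ a, Tendsto (fun t => ψ.toFun t a - φ.toFun t a) atTop (𝓝 0)) :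
    ExtHom.Homotopic J B φ ψ :=
  ⟨φ.line ψ h, φ.evM_zero_line ψ h, φ.evM_one_line ψ h⟩

/-- The value at `s` of a homotopy. -/
noncomputable def eval (Φ : ExtHom J C(I, B)) (s : I) : ExtHom J B where
  toFun t a := evM s (Φ.toFun t a)
  isAsymptoticHom := by
    have hc : Continuous (evM s : 𝓜(ℂ, C(I, B)) →⋆ₐ[ℂ] 𝓜(ℂ, B)) :=
      AddMonoidHomClass.continuous_of_bound _ 1 fun m => by
        rw [one_mul]; exact norm_evM_le s m
    have h0 := hc.tendsto 0
    rw [map_zero] at h0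
    have h := Φ.isAsymptoticHom
    refine ⟨fun a => hc.comp (h.continuous a), fun a b => (h0.comp (h.add a b)).congr fun t => ?_,
      fun c a => (h0.comp (h.smul c a)).congr fun t => ?_,
      fun a b => (h0.comp (h.mul a b)).congr fun t => ?_,
      fun a => (h0.comp (h.star a)).congr fun t => ?_⟩
    all_goals simp only [Function.comp_apply, map_sub, map_add, map_smul, map_mul, map_star]
  extended t x hx := evM_mem s (Φ.extended t x hx)

/-- The constant homotopy at `φ`, followed by `Φ`, followed by the constant homotopy at `ψ`. -/
noncomputable def pad {φ ψ : ExtHom J B} (Φ : ExtHom J C(I, B))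
    (h0 : ∀ t a, evM 0 (Φ.toFun t a) = φ.toFun t a)
    (h1 : ∀ t a, evM 1 (Φ.toFun t a) = ψ.toFun t a) : ExtHom J C(I, B) :=
  (φ.const.trans Φ fun t a => (h0 t a).symm).trans ψ.const fun t a =>
    (evM_one_transM _ _ (h0 t a).symm).trans (h1 t a)

variable {φ ψ : ExtHom J B} (Φ : ExtHom J C(I, B))
  (h0 : ∀ t a, evM 0 (Φ.toFun t a) = φ.toFun t a)
  (h1 : ∀ t a, evM 1 (Φ.toFun t a) = ψ.toFun t a)

theorem evM_pad_of_le {s : I} (hs : (s : ℝ) ≤ 1 / 4) (t : Set.Ici (1 : ℝ)) (a : A) :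
    evM s ((pad Φ h0 h1).toFun t a) = φ.toFun t a := by
  simp only [pad, ExtHom.trans, evM_transM, ExtHom.const, evM_constM]
  rw [glue, if_pos (by linarith), glue, if_pos]
  · rw [Set.coe_projIcc]
    exact max_le (by norm_num) (min_le_of_right_le (by linarith))

theorem evM_pad_of_lt {s : I} (hs : 1 / 2 < (s : ℝ)) (t : Set.Ici (1 : ℝ)) (a : A) :
    evM s ((pad Φ h0 h1).toFun t a) = ψ.toFun t a := by
  simp only [pad, ExtHom.trans, evM_transM, ExtHom.const, evM_constM]
  rw [glue, if_neg (not_le.2 hs)]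

end ExtHom

theorem ConstExtHom.homotopic_of_tendsto {φ ψ : ConstExtHom J B}
    (h : ∀ a, Tendsto (fun t => ψ.toFun t a - φ.toFun t a) atTop (𝓝 0)) :
    ConstExtHom.Homotopic J B φ ψ := by
  refine ⟨⟨φ.toExtHom.line ψ.toExtHom h, fun t a => ?_⟩, φ.toExtHom.evM_zero_line ψ.toExtHom h,
    φ.toExtHom.evM_one_line ψ.toExtHom h⟩
  have e : (φ.toExtHom.line ψ.toExtHom h).toFun t a
      - (φ.toExtHom.line ψ.toExtHom h).toFun start a
      = constM (φ.toFun t a - φ.toFun start a)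
        + rampM ((ψ.toFun t a - ψ.toFun start a) - (φ.toFun t a - φ.toFun start a)) := by
    simp only [ExtHom.line, constM_sub, rampM_sub]
    abel
  rw [e]
  exact add_mem (constM_mem (φ.constant t a))
    (rampM_mem (sub_mem (ψ.constant t a) (φ.constant t a)))

/-- The differences `φ_t a - φ_1 a` form a continuous path in `B`. -/
theorem ConstExtHom.exists_path (φ : ConstExtHom J B) (a : A) :
    ∃ b : Set.Ici (1 : ℝ) → B, Continuous b ∧
      ∀ t, toM (b t) = φ.toFun t a - φ.toFun start a := by
  choose b hb using fun t => φ.constant t a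
  refine ⟨b, ?_, hb⟩
  refine (Isometry.isEmbedding (isometry_toM (D := B))).isInducing.continuous_iff.2 ?_
  convert (φ.isAsymptoticHom.continuous a).sub continuous_const using 1
  exact funext hb

/-- A function on `[0,1]` that is `1` at the end points and is supported in
`[0, 1/4] ∪ [1/2, 1]`. -/
noncomputable def endCutoff : C(I, I) where
  toFun s := Set.projIcc 0 1 zero_le_one (max (1 - 4 * (s : ℝ)) (2 * (s : ℝ) - 1))
  continuous_toFun := continuous_projIcc.comp (by fun_prop)

theorem endCutoff_zero : endCutoff 0 = 1 :=
  Set.projIcc_of_right_le zero_le_one (by norm_num)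

theorem endCutoff_one : endCutoff 1 = 1 :=
  Set.projIcc_of_right_le zero_le_one (by norm_num)

theorem le_or_lt_of_endCutoff_ne {s : I} (hs : endCutoff s ≠ 0) :
    (s : ℝ) ≤ 1 / 4 ∨ 1 / 2 < (s : ℝ) := by
  by_contra! h
  exact hs (Set.projIcc_of_le_left zero_le_one (max_le (by linarith) (by linarith)))

variable [TopologicalSpace.SeparableSpace A] [TopologicalSpace.SeparableSpace B]

/-- Every extended asymptotic homomorphism is homotopic to a constantly extended one: compress the
constant homotopy, with a cut-off at time `1 / (1 - s)`. -/
theorem ExtHom.exists_homotopic_constExtHom (φ : ExtHom J B) :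
    ∃ ψ : ConstExtHom J B, ExtHom.Homotopic J B ψ.toExtHom φ := by
  obtain ⟨g, a, S, h⟩ := exists_isAdapted φ.const ⟨σ, unitInterval.continuous_symm⟩
  refine ⟨⟨h.compression.eval 1, fun t x =>
    h.evM_compression_sub_mem unitInterval.symm_one t x⟩, ?_⟩
  have h1 : ExtHom.Homotopic J B (h.compression.eval 0) (h.compression.eval 1) :=
    ⟨h.compression, fun _ _ => rfl, fun _ _ => rfl⟩
  have h2 : ExtHom.Homotopic J B φ (h.compression.eval 0) :=
    ExtHom.homotopic_of_tendsto fun z =>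
      h.tendsto_evM_compression_sub unitInterval.symm_zero z
  exact (ExtHom.equivalence J B).symm ((ExtHom.equivalence J B).trans h2 h1)

/-- An extended homotopy between constantly extended asymptotic homomorphisms can be replaced by a
constantly extended one: pad it by constant homotopies, and compress it with a cut-off that is
trivial at the end points and effective only where the padded homotopy is constantly extended. -/
theorem ConstExtHom.homotopic_of_extHom_homotopic {φ ψ : ConstExtHom J B}
    (hφψ : ExtHom.Homotopic J B φ.toExtHom ψ.toExtHom) : ConstExtHom.Homotopic J B φ ψ := by
  obtain ⟨Φ, h0, h1⟩ := hφψ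
  obtain ⟨g, a, S, h⟩ := exists_isAdapted (ExtHom.pad Φ h0 h1) endCutoff
  have hconst : ∀ t z, h.compression.toFun t z - h.compression.toFun start z ∈ inM C(I, B) := by
    intro t z
    obtain ⟨b, hb, hφ⟩ := φ.exists_path z
    obtain ⟨c, hc, hψ⟩ := ψ.exists_path z
    -- `p` is `0` on `[0, 1/4]` and `1` on `[1/2, 1]`
    let p : I → ℝ := fun s => (Set.projIcc (0 : ℝ) 1 zero_le_one (4 * (s : ℝ) - 1) : ℝ)
    have hp : Continuous p := continuous_subtype_val.comp (continuous_projIcc.comp (by fun_prop))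
    let f : C(Set.Ici (1 : ℝ) × I, B) :=
      ⟨fun q => b q.1 + (p q.2 : ℂ) • (c q.1 - b q.1), by fun_prop⟩
    refine h.compression_sub_mem (f := f.curry) f.curry.continuous (fun t s hs => ?_) t
    change _ = toM (b t + (p s : ℂ) • (c t - b t))
    rcases le_or_lt_of_endCutoff_ne hs with hs | hs
    · have : p s = 0 := congrArg Subtype.val (Set.projIcc_of_le_left zero_le_one (by linarith))
      rw [this, Complex.ofReal_zero, zero_smul, add_zero, hφ, ExtHom.evM_pad_of_le Φ h0 h1 hs,
        ExtHom.evM_pad_of_le Φ h0 h1 hs]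
    · have : p s = 1 := congrArg Subtype.val (Set.projIcc_of_right_le zero_le_one (by linarith))
      rw [this, Complex.ofReal_one, one_smul, add_sub_cancel, hψ, ExtHom.evM_pad_of_lt Φ h0 h1 hs,
        ExtHom.evM_pad_of_lt Φ h0 h1 hs]
  have hφ : ConstExtHom.Homotopic J B φ
      ⟨h.compression.eval 0, fun t z => by
        have := evM_mem 0 (hconst t z)
        rwa [map_sub] at this⟩ :=
    ConstExtHom.homotopic_of_tendsto fun z =>
      (h.tendsto_evM_compression_sub endCutoff_zero z).congr fun t => by
        rw [ExtHom.evM_pad_of_le Φ h0 h1 (by norm_num)]; rfl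
  have hψ : ConstExtHom.Homotopic J B ψ
      ⟨h.compression.eval 1, fun t z => by
        have := evM_mem 1 (hconst t z)
        rwa [map_sub] at this⟩ :=
    ConstExtHom.homotopic_of_tendsto fun z =>
      (h.tendsto_evM_compression_sub endCutoff_one z).congr fun t => by
        rw [ExtHom.evM_pad_of_lt Φ h0 h1 (by norm_num)]; rfl
  refine (ConstExtHom.equivalence J B).trans hφ
    ((ConstExtHom.equivalence J B).trans ?_ ((ConstExtHom.equivalence J B).symm hψ))
  exact ⟨⟨h.compression, hconst⟩, fun _ _ => rfl, fun _ _ => rfl⟩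

end Homotopies

end AsympExt

theorem theorem4p1 {A B : Type*} [NonUnitalCStarAlgebra A] [NonUnitalCStarAlgebra B]
    [TopologicalSpace.SeparableSpace A] [TopologicalSpace.SeparableSpace B]
    (J : NonUnitalStarSubalgebra ℂ A) (hJ : IsClosed (J : Set A)) :
    Function.Bijective (AsympExt.forget J B) := by
  constructor
  · rintro ⟨φ⟩ ⟨ψ⟩ h
    exact Quotient.sound (AsympExt.ConstExtHom.homotopic_of_extHom_homotopic (Quotient.exact h))
  · rintro ⟨φ⟩
    obtain ⟨ψ, h⟩ := φ.exists_homotopic_constExtHom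
    exact ⟨Quotient.mk _ ψ, Quotient.sound h⟩
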